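/- Let $\mathbf{Ope}$ be the category of small non-symmetric (coloured) operads, i.e. multicategories, and functors between them, and let $\mathbf{Ope}_\Sigma$ be the category of small symmetric (coloured) operads and functors (compatible with the actions of the symmetric groups). In an operad, an isomorphism is a unary morphism that is invertible for the composition of unary morphisms. **Theorem.** Each of the categories $\mathbf{Ope}$ and $\mathbf{Ope}_\Sigma$ has all small limits and colimits and carries a Quillen model structure in which - the weak equivalences are the functors $F:\mathcal P\to\mathcal Q$ that are essentially surjective (every object of $\mathcal Q$ is the target of an isomorphism from some $Fp$) and fully faithful (every function $\mathcal P(p_1,\dots,p_n;p_0)\to\mathcal Q(Fp_1,\dots,Fp_n;Fp_0)$, $n\ge 0$, is a bijection); - the cofibrations are the functors that are injective on objects; - the fibrations are the functors $F:\mathcal P\to\mathcal Q$ such that for every object $p$ of $\mathcal P$ and every isomorphism $\psi:Fp\to q$ in $\mathcal Q$ there is an isomorphism $\phi:p\to p'$ in $\mathcal P$ with $F\phi=\psi$. This model structure is cofibrantly generated, in both cases, by the following sets $I$ of generating cofibrations and $J$ of generating trivial cofibrations: $$I=\{\emptyset\to\star\}\cup\{\partial Ar_n\to Ar_n\mid n\ge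 0\}\cup\{PAr_n\to Ar_n\mid n\ge 0\},\qquad J=\{\star\to H\}.$$ That is, $I$ and $J$ permit the small object argument, the trivial fibrations are exactly the functors with the right lifting property with respect to $I$, and the fibrations are exactly the functors with the right lifting property with respect to $J$. Here $\emptyset$ is the operad without objects; $\star$ is the operad with one object and only the identity morphism; $H$ is the free-living isomorphism, with two objects, whose only morphisms are the two identities and two mutually inverse unary morphisms between the two objects, and $\star\to H$ is either one of the two functors from $\star$ to $H$; $Ar_n$ is the operad (symmetric operad in the case of $\mathbf{Ope}_\Sigma$) with objects $0,1,\dots,n$ freely generated by one morphism $(1,\dots,n)\to 0$; $\partial Ar_n\subseteq Ar_n$ is the suboperad with the same objects and only the identity morphisms; $PAr_n$ is the operad (symmetric operad) with objects $0,1,\dots,n$ freely generated by two distinct morphisms $(1,\dots,n)\to 0$; and $PAr_n\to Ar_n$ is the identity on objects and identifies the two generators. -/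

import Mathlib

open CategoryTheory HomotopicalAlgebra

universe u v w

/-- The concatenation `q₁¹, …, q¹_{k₁}, …, qⁿ₁, …, qⁿ_{kₙ}` of `n` finite sequences:
`finSigmaFinEquiv` enumerates the pairs `⟨i, j⟩` in lexicographic order. -/
abbrev concat {X : Type u} {n : ℕ} {k : Fin n → ℕ} (q : ∀ i, Fin (k i) → X) :
    Fin (∑ i, k i) → X :=
  fun j => q (finSigmaFinEquiv.symm j).1 (finSigmaFinEquiv.symm j).2

/-- A (small) non-symmetric operad, i.e. a multicategory. `Hom p b` is the set of morphisms
`p 0, …, p (n - 1) → b`, for `n ≥ 0`. In the laws, the two sides have inputs that are equal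
as finite sequences but not syntactically so, hence the heterogeneous equalities. -/
structure NSOperad where
  Ob : Type u
  Hom : {n : ℕ} → (Fin n → Ob) → Ob → Type u
  id : (a : Ob) → Hom (fun _ : Fin 1 => a) a
  comp : {n : ℕ} → {p : Fin n → Ob} → {b : Ob} → Hom p b →
    {k : Fin n → ℕ} → {q : ∀ i, Fin (k i) → Ob} → (∀ i, Hom (q i) (p i)) → Hom (concat q) b
  id_comp : ∀ {n : ℕ} {p : Fin n → Ob} {b : Ob} (ψ : Hom p b),
    HEq (comp (id b) (fun _ : Fin 1 => ψ)) ψ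
  comp_id : ∀ {n : ℕ} {p : Fin n → Ob} {b : Ob} (ψ : Hom p b),
    HEq (comp ψ (fun i => id (p i))) ψ
  assoc : ∀ {n : ℕ} {p : Fin n → Ob} {b : Ob} (ψ : Hom p b)
    {k : Fin n → ℕ} {q : ∀ i, Fin (k i) → Ob} (φ : ∀ i, Hom (q i) (p i))
    {l : ∀ i, Fin (k i) → ℕ} {r : ∀ i (j : Fin (k i)), Fin (l i j) → Ob}
    (χ : ∀ i (j : Fin (k i)), Hom (r i j) (q i j)),
    HEq (comp ψ (fun i => comp (φ i) (χ i)))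
      (comp (comp ψ φ)
        (fun j => χ (finSigmaFinEquiv.symm j).1 (finSigmaFinEquiv.symm j).2))

/-- The block sum `τ₁ ⊕ … ⊕ τₙ`. -/
def blockSum {n : ℕ} {k k' : Fin n → ℕ} (τ : ∀ i, Fin (k' i) ≃ Fin (k i)) :
    Fin (∑ i, k' i) ≃ Fin (∑ i, k i) :=
  finSigmaFinEquiv.symm.trans ((Equiv.sigmaCongrRight τ).trans finSigmaFinEquiv)

/-- The permutation of `n` blocks of lengths `k₁, …, kₙ` induced by `σ`. -/
def blockPerm {m n : ℕ} (σ : Fin m ≃ Fin n) (k : Fin n → ℕ) :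
    Fin (∑ i, k (σ i)) ≃ Fin (∑ i, k i) :=
  finSigmaFinEquiv.symm.trans ((Equiv.sigmaCongrLeft (β := fun i => Fin (k i)) σ).trans
    finSigmaFinEquiv)

/-- A (small) symmetric operad. `act σ` is `σ^*`. Since a bijection `Fin m ≃ Fin n` exists only
for `m = n`, these are the permutations; allowing `m` and `n` to be only propositionally equal
avoids transports in the equivariance laws. -/
structure SymOperad extends NSOperad.{u} where
  act : {m n : ℕ} → (σ : Fin m ≃ Fin n) → {p : Fin n → Ob} → {b : Ob} → Hom p b →
    Hom (fun i => p (σ i)) b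
  act_refl : ∀ {n : ℕ} {p : Fin n → Ob} {b : Ob} (ψ : Hom p b), act (Equiv.refl (Fin n)) ψ = ψ
  act_act : ∀ {l m n : ℕ} (τ : Fin l ≃ Fin m) (σ : Fin m ≃ Fin n) {p : Fin n → Ob} {b : Ob}
    (ψ : Hom p b), act τ (act σ ψ) = act (τ.trans σ) ψ
  comp_act : ∀ {n : ℕ} {p : Fin n → Ob} {b : Ob} (ψ : Hom p b)
    {k k' : Fin n → ℕ} {q : ∀ i, Fin (k i) → Ob} (φ : ∀ i, Hom (q i) (p i))
    (τ : ∀ i, Fin (k' i) ≃ Fin (k i)),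
    HEq (comp ψ (fun i => act (τ i) (φ i))) (act (blockSum τ) (comp ψ φ))
  act_comp : ∀ {m n : ℕ} (σ : Fin m ≃ Fin n) {p : Fin n → Ob} {b : Ob} (ψ : Hom p b)
    {k : Fin n → ℕ} {q : ∀ i, Fin (k i) → Ob} (φ : ∀ i, Hom (q i) (p i)),
    HEq (comp (act σ ψ) (fun i => φ (σ i))) (act (blockPerm σ k) (comp ψ φ))

/-- A functor between non-symmetric operads. -/
@[ext]
structure NSOperad.Map (P Q : NSOperad.{u}) where
  obj : P.Ob → Q.Ob
  map : {n : ℕ} → {p : Fin n → P.Ob} → {b : P.Ob} → P.Hom p b →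
    Q.Hom (fun i => obj (p i)) (obj b)
  map_id : ∀ a : P.Ob, map (P.id a) = Q.id (obj a)
  map_comp : ∀ {n : ℕ} {p : Fin n → P.Ob} {b : P.Ob} (ψ : P.Hom p b)
    {k : Fin n → ℕ} {q : ∀ i, Fin (k i) → P.Ob} (φ : ∀ i, P.Hom (q i) (p i)),
    map (P.comp ψ φ) = Q.comp (map ψ) (fun i => map (φ i))

/-- A functor between symmetric operads. -/
@[ext]
structure SymOperad.Map (P Q : SymOperad.{u}) extends NSOperad.Map P.toNSOperad Q.toNSOperad where
  map_act : ∀ {m n : ℕ} (σ : Fin m ≃ Fin n) {p : Fin n → P.Ob} {b : P.Ob} (ψ : P.Hom p b),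
    map (P.act σ ψ) = Q.act σ (map ψ)

/-- The category of small non-symmetric operads. -/
instance : Category.{u} NSOperad.{u} where
  Hom := NSOperad.Map
  id P := { obj := fun a => a, map := fun ψ => ψ, map_id := fun _ => rfl,
            map_comp := fun _ _ _ _ => rfl }
  comp F G :=
    { obj := fun a => G.obj (F.obj a)
      map := fun ψ => G.map (F.map ψ)
      map_id := fun a => by rw [F.map_id, G.map_id]
      map_comp := fun ψ _ _ φ => by rw [F.map_comp, G.map_comp] }

/-- The category of small symmetric operads. -/
instance : Category.{u} SymOperad.{u} where
  Hom := SymOperad.Map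
  id P := { obj := fun a => a, map := fun ψ => ψ, map_id := fun _ => rfl,
            map_comp := fun _ _ _ _ => rfl, map_act := fun _ _ _ _ => rfl }
  comp F G :=
    { obj := fun a => G.obj (F.obj a)
      map := fun ψ => G.map (F.map ψ)
      map_id := fun a => by rw [F.map_id, G.map_id]
      map_comp := fun ψ _ _ φ => by rw [F.map_comp, G.map_comp]
      map_act := fun σ _ _ ψ => by rw [F.map_act, G.map_act] }

/-- The functor that forgets the actions of the symmetric groups. -/
def SymOperad.forget : SymOperad.{u} ⥤ NSOperad.{u} where
  obj P := P.toNSOperad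
  map F := F.toMap

/-! ### Weak equivalences, cofibrations and fibrations -/

/-- A unary morphism `f : a → b` is an isomorphism (in the category of unary morphisms). -/
def NSOperad.IsIsomorphism (P : NSOperad.{u}) {a b : P.Ob} (f : P.Hom (fun _ : Fin 1 => a) b) :
    Prop :=
  ∃ g : P.Hom (fun _ : Fin 1 => b) a,
    HEq (P.comp g (fun _ : Fin 1 => f)) (P.id a) ∧ HEq (P.comp f (fun _ : Fin 1 => g)) (P.id b)

/-- The operadic equivalences: the essentially surjective and fully faithful functors. -/
def NSOperad.equivalences : MorphismProperty NSOperad.{u} := fun P Q F =>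
  (∀ q : Q.Ob, ∃ (p : P.Ob) (f : Q.Hom (fun _ : Fin 1 => NSOperad.Map.obj F p) q),
    Q.IsIsomorphism f) ∧
  ∀ {n : ℕ} (p : Fin n → P.Ob) (b : P.Ob),
    Function.Bijective (fun ψ : P.Hom p b => NSOperad.Map.map F ψ)

/-- The functors that are injective on objects. -/
def NSOperad.injectiveOnObjects : MorphismProperty NSOperad.{u} := fun _ _ F =>
  Function.Injective (NSOperad.Map.obj F)

/-- The functors `F : P → Q` such that every isomorphism `ψ : F p → q` of `Q` is `F φ` for some
isomorphism `φ : p → p'` of `P`. -/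
def NSOperad.isofibrations : MorphismProperty NSOperad.{u} := fun P Q F =>
  ∀ (p : P.Ob) (q : Q.Ob) (ψ : Q.Hom (fun _ : Fin 1 => NSOperad.Map.obj F p) q),
    Q.IsIsomorphism ψ →
    ∃ (p' : P.Ob) (φ : P.Hom (fun _ : Fin 1 => p) p'), P.IsIsomorphism φ ∧
      NSOperad.Map.obj F p' = q ∧ HEq (NSOperad.Map.map F φ) ψ

def SymOperad.equivalences : MorphismProperty SymOperad.{u} :=
  NSOperad.equivalences.inverseImage SymOperad.forget

def SymOperad.injectiveOnObjects : MorphismProperty SymOperad.{u} :=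
  NSOperad.injectiveOnObjects.inverseImage SymOperad.forget

def SymOperad.isofibrations : MorphismProperty SymOperad.{u} :=
  NSOperad.isofibrations.inverseImage SymOperad.forget

/-! ### Cofibrantly generated model structures -/

/-- The classes `W`, `Cof`, `Fib` are the weak equivalences, cofibrations and fibrations of a
Quillen model structure on the category `C`, which has all small limits and colimits, and this
model structure is cofibrantly generated by the set `I` of generating cofibrations and the set
`J` of generating trivial cofibrations. -/
def IsCofibrantlyGeneratedModelStructure {C : Type w} [Category.{v} C]
    (W Cof Fib I J : MorphismProperty C) : Prop :=
  Limits.HasLimits C ∧ Limits.HasColimits C ∧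
  ∃ _ : ModelCategory C,
    weakEquivalences C = W ∧ cofibrations C = Cof ∧ fibrations C = Fib ∧
    MorphismProperty.HasSmallObjectArgument.{v} I ∧
    MorphismProperty.HasSmallObjectArgument.{v} J ∧
    trivialFibrations C = I.rlp ∧
    fibrations C = J.rlp

/-! ### Auxiliary facts on concatenation -/

theorem concat_apply {X : Type u} {n : ℕ} {k : Fin n → ℕ} (q : ∀ i, Fin (k i) → X)
    (s : (i : Fin n) × Fin (k i)) : concat q (finSigmaFinEquiv s) = q s.1 s.2 :=
  congrArg (fun t : (i : Fin n) × Fin (k i) => q t.1 t.2) (finSigmaFinEquiv.symm_apply_apply s)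

theorem ofFn_concat {X : Type u} {n : ℕ} {k : Fin n → ℕ} (q : ∀ i, Fin (k i) → X) :
    List.ofFn (concat q) = (List.ofFn fun i => List.ofFn (q i)).flatten := by
  induction n with
  | zero => simp [List.ofFn_eq_nil_iff]
  | succ n ih =>
    have e : ∑ i, k i = (∑ i : Fin n, k i.castSucc) + k (Fin.last n) := Fin.sum_univ_castSucc k
    have h : (fun j => concat q (Fin.cast e.symm j)) =
        Fin.append (concat fun i : Fin n => q i.castSucc) (q (Fin.last n)) := by
      have key : ∀ (i : Fin (n + 1)) (t : Fin (k i)) (j : Fin (∑ i, k i)),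
          j = finSigmaFinEquiv ⟨i, t⟩ → concat q j = q i t := by
        rintro i t _ rfl
        exact concat_apply q ⟨i, t⟩
      funext j
      refine Fin.addCases (fun x => ?_) (fun y => ?_) j
      · obtain ⟨⟨i, t⟩, rfl⟩ := finSigmaFinEquiv.surjective x
        rw [Fin.append_left, key i.castSucc t]
        · exact (concat_apply (fun i : Fin n => q i.castSucc) ⟨i, t⟩).symm
        · apply Fin.ext
          simp only [Fin.val_cast, Fin.val_castAdd, finSigmaFinEquiv_apply]
          rfl
      · rw [Fin.append_right, key (Fin.last n) y]
        apply Fin.ext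
        simp only [Fin.val_cast, Fin.val_natAdd, finSigmaFinEquiv_apply]
        rfl
    rw [List.ofFn_congr e, h, List.ofFn_fin_append, ih, List.ofFn_succ_last]
    simp

theorem ofFn_concat_of_singleton {X : Type u} {n : ℕ} {k : Fin n → ℕ} {p : Fin n → X}
    {q : ∀ i, Fin (k i) → X} (h : ∀ i, List.ofFn (q i) = [p i]) :
    List.ofFn (concat q) = List.ofFn p := by
  rw [ofFn_concat]
  simp only [h]
  rw [show (fun i => [p i]) = (fun x => [x]) ∘ p from rfl, ← List.map_ofFn]
  rw [← List.flatMap_def, List.flatMap_singleton']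

theorem ofFn_concat_of_one {X : Type u} {n : ℕ} {k : Fin n → ℕ} {p : Fin n → X} {b : X}
    {q : ∀ i, Fin (k i) → X} (h : List.ofFn p = [b]) :
    ∃ i, p i = b ∧ List.ofFn (concat q) = List.ofFn (q i) ∧ ∀ j, j = i := by
  obtain rfl : n = 1 := by simpa using congrArg List.length h
  refine ⟨0, by simpa using h, ?_, fun j => Subsingleton.elim _ _⟩
  rw [ofFn_concat]
  simp

theorem ofFn_concat_concat {X : Type u} {n : ℕ} {k : Fin n → ℕ} {l : ∀ i, Fin (k i) → ℕ}
    (r : ∀ i (j : Fin (k i)), Fin (l i j) → X) :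
    List.ofFn (concat fun i => concat (r i)) =
      List.ofFn (concat fun j => r (finSigmaFinEquiv.symm j).1 (finSigmaFinEquiv.symm j).2) := by
  have h := ofFn_concat (fun i (j : Fin (k i)) => List.ofFn (r i j))
  rw [ofFn_concat, ofFn_concat]
  unfold concat at h
  rw [h, List.flatten_flatten, List.map_ofFn]
  congr 2
  funext i
  exact ofFn_concat _

theorem concat_blockSum {X : Type u} {n : ℕ} {k k' : Fin n → ℕ} (q : ∀ i, Fin (k i) → X)
    (τ : ∀ i, Fin (k' i) ≃ Fin (k i)) (j : Fin (∑ i, k' i)) :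
    concat q (blockSum τ j) = concat (fun i t => q i (τ i t)) j := by
  exact concat_apply q (Equiv.sigmaCongrRight τ (finSigmaFinEquiv.symm j))

theorem concat_blockPerm {X : Type u} {m n : ℕ} {k : Fin n → ℕ} (q : ∀ i, Fin (k i) → X)
    (σ : Fin m ≃ Fin n) (j : Fin (∑ i, k (σ i))) :
    concat q (blockPerm σ k j) = concat (fun i => q (σ i)) j := by
  exact concat_apply q
    (Equiv.sigmaCongrLeft (β := fun i => Fin (k i)) σ (finSigmaFinEquiv.symm j))

theorem perm_ofFn_comp {X : Type u} {m n : ℕ} (σ : Fin m ≃ Fin n) (p : Fin n → X) :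
    (List.ofFn fun i => p (σ i)).Perm (List.ofFn p) := by
  obtain rfl : m = n := by simpa using Fintype.card_congr σ
  exact Equiv.Perm.ofFn_comp_perm σ p

theorem label_heq {X : Type u} {M : Type u} {P : ∀ {n : ℕ}, (Fin n → X) → X → M → Prop}
    {m n : ℕ} {p : Fin m → X} {p' : Fin n → X} (h : List.ofFn p = List.ofFn p') {b : X}
    {x : {x : M // P p b x}} {y : {y : M // P p' b y}} (hxy : x.1 = y.1) : HEq x y := by
  have h' := List.ofFn_inj'.1 h
  obtain rfl : m = n := congrArg Sigma.fst h'
  obtain rfl : p = p' := eq_of_heq (Sigma.mk.inj h').2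
  exact heq_of_eq (Subtype.ext hxy)

/-! ### The operads `∅`, `⋆`, `H`, `Ar_n`, `∂Ar_n` and `PAr_n` -/

/-- A rule that prescribes, for all objects `p 0, …, p (n - 1)` and `b`, a set of labels in the
commutative monoid `M`, compatible with identities (labelled by `0`) and composition (which
adds all the labels involved). -/
structure Labelling (X M : Type u) [AddCommMonoid M] where
  Allowed : {n : ℕ} → (Fin n → X) → X → M → Prop
  allowed_id : ∀ a : X, Allowed (fun _ : Fin 1 => a) a 0
  allowed_comp : ∀ {n : ℕ} {p : Fin n → X} {b : X} {x : M} {k : Fin n → ℕ}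
    {q : ∀ i, Fin (k i) → X} {y : Fin n → M},
    Allowed p b x → (∀ i, Allowed (q i) (p i) (y i)) → Allowed (concat q) b (x + ∑ i, y i)

/-- A labelling that is invariant under permutations of the inputs. -/
structure SymLabelling (X M : Type u) [AddCommMonoid M] extends Labelling X M where
  allowed_act : ∀ {m n : ℕ} (σ : Fin m ≃ Fin n) {p : Fin n → X} {b : X} {x : M},
    Allowed p b x → Allowed (fun i => p (σ i)) b x

/-- The operad whose morphisms `p → b` are the allowed labels. -/
def Labelling.operad {X M : Type u} [AddCommMonoid M] (L : Labelling X M) : NSOperad.{u} where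
  Ob := X
  Hom p b := {x : M // L.Allowed p b x}
  id a := ⟨0, L.allowed_id a⟩
  comp ψ _ _ φ := ⟨ψ.1 + ∑ i, (φ i).1, L.allowed_comp ψ.2 fun i => (φ i).2⟩
  id_comp ψ := label_heq (P := L.Allowed) (by rw [ofFn_concat]; simp) (by simp)
  comp_id ψ := label_heq (P := L.Allowed) (ofFn_concat_of_singleton fun i => by simp) (by simp)
  assoc ψ k q φ l r χ := label_heq (P := L.Allowed) (ofFn_concat_concat r) (by
    simp only [Finset.sum_add_distrib, add_assoc]
    congr 2
    rw [← Fintype.sum_sigma' (fun i (j : Fin (k i)) => (χ i j).1)]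
    exact (Equiv.sum_comp finSigmaFinEquiv.symm
      (fun x : (i : Fin _) × Fin (k i) => (χ x.1 x.2).1)).symm)

/-- The symmetric operad whose morphisms `p → b` are the allowed labels; the actions of the
symmetric groups preserve the labels. -/
def SymLabelling.operad {X M : Type u} [AddCommMonoid M] (L : SymLabelling X M) :
    SymOperad.{u} where
  toNSOperad := L.toLabelling.operad
  act σ _ _ ψ := ⟨ψ.1, L.allowed_act σ ψ.2⟩
  act_refl _ := rfl
  act_act _ _ _ _ _ := rfl
  comp_act _ _ _ q _ τ := label_heq (P := L.Allowed)
    (congrArg List.ofFn (funext fun j => (concat_blockSum q τ j).symm)) rfl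
  act_comp σ _ _ ψ _ q φ := label_heq (P := L.Allowed)
    (congrArg List.ofFn (funext fun j => (concat_blockPerm q σ j).symm))
    (congrArg (ψ.1 + ·) (Equiv.sum_comp σ fun i => (φ i).1))

/-- The functor given by a function `g` on objects and a homomorphism `f` on labels. -/
def Labelling.map {X Y M N : Type u} [AddCommMonoid M] [AddCommMonoid N]
    (L : Labelling X M) (L' : Labelling Y N) (g : X → Y) (f : M →+ N)
    (h : ∀ {n : ℕ} (p : Fin n → X) (b : X) (x : M),
      L.Allowed p b x → L'.Allowed (fun i => g (p i)) (g b) (f x)) :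
    L.operad ⟶ L'.operad :=
  NSOperad.Map.mk (P := L.operad) (Q := L'.operad) g (fun ψ => ⟨f ψ.1, h _ _ _ ψ.2⟩)
    (fun _ => Subtype.ext (map_zero f))
    (fun ψ _ _ φ => Subtype.ext (by simp [Labelling.operad, map_add, map_sum]))

/-- The functor given by a function `g` on objects and a homomorphism `f` on labels. -/
def SymLabelling.map {X Y M N : Type u} [AddCommMonoid M] [AddCommMonoid N]
    (L : SymLabelling X M) (L' : SymLabelling Y N) (g : X → Y) (f : M →+ N)
    (h : ∀ {n : ℕ} (p : Fin n → X) (b : X) (x : M),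
      L.Allowed p b x → L'.Allowed (fun i => g (p i)) (g b) (f x)) :
    L.operad ⟶ L'.operad :=
  SymOperad.Map.mk (P := L.operad) (Q := L'.operad)
    (L.toLabelling.map L'.toLabelling g f h) (fun _ _ _ _ => rfl)

/-- The labelling of `unaryIndiscrete`: one label in arity `1` and none in other arities. -/
def unaryLabelling (X : Type u) : SymLabelling X PUnit.{u + 1} where
  Allowed {n} _ _ _ := n = 1
  allowed_id _ := rfl
  allowed_comp := by rintro n p b x k q y rfl h; simp [h]
  allowed_act := by rintro m n σ p b x rfl; simpa using Fintype.card_congr σ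

/-- The operad with set of objects `X`, exactly one unary morphism `a → b` for all objects `a`
and `b`, and no morphisms of arity different from `1`. -/
def NSOperad.unaryIndiscrete (X : Type u) : NSOperad.{u} :=
  (unaryLabelling X).toLabelling.operad

/-- The symmetric version of `NSOperad.unaryIndiscrete`. -/
def SymOperad.unaryIndiscrete (X : Type u) : SymOperad.{u} :=
  (unaryLabelling X).operad

/-- The functor between such operads given by a function on objects. -/
def NSOperad.unaryIndiscreteMap {X Y : Type u} (g : X → Y) :
    NSOperad.unaryIndiscrete X ⟶ NSOperad.unaryIndiscrete Y :=
  Labelling.map _ _ g (AddMonoidHom.id _) (fun _ _ _ h => h)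

/-- The functor between such operads given by a function on objects. -/
def SymOperad.unaryIndiscreteMap {X Y : Type u} (g : X → Y) :
    SymOperad.unaryIndiscrete X ⟶ SymOperad.unaryIndiscrete Y :=
  SymLabelling.map _ _ g (AddMonoidHom.id _) (fun _ _ _ h => h)

/-- The sequence of objects `1, …, n` of the operads `Ar_n`, `∂Ar_n` and `PAr_n`, whose objects
are `0, 1, …, n`. -/
def arrowInputs (n : ℕ) : List (ULift.{u} (Fin (n + 1))) :=
  List.ofFn fun i : Fin n => ULift.up i.succ

/-- The morphisms of the non-symmetric operad on the objects `0, …, n` freely generated by one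
morphism `1, …, n → 0` for each element of `S`: the identities (labelled by `0`) and the
generators (labelled by the elements of `S`). -/
def NSOperad.ArrowHom (n : ℕ) (S : Set ℕ) {m : ℕ} (p : Fin m → ULift.{u} (Fin (n + 1)))
    (b : ULift.{u} (Fin (n + 1))) (x : ULift.{u} ℕ) : Prop :=
  (List.ofFn p = [b] ∧ x.down = 0) ∨
    (List.ofFn p = arrowInputs n ∧ b = ULift.up 0 ∧ x.down ∈ S)

/-- The morphisms of the symmetric operad on the objects `0, …, n` freely generated by one
morphism `1, …, n → 0` for each element of `S`: the identities and, for every permutation `σ`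
and every generator `s`, the morphism `σ^* s : σ 1, …, σ n → 0`. -/
def SymOperad.ArrowHom (n : ℕ) (S : Set ℕ) {m : ℕ} (p : Fin m → ULift.{u} (Fin (n + 1)))
    (b : ULift.{u} (Fin (n + 1))) (x : ULift.{u} ℕ) : Prop :=
  (List.ofFn p = [b] ∧ x.down = 0) ∨
    ((List.ofFn p).Perm (arrowInputs n) ∧ b = ULift.up 0 ∧ x.down ∈ S)

theorem zero_not_mem_arrowInputs (n : ℕ) : ULift.up 0 ∉ arrowInputs.{u} n := by
  intro h
  simp only [arrowInputs, List.mem_ofFn] at h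
  obtain ⟨i, hi⟩ := h
  exact Fin.succ_ne_zero i (congrArg ULift.down hi)

theorem NSOperad.ArrowHom.comp {n : ℕ} {S : Set ℕ} {m : ℕ}
    {p : Fin m → ULift.{u} (Fin (n + 1))} {b : ULift.{u} (Fin (n + 1))} {x : ULift.{u} ℕ}
    {k : Fin m → ℕ} {q : ∀ i, Fin (k i) → ULift.{u} (Fin (n + 1))} {y : Fin m → ULift.{u} ℕ}
    (hx : NSOperad.ArrowHom n S p b x) (hy : ∀ i, NSOperad.ArrowHom n S (q i) (p i) (y i)) :
    NSOperad.ArrowHom n S (concat q) b (x + ∑ i, y i) := by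
  rcases hx with ⟨hp, hx⟩ | ⟨hp, hb, hx⟩
  · obtain ⟨i, hi, hq, hu⟩ := ofFn_concat_of_one (q := q) hp
    have hsum : x + ∑ j, y j = y i := by
      rw [Finset.sum_eq_single i (fun j _ hj => absurd (hu j) hj) (by simp),
        show x = 0 from ULift.ext _ _ hx, zero_add]
    rw [hsum, NSOperad.ArrowHom, hq, ← hi]
    exact hy i
  · have hy' : ∀ i, List.ofFn (q i) = [p i] ∧ (y i).down = 0 := fun i =>
      (hy i).resolve_right fun h => zero_not_mem_arrowInputs n (by
        rw [← h.2.1, ← hp]; exact List.mem_ofFn.2 ⟨i, rfl⟩)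
    have hsum : x + ∑ j, y j = x := by
      rw [Finset.sum_eq_zero fun i _ => ULift.ext (y i) 0 (hy' i).2, add_zero]
    rw [hsum, NSOperad.ArrowHom, ofFn_concat_of_singleton fun i => (hy' i).1]
    exact Or.inr ⟨hp, hb, hx⟩

theorem SymOperad.ArrowHom.comp {n : ℕ} {S : Set ℕ} {m : ℕ}
    {p : Fin m → ULift.{u} (Fin (n + 1))} {b : ULift.{u} (Fin (n + 1))} {x : ULift.{u} ℕ}
    {k : Fin m → ℕ} {q : ∀ i, Fin (k i) → ULift.{u} (Fin (n + 1))} {y : Fin m → ULift.{u} ℕ}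
    (hx : SymOperad.ArrowHom n S p b x) (hy : ∀ i, SymOperad.ArrowHom n S (q i) (p i) (y i)) :
    SymOperad.ArrowHom n S (concat q) b (x + ∑ i, y i) := by
  rcases hx with ⟨hp, hx⟩ | ⟨hp, hb, hx⟩
  · obtain ⟨i, hi, hq, hu⟩ := ofFn_concat_of_one (q := q) hp
    have hsum : x + ∑ j, y j = y i := by
      rw [Finset.sum_eq_single i (fun j _ hj => absurd (hu j) hj) (by simp),
        show x = 0 from ULift.ext _ _ hx, zero_add]
    rw [hsum, SymOperad.ArrowHom, hq, ← hi]
    exact hy i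
  · have hy' : ∀ i, List.ofFn (q i) = [p i] ∧ (y i).down = 0 := fun i =>
      (hy i).resolve_right fun h => zero_not_mem_arrowInputs n (by
        rw [← h.2.1, ← hp.mem_iff]; exact List.mem_ofFn.2 ⟨i, rfl⟩)
    have hsum : x + ∑ j, y j = x := by
      rw [Finset.sum_eq_zero fun i _ => ULift.ext (y i) 0 (hy' i).2, add_zero]
    rw [hsum, SymOperad.ArrowHom, ofFn_concat_of_singleton fun i => (hy' i).1]
    exact Or.inr ⟨hp, hb, hx⟩

theorem SymOperad.ArrowHom.act {n : ℕ} {S : Set ℕ} {l m : ℕ} (σ : Fin l ≃ Fin m)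
    {p : Fin m → ULift.{u} (Fin (n + 1))} {b : ULift.{u} (Fin (n + 1))} {x : ULift.{u} ℕ}
    (hx : SymOperad.ArrowHom n S p b x) : SymOperad.ArrowHom n S (fun i => p (σ i)) b x := by
  rcases hx with ⟨hp, hx⟩ | ⟨hp, hb, hx⟩
  · exact Or.inl ⟨List.perm_singleton.1 (hp ▸ perm_ofFn_comp σ p), hx⟩
  · exact Or.inr ⟨(perm_ofFn_comp σ p).trans hp, hb, hx⟩

/-- The non-symmetric operad on the objects `0, …, n` freely generated by one morphism
`1, …, n → 0` for each element of `S`. -/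
def NSOperad.arrows (n : ℕ) (S : Set ℕ) : NSOperad.{u} :=
  Labelling.operad (X := ULift.{u} (Fin (n + 1))) (M := ULift.{u} ℕ)
    { Allowed := NSOperad.ArrowHom n S
      allowed_id := fun _ => Or.inl ⟨by simp, rfl⟩
      allowed_comp := NSOperad.ArrowHom.comp }

/-- The symmetric operad on the objects `0, …, n` freely generated by one morphism
`1, …, n → 0` for each element of `S`. -/
def SymOperad.arrows (n : ℕ) (S : Set ℕ) : SymOperad.{u} :=
  SymLabelling.operad (X := ULift.{u} (Fin (n + 1))) (M := ULift.{u} ℕ)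
    { Allowed := SymOperad.ArrowHom n S
      allowed_id := fun _ => Or.inl ⟨by simp, rfl⟩
      allowed_comp := SymOperad.ArrowHom.comp
      allowed_act := SymOperad.ArrowHom.act }

/-- The functor that is the identity on objects and applies `f` to the labels. -/
def NSOperad.arrowsMap (n : ℕ) {S T : Set ℕ} (f : ℕ →+ ℕ) (h : Set.MapsTo f S T) :
    NSOperad.arrows.{u} n S ⟶ NSOperad.arrows.{u} n T :=
  Labelling.map _ _ (fun a => a)
    { toFun := fun x => ULift.up (f x.down)
      map_zero' := ULift.ext _ _ (map_zero f)
      map_add' := fun x y => ULift.ext _ _ (map_add f x.down y.down) }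
    (fun _ _ _ hψ => hψ.imp (fun hψ => ⟨hψ.1, (congrArg f hψ.2).trans (map_zero f)⟩)
      (fun hψ => ⟨hψ.1, hψ.2.1, h hψ.2.2⟩))

/-- The functor that is the identity on objects and applies `f` to the labels. -/
def SymOperad.arrowsMap (n : ℕ) {S T : Set ℕ} (f : ℕ →+ ℕ) (h : Set.MapsTo f S T) :
    SymOperad.arrows.{u} n S ⟶ SymOperad.arrows.{u} n T :=
  SymLabelling.map _ _ (fun a => a)
    { toFun := fun x => ULift.up (f x.down)
      map_zero' := ULift.ext _ _ (map_zero f)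
      map_add' := fun x y => ULift.ext _ _ (map_add f x.down y.down) }
    (fun _ _ _ hψ => hψ.imp (fun hψ => ⟨hψ.1, (congrArg f hψ.2).trans (map_zero f)⟩)
      (fun hψ => ⟨hψ.1, hψ.2.1, h hψ.2.2⟩))

/-! ### The generating cofibrations and trivial cofibrations -/

/-- The functor `∅ ⟶ ⋆`. -/
def NSOperad.emptyToStar :
    NSOperad.unaryIndiscrete PEmpty.{u + 1} ⟶ NSOperad.unaryIndiscrete PUnit.{u + 1} :=
  NSOperad.unaryIndiscreteMap PEmpty.elim

/-- The functor `∅ ⟶ ⋆`. -/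
def SymOperad.emptyToStar :
    SymOperad.unaryIndiscrete PEmpty.{u + 1} ⟶ SymOperad.unaryIndiscrete PUnit.{u + 1} :=
  SymOperad.unaryIndiscreteMap PEmpty.elim

/-- The functor `⋆ ⟶ H` with image `e`, one of the two objects of the free-living isomorphism. -/
def NSOperad.starToIso (e : Bool) :
    NSOperad.unaryIndiscrete PUnit.{u + 1} ⟶ NSOperad.unaryIndiscrete (ULift.{u} Bool) :=
  NSOperad.unaryIndiscreteMap fun _ => ULift.up e

/-- The functor `⋆ ⟶ H` with image `e`, one of the two objects of the free-living isomorphism. -/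
def SymOperad.starToIso (e : Bool) :
    SymOperad.unaryIndiscrete PUnit.{u + 1} ⟶ SymOperad.unaryIndiscrete (ULift.{u} Bool) :=
  SymOperad.unaryIndiscreteMap fun _ => ULift.up e

/-- The inclusion `∂Ar_n ⟶ Ar_n`. -/
def NSOperad.boundaryInclusion (n : ℕ) :
    NSOperad.arrows.{u} n ∅ ⟶ NSOperad.arrows.{u} n {0} :=
  NSOperad.arrowsMap n (AddMonoidHom.id ℕ) (Set.mapsTo_empty _ _)

/-- The inclusion `∂Ar_n ⟶ Ar_n`. -/
def SymOperad.boundaryInclusion (n : ℕ) :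
    SymOperad.arrows.{u} n ∅ ⟶ SymOperad.arrows.{u} n {0} :=
  SymOperad.arrowsMap n (AddMonoidHom.id ℕ) (Set.mapsTo_empty _ _)

/-- The functor `PAr_n ⟶ Ar_n` that identifies the two generators. -/
def NSOperad.foldParallel (n : ℕ) :
    NSOperad.arrows.{u} n {0, 1} ⟶ NSOperad.arrows.{u} n {0} :=
  NSOperad.arrowsMap n 0 (fun _ _ => rfl)

/-- The functor `PAr_n ⟶ Ar_n` that identifies the two generators. -/
def SymOperad.foldParallel (n : ℕ) :
    SymOperad.arrows.{u} n {0, 1} ⟶ SymOperad.arrows.{u} n {0} :=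
  SymOperad.arrowsMap n 0 (fun _ _ => rfl)

/-- The set consisting of `∅ ⟶ ⋆` and of `∂Ar_n ⟶ Ar_n` and `PAr_n ⟶ Ar_n` for all `n ≥ 0`. -/
def NSOperad.generatingCofibrations : MorphismProperty NSOperad.{u} :=
  MorphismProperty.ofHoms (fun _ : Unit => NSOperad.emptyToStar) ⊔
    MorphismProperty.ofHoms NSOperad.boundaryInclusion ⊔
    MorphismProperty.ofHoms NSOperad.foldParallel

/-- The set consisting of `∅ ⟶ ⋆` and of `∂Ar_n ⟶ Ar_n` and `PAr_n ⟶ Ar_n` for all `n ≥ 0`. -/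
def SymOperad.generatingCofibrations : MorphismProperty SymOperad.{u} :=
  MorphismProperty.ofHoms (fun _ : Unit => SymOperad.emptyToStar) ⊔
    MorphismProperty.ofHoms SymOperad.boundaryInclusion ⊔
    MorphismProperty.ofHoms SymOperad.foldParallel

/-- The set whose only element is the functor `⋆ ⟶ H` with image `e`. -/
def NSOperad.generatingTrivialCofibrations (e : Bool) : MorphismProperty NSOperad.{u} :=
  MorphismProperty.ofHoms (fun _ : Unit => NSOperad.starToIso e)

/-- The set whose only element is the functor `⋆ ⟶ H` with image `e`. -/
def SymOperad.generatingTrivialCofibrations (e : Bool) : MorphismProperty SymOperad.{u} :=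
  MorphismProperty.ofHoms (fun _ : Unit => SymOperad.starToIso e)

/-!
Both model structures are obtained at once by working with `ActOperad s`, the category of operads
which carry actions of the symmetric groups if the proposition `s` holds. It is equivalent to the
category of non-symmetric operads for `s = False` and to that of symmetric operads for `s = True`
(`NSOperad.toAct`, `SymOperad.toAct`).

*Limits and colimits.* Products and equalizers are formed on objects and morphisms. A colimit is
built from formal composites of morphisms of the diagram, two of them being identified when they
have the same value in every cocone (`ActOperad.colimitOperad`). The laws hold in this quotient
because they hold in every cocone.

*Model structure.* The trivial fibrations are the fully faithful functors that are surjective on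
objects (`NSOperad.isofibrations_inf_equivalences_iff`), and a functor lifts along a fully faithful
functor as soon as it does on objects (`ActOperad.exists_lift_of_fullyFaithful`). This gives the
lifts of cofibrations against trivial fibrations. Every functor `A ⟶ B` factors through the operad
with objects `Ob A ⊔ Ob B` and the morphisms of `B`. For the other half, the mapping path operad
`ActOperad.path F` has as objects the isomorphisms out of objects `F a`, and the morphisms of `A`.
Each of its objects is isomorphic to an object of `A`, so a functor on `A` is extended to it by
choosing isomorphisms and conjugating (`ActOperad.conj`); with the isomorphisms lifted along an
isofibration this solves lifting problems (`ActOperad.hasLiftingProperty_pathι`). Every trivial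
cofibration `i` is a retract of `A ⟶ path i`.

*Generators.* `∅`, `⋆`, `H` and the operads `arrows n S` corepresent, respectively, the one-point
set, objects, isomorphisms and families of parallel `n`-ary morphisms indexed by `S`; the operads
`Ar_n`, `∂Ar_n` and `PAr_n` are the cases where `S` has one, no and two elements. The right lifting
properties thus translate into surjectivity on objects, surjectivity and injectivity on morphisms,
and the lifting of isomorphisms (`NSOperad.hasLiftingProperty_iff_surjective` and its companions).

*Small objects.* Filtered colimits of operads consist of germs of objects and morphisms
(`ActOperad.isColimitGermCocone`), because a composite involves only finitely many morphisms. Hence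
objects, morphisms and finite families of parallel morphisms commute with filtered colimits, and the
sources of the generators are finitely presentable.
-/

/-! ### Concatenations of one block and of blocks of length one -/

theorem finSigmaFinEquiv_symm_fst_of_one {n : ℕ} (j : Fin (∑ _ : Fin n, 1)) :
    ((finSigmaFinEquiv (n := fun _ : Fin n => 1)).symm j).1.val = j.val := by
  obtain ⟨⟨i, t⟩, rfl⟩ := (finSigmaFinEquiv (n := fun _ : Fin n => 1)).surjective j
  rw [Equiv.symm_apply_apply, finSigmaFinEquiv_apply]
  simp

theorem finSigmaFinEquiv_symm_snd_of_one {k : Fin 1 → ℕ} (j : Fin (∑ i, k i)) :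
    ((finSigmaFinEquiv (n := k)).symm j).2.val = j.val := by
  obtain ⟨⟨i, t⟩, rfl⟩ := (finSigmaFinEquiv (n := k)).surjective j
  rw [Equiv.symm_apply_apply, finSigmaFinEquiv_one]

/-- Concatenating one block changes nothing, as a list; the lengths agree only propositionally. -/
theorem ofFn_concat_one {X : Type u} {k : Fin 1 → ℕ} (q : ∀ i, Fin (k i) → X) :
    List.ofFn (concat q) = List.ofFn (q 0) := by
  rw [ofFn_concat]; simp

theorem ofFn_concat_of_ones {X : Type u} {n : ℕ} (p : Fin n → X) :
    List.ofFn (concat (fun i (_ : Fin 1) => p i)) = List.ofFn p :=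
  ofFn_concat_of_singleton fun i => by simp

namespace NSOperad

variable {P Q R : NSOperad.{u}}

/-! ### Transport of morphisms and unary composition -/

/-- Transport of a morphism along equalities of its inputs, as sequences, and of its target. -/
def castHom {m n : ℕ} {p : Fin m → P.Ob} {p' : Fin n → P.Ob} {b b' : P.Ob}
    (h : List.ofFn p = List.ofFn p') (hb : b = b') (ψ : P.Hom p b) : P.Hom p' b' :=
  cast (by
    obtain ⟨rfl, h⟩ := Sigma.mk.inj_iff.1 (List.ofFn_inj'.1 h)
    cases h; cases hb; rfl) ψ

theorem castHom_heq {m n : ℕ} {p : Fin m → P.Ob} {p' : Fin n → P.Ob} {b b' : P.Ob}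
    (h : List.ofFn p = List.ofFn p') (hb : b = b') (ψ : P.Hom p b) :
    HEq (castHom h hb ψ) ψ :=
  cast_heq _ _

/-- Composition respects heterogeneous equality of all the morphisms involved. -/
theorem comp_heq {m n : ℕ} {p : Fin m → P.Ob} {p' : Fin n → P.Ob} {b b' : P.Ob}
    (h : List.ofFn p = List.ofFn p') (hb : b = b') {ψ : P.Hom p b} {ψ' : P.Hom p' b'}
    (hψ : HEq ψ ψ')
    {k : Fin m → ℕ} {q : ∀ i, Fin (k i) → P.Ob} {φ : ∀ i, P.Hom (q i) (p i)}
    {k' : Fin n → ℕ} {q' : ∀ i, Fin (k' i) → P.Ob} {φ' : ∀ i, P.Hom (q' i) (p' i)}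
    (hφ : ∀ i i', i.val = i'.val → List.ofFn (q i) = List.ofFn (q' i') ∧ HEq (φ i) (φ' i')) :
    HEq (P.comp ψ φ) (P.comp ψ' φ') := by
  obtain ⟨rfl, h⟩ := Sigma.mk.inj_iff.1 (List.ofFn_inj'.1 h)
  cases h; cases hb; cases hψ
  have hk : k = k' := funext fun i => by simpa using congrArg List.length (hφ i i rfl).1
  subst hk
  have hq : q = q' := funext fun i => List.ofFn_injective (hφ i i rfl).1
  subst hq
  have hφ' : φ = φ' := funext fun i => eq_of_heq (hφ i i rfl).2
  rw [hφ']

theorem id_heq {a a' : P.Ob} (h : a = a') : HEq (P.id a) (P.id a') := by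
  subst h; rfl

theorem comp_heq_right {n : ℕ} {p : Fin n → P.Ob} {b : P.Ob} (ψ : P.Hom p b)
    {k k' : Fin n → ℕ} {q : ∀ i, Fin (k i) → P.Ob} {φ : ∀ i, P.Hom (q i) (p i)}
    {q' : ∀ i, Fin (k' i) → P.Ob} {φ' : ∀ i, P.Hom (q' i) (p i)}
    (hφ : ∀ i, List.ofFn (q i) = List.ofFn (q' i) ∧ HEq (φ i) (φ' i)) :
    HEq (P.comp ψ φ) (P.comp ψ φ') :=
  comp_heq rfl rfl HEq.rfl fun i i' h => by obtain rfl := Fin.ext h; exact hφ i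

/-- The composite of a morphism with a unary morphism out of its target. -/
def post {n : ℕ} {p : Fin n → P.Ob} {b b' : P.Ob} (θ : P.Hom (fun _ : Fin 1 => b) b')
    (ψ : P.Hom p b) : P.Hom p b' :=
  castHom (ofFn_concat_one _) rfl (P.comp θ (fun _ : Fin 1 => ψ))

theorem post_heq {n : ℕ} {p : Fin n → P.Ob} {b b' : P.Ob} (θ : P.Hom (fun _ : Fin 1 => b) b')
    (ψ : P.Hom p b) : HEq (post θ ψ) (P.comp θ (fun _ : Fin 1 => ψ)) :=
  castHom_heq _ _ _

/-- The composite of a morphism with unary morphisms into each of its inputs. -/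
def pre {n : ℕ} {p p' : Fin n → P.Ob} {b : P.Ob} (ψ : P.Hom p b)
    (η : ∀ i, P.Hom (fun _ : Fin 1 => p' i) (p i)) : P.Hom p' b :=
  castHom (ofFn_concat_of_ones p') rfl (P.comp ψ η)

theorem pre_heq {n : ℕ} {p p' : Fin n → P.Ob} {b : P.Ob} (ψ : P.Hom p b)
    (η : ∀ i, P.Hom (fun _ : Fin 1 => p' i) (p i)) : HEq (pre ψ η) (P.comp ψ η) :=
  castHom_heq _ _ _

@[simp]
theorem id_post {n : ℕ} {p : Fin n → P.Ob} {b : P.Ob} (ψ : P.Hom p b) : post (P.id b) ψ = ψ :=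
  eq_of_heq ((post_heq _ _).trans (P.id_comp ψ))

@[simp]
theorem post_id {b b' : P.Ob} (θ : P.Hom (fun _ : Fin 1 => b) b') : post θ (P.id b) = θ :=
  eq_of_heq ((post_heq _ _).trans (P.comp_id θ))

@[simp]
theorem pre_id {n : ℕ} {p : Fin n → P.Ob} {b : P.Ob} (ψ : P.Hom p b) :
    pre ψ (fun i => P.id (p i)) = ψ :=
  eq_of_heq ((pre_heq _ _).trans (P.comp_id ψ))

@[simp]
theorem id_pre {b b' : P.Ob} (θ : P.Hom (fun _ : Fin 1 => b) b') :
    pre (P.id b') (fun _ : Fin 1 => θ) = θ :=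
  eq_of_heq ((pre_heq _ _).trans (P.id_comp θ))

theorem comp_post {n : ℕ} {p : Fin n → P.Ob} {b b' : P.Ob} (θ : P.Hom (fun _ : Fin 1 => b) b')
    (ψ : P.Hom p b) {k : Fin n → ℕ} {q : ∀ i, Fin (k i) → P.Ob} (φ : ∀ i, P.Hom (q i) (p i)) :
    P.comp (post θ ψ) φ = post θ (P.comp ψ φ) := by
  have h₁ := P.assoc θ (k := fun _ => n) (q := fun _ => p) (fun _ : Fin 1 => ψ)
    (l := fun _ => k) (r := fun _ => q) fun _ => φ
  refine eq_of_heq (HEq.trans ?_ ((post_heq θ (P.comp ψ φ)).trans h₁).symm)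
  refine comp_heq (ofFn_concat_one fun _ : Fin 1 => p).symm rfl (post_heq θ ψ) fun i i' h => ?_
  have e : i = ((finSigmaFinEquiv (n := fun _ : Fin 1 => n)).symm i').2 :=
    Fin.ext (h.trans (finSigmaFinEquiv_symm_snd_of_one i').symm)
  rw [e]
  exact ⟨rfl, HEq.rfl⟩

theorem comp_pre {n : ℕ} {p p' : Fin n → P.Ob} {b : P.Ob} (ψ : P.Hom p b)
    (η : ∀ i, P.Hom (fun _ : Fin 1 => p' i) (p i))
    {k : Fin n → ℕ} {q : ∀ i, Fin (k i) → P.Ob} (φ : ∀ i, P.Hom (q i) (p' i)) :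
    P.comp (pre ψ η) φ = P.comp ψ (fun i => post (η i) (φ i)) := by
  have h₁ : HEq (P.comp ψ fun i => post (η i) (φ i))
      (P.comp ψ fun i => P.comp (η i) fun _ : Fin 1 => φ i) :=
    comp_heq_right ψ fun i => ⟨(ofFn_concat_one fun _ : Fin 1 => q i).symm, post_heq (η i) (φ i)⟩
  have h₂ := P.assoc ψ (k := fun _ => 1) (q := fun i _ => p' i) η (l := fun i _ => k i)
    (r := fun i _ => q i) fun i _ => φ i
  refine eq_of_heq (HEq.trans ?_ (h₁.trans h₂).symm)
  refine comp_heq (ofFn_concat_of_ones p').symm rfl (pre_heq _ _) fun i i' h => ?_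
  have e : i = ((finSigmaFinEquiv (n := fun _ : Fin n => 1)).symm i').1 :=
    Fin.ext (h.trans (finSigmaFinEquiv_symm_fst_of_one i').symm)
  rw [e]
  exact ⟨rfl, HEq.rfl⟩

theorem pre_comp {n : ℕ} {p : Fin n → P.Ob} {b : P.Ob} (ψ : P.Hom p b)
    {k : Fin n → ℕ} {q q' : ∀ i, Fin (k i) → P.Ob} (φ : ∀ i, P.Hom (q i) (p i))
    (η : ∀ i j, P.Hom (fun _ : Fin 1 => q' i j) (q i j)) :
    P.comp ψ (fun i => pre (φ i) (η i)) =
      pre (p' := concat q') (P.comp ψ φ)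
        (fun j => η (finSigmaFinEquiv.symm j).1 (finSigmaFinEquiv.symm j).2) := by
  refine eq_of_heq (((comp_heq_right ψ fun i =>
    ⟨(ofFn_concat_of_ones (q' i)).symm, pre_heq (φ i) (η i)⟩).trans ?_).trans (pre_heq _ _).symm)
  exact P.assoc ψ φ η

theorem post_post {n : ℕ} {p : Fin n → P.Ob} {b b' b'' : P.Ob}
    (θ' : P.Hom (fun _ : Fin 1 => b') b'') (θ : P.Hom (fun _ : Fin 1 => b) b') (ψ : P.Hom p b) :
    post θ' (post θ ψ) = post (post θ' θ) ψ := by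
  refine eq_of_heq (HEq.trans ?_ (post_heq _ _).symm)
  rw [comp_post]
  have : HEq (P.comp θ (fun _ : Fin 1 => ψ)) (post θ ψ) := (post_heq _ _).symm
  refine (post_heq _ _).trans (HEq.trans ?_ (post_heq _ _).symm)
  exact comp_heq_right _ fun i => ⟨(ofFn_concat_one fun _ : Fin 1 => p).symm, this.symm⟩

theorem post_pre {n : ℕ} {p p' : Fin n → P.Ob} {b b' : P.Ob}
    (θ : P.Hom (fun _ : Fin 1 => b) b') (ψ : P.Hom p b)
    (η : ∀ i, P.Hom (fun _ : Fin 1 => p' i) (p i)) :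
    post θ (pre ψ η) = pre (post θ ψ) η := by
  refine eq_of_heq (HEq.trans ?_ (pre_heq _ _).symm)
  rw [comp_post]
  refine (post_heq _ _).trans (HEq.trans ?_ (post_heq _ _).symm)
  exact comp_heq_right _ fun i => ⟨(ofFn_concat_of_ones p').symm, pre_heq _ _⟩

theorem pre_pre {n : ℕ} {p p' p'' : Fin n → P.Ob} {b : P.Ob} (ψ : P.Hom p b)
    (η : ∀ i, P.Hom (fun _ : Fin 1 => p' i) (p i))
    (η' : ∀ i, P.Hom (fun _ : Fin 1 => p'' i) (p' i)) :
    pre (pre ψ η) η' = pre ψ (fun i => post (η i) (η' i)) := by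
  refine eq_of_heq ((pre_heq _ _).trans ?_)
  rw [comp_pre]
  exact (pre_heq _ _).symm

/-! ### Functors -/

theorem Map.map_castHom (F : Map P Q) {m n : ℕ} {p : Fin m → P.Ob} {p' : Fin n → P.Ob}
    {b b' : P.Ob} (h : List.ofFn p = List.ofFn p') (hb : b = b') (ψ : P.Hom p b) :
    HEq (F.map (castHom h hb ψ)) (F.map ψ) := by
  obtain ⟨rfl, h⟩ := Sigma.mk.inj_iff.1 (List.ofFn_inj'.1 h)
  cases h; cases hb; rfl

theorem Map.map_heq (F : Map P Q) {m n : ℕ} {p : Fin m → P.Ob} {p' : Fin n → P.Ob}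
    {b b' : P.Ob} (h : List.ofFn p = List.ofFn p') (hb : b = b') {ψ : P.Hom p b}
    {ψ' : P.Hom p' b'} (hψ : HEq ψ ψ') : HEq (F.map ψ) (F.map ψ') := by
  obtain ⟨rfl, h⟩ := Sigma.mk.inj_iff.1 (List.ofFn_inj'.1 h)
  cases h; cases hb; cases hψ; rfl

theorem Map.map_post (F : Map P Q) {n : ℕ} {p : Fin n → P.Ob} {b b' : P.Ob}
    (θ : P.Hom (fun _ : Fin 1 => b) b') (ψ : P.Hom p b) :
    F.map (post θ ψ) = post (F.map θ) (F.map ψ) := by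
  refine eq_of_heq ((F.map_castHom _ _ _).trans ?_)
  rw [F.map_comp]
  exact (post_heq (F.map θ) (F.map ψ)).symm

theorem Map.map_pre (F : Map P Q) {n : ℕ} {p p' : Fin n → P.Ob} {b : P.Ob} (ψ : P.Hom p b)
    (η : ∀ i, P.Hom (fun _ : Fin 1 => p' i) (p i)) :
    F.map (pre ψ η) =
      pre (p' := fun i => F.obj (p' i)) (F.map ψ) (fun i => F.map (η i)) := by
  refine eq_of_heq ((F.map_castHom _ _ _).trans ?_)
  rw [F.map_comp]
  exact (pre_heq (p' := fun i => F.obj (p' i)) (F.map ψ) (fun i => F.map (η i))).symm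

/-- Functors with heterogeneously equal values on objects and morphisms are equal. -/
theorem Map.ext_heq {F G : Map P Q} (h : ∀ a, F.obj a = G.obj a)
    (h' : ∀ {n : ℕ} {p : Fin n → P.Ob} {b : P.Ob} (ψ : P.Hom p b), HEq (F.map ψ) (G.map ψ)) :
    F = G := by
  obtain ⟨o, f, _, _⟩ := F
  obtain ⟨o', f', _, _⟩ := G
  obtain rfl : o = o' := funext h
  obtain rfl : @f = @f' := by
    funext n p b ψ
    exact eq_of_heq (h' ψ)
  rfl

theorem Map.congr_map {F G : Map P Q} (h : F = G) {n : ℕ} {p : Fin n → P.Ob} {b : P.Ob}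
    (ψ : P.Hom p b) : HEq (F.map ψ) (G.map ψ) := by
  subst h; rfl

/-! ### Isomorphisms -/

/-- `f` and `g` are mutually inverse unary morphisms. -/
structure IsInverse {a b : P.Ob} (f : P.Hom (fun _ : Fin 1 => a) b)
    (g : P.Hom (fun _ : Fin 1 => b) a) : Prop where
  post_left : post g f = P.id a
  post_right : post f g = P.id b

theorem isIsomorphism_iff {a b : P.Ob} (f : P.Hom (fun _ : Fin 1 => a) b) :
    P.IsIsomorphism f ↔ ∃ g, IsInverse f g := by
  constructor
  · rintro ⟨g, h₁, h₂⟩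
    exact ⟨g, eq_of_heq ((post_heq _ _).trans h₁), eq_of_heq ((post_heq _ _).trans h₂)⟩
  · rintro ⟨g, h₁, h₂⟩
    exact ⟨g, (post_heq _ _).symm.trans (heq_of_eq h₁), (post_heq _ _).symm.trans (heq_of_eq h₂)⟩

theorem IsInverse.symm {a b : P.Ob} {f : P.Hom (fun _ : Fin 1 => a) b}
    {g : P.Hom (fun _ : Fin 1 => b) a} (h : IsInverse f g) : IsInverse g f :=
  ⟨h.2, h.1⟩

theorem isInverse_id (a : P.Ob) : IsInverse (P.id a) (P.id a) :=
  ⟨by simp, by simp⟩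

theorem IsInverse.comp {a b c : P.Ob} {f : P.Hom (fun _ : Fin 1 => a) b}
    {g : P.Hom (fun _ : Fin 1 => b) a} (h : IsInverse f g) {f' : P.Hom (fun _ : Fin 1 => b) c}
    {g' : P.Hom (fun _ : Fin 1 => c) b} (h' : IsInverse f' g') :
    IsInverse (post f' f) (post g g') :=
  ⟨by rw [post_post, ← post_post g, h'.1, post_id, h.1],
    by rw [post_post, ← post_post f', h.2, post_id, h'.2]⟩

theorem IsInverse.map (F : Map P Q) {a b : P.Ob} {f : P.Hom (fun _ : Fin 1 => a) b}
    {g : P.Hom (fun _ : Fin 1 => b) a} (h : IsInverse f g) :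
    IsInverse (F.map f) (F.map g) :=
  ⟨by rw [← F.map_id, ← h.1]; exact (F.map_post g f).symm,
    by rw [← F.map_id, ← h.2]; exact (F.map_post f g).symm⟩

/-- An inverse of a unary morphism is unique. -/
theorem IsInverse.unique {a b : P.Ob} {f : P.Hom (fun _ : Fin 1 => a) b}
    {g g' : P.Hom (fun _ : Fin 1 => b) a} (h : IsInverse f g) (h' : IsInverse f g') : g = g' := by
  rw [← post_id g, ← h'.2, post_post, h.1, id_post]

theorem post_post_cancel {a b c : P.Ob} (θ : P.Hom (fun _ : Fin 1 => b) c)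
    {f : P.Hom (fun _ : Fin 1 => a) b} {g : P.Hom (fun _ : Fin 1 => b) a} (h : IsInverse f g) :
    post (post θ f) g = θ := by
  rw [← post_post, h.post_right, post_id]

variable (P) in
/-- An isomorphism with source `a`. -/
structure IsoFrom (a : P.Ob) where
  target : P.Ob
  hom : P.Hom (fun _ : Fin 1 => a) target
  inv : P.Hom (fun _ : Fin 1 => target) a
  isInverse : IsInverse hom inv

namespace IsoFrom

/-- The identity isomorphism. -/
def refl (a : P.Ob) : IsoFrom P a := ⟨a, P.id a, P.id a, isInverse_id a⟩

/-- The composite of two isomorphisms. -/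
def trans {a : P.Ob} (e : IsoFrom P a) (e' : IsoFrom P e.target) : IsoFrom P a :=
  ⟨e'.target, post e'.hom e.hom, post e.inv e'.inv, e.isInverse.comp e'.isInverse⟩

/-- The inverse of an isomorphism. -/
def symm {a : P.Ob} (e : IsoFrom P a) : IsoFrom P e.target :=
  ⟨a, e.inv, e.hom, e.isInverse.symm⟩

/-- The image of an isomorphism under a functor. -/
def map (F : Map P Q) {a : P.Ob} (e : IsoFrom P a) : IsoFrom Q (F.obj a) :=
  ⟨F.obj e.target, F.map e.hom, F.map e.inv, e.isInverse.map F⟩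

theorem ext_hom {a : P.Ob} {e e' : IsoFrom P a} (h : e.target = e'.target)
    (h' : HEq e.hom e'.hom) : e = e' := by
  obtain ⟨t, f, g, hf⟩ := e
  obtain ⟨t', f', g', hf'⟩ := e'
  cases h; cases h'
  cases hf.unique hf'
  rfl

theorem map_refl (F : Map P Q) (a : P.Ob) : (refl a).map F = refl (F.obj a) :=
  ext_hom rfl (heq_of_eq (F.map_id a))

theorem refl_heq {a a' : P.Ob} (h : a = a') : HEq (refl a) (refl a') := by
  cases h; rfl

theorem map_heq {F G : Map P Q} (h : F = G) {a a' : P.Ob} (ha : a = a') {e : IsoFrom P a}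
    {e' : IsoFrom P a'} (he : HEq e e') : HEq (e.map F) (e'.map G) := by
  cases h; cases ha; cases he; rfl

end IsoFrom

theorem exists_isIsomorphism_iff {a b : P.Ob} :
    (∃ f : P.Hom (fun _ : Fin 1 => a) b, P.IsIsomorphism f) ↔ ∃ e : IsoFrom P a, e.target = b := by
  simp only [isIsomorphism_iff]
  constructor
  · rintro ⟨f, g, h⟩
    exact ⟨⟨b, f, g, h⟩, rfl⟩
  · rintro ⟨e, rfl⟩
    exact ⟨e.hom, e.inv, e.isInverse⟩

/-- Conjugating the values of a functor by isomorphisms gives a functor. -/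
def Map.conj (G : Map P Q) (e : ∀ a, IsoFrom Q (G.obj a)) : Map P Q where
  obj a := (e a).target
  map {n p b} ψ := post (e b).hom (pre (G.map ψ) (fun i => (e (p i)).inv))
  map_id a := by
    rw [G.map_id]
    exact (congrArg _ (id_pre (e a).inv)).trans (e a).isInverse.post_right
  map_comp {n p b} ψ k q φ := by
    rw [comp_post, comp_pre]
    simp only [post_post, (e _).isInverse.post_left, id_post]
    rw [G.map_comp]
    exact congrArg _ (pre_comp (G.map ψ) (fun i => G.map (φ i)) (fun i j => (e (q i j)).inv)).symm

theorem Map.conj_refl (G : Map P Q) : (G.conj fun _ => IsoFrom.refl _) = G :=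
  Map.ext_heq (fun _ => rfl) fun ψ => heq_of_eq (by
    refine (id_post _).trans (pre_id _))

/-- A morphism is recovered from its conjugate. -/
theorem post_pre_cancel {n : ℕ} {p p' : Fin n → P.Ob} {b b' : P.Ob}
    {θ : P.Hom (fun _ : Fin 1 => b) b'} {θ' : P.Hom (fun _ : Fin 1 => b') b}
    (hθ : IsInverse θ θ') {η : ∀ i, P.Hom (fun _ : Fin 1 => p' i) (p i)}
    {η' : ∀ i, P.Hom (fun _ : Fin 1 => p i) (p' i)} (hη : ∀ i, IsInverse (η i) (η' i))
    (ψ : P.Hom p b) : post θ' (pre (post θ (pre ψ η)) η') = ψ := by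
  rw [post_pre, post_post, hθ.1, id_post, pre_pre]
  simp only [(hη _).2, pre_id]

/-- Conjugation by isomorphisms is a bijection. -/
theorem conj_bijective {n : ℕ} {p p' : Fin n → P.Ob} {b b' : P.Ob}
    {θ : P.Hom (fun _ : Fin 1 => b) b'} {θ' : P.Hom (fun _ : Fin 1 => b') b}
    (hθ : IsInverse θ θ') {η : ∀ i, P.Hom (fun _ : Fin 1 => p' i) (p i)}
    {η' : ∀ i, P.Hom (fun _ : Fin 1 => p i) (p' i)} (hη : ∀ i, IsInverse (η i) (η' i)) :
    Function.Bijective fun ψ : P.Hom p b => post θ (pre ψ η) :=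
  Function.bijective_iff_has_inverse.2 ⟨fun ψ => post θ' (pre ψ η'), post_pre_cancel hθ hη,
    post_pre_cancel hθ.symm fun i => (hη i).symm⟩

/-! ### Equivalences and isofibrations of operads -/

/-- The functor is bijective on morphisms with given inputs and target. -/
def Map.FullyFaithful (F : Map P Q) : Prop :=
  ∀ {n : ℕ} (p : Fin n → P.Ob) (b : P.Ob), Function.Bijective fun ψ : P.Hom p b => F.map ψ

/-- Every object is isomorphic to one in the image of the functor. -/
def Map.EssSurjective (F : Map P Q) : Prop :=
  ∀ q : Q.Ob, ∃ (p : P.Ob) (e : IsoFrom Q (F.obj p)), e.target = q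

theorem equivalences_iff {P Q : NSOperad.{u}} (F : P ⟶ Q) :
    equivalences F ↔ Map.EssSurjective F ∧ Map.FullyFaithful F := by
  simp only [equivalences, exists_isIsomorphism_iff]
  rfl

/-- Isofibrations, with the inverses as part of the data; since inverses are unique, it is enough to
lift the isomorphism itself. -/
theorem isofibrations_iff {P Q : NSOperad.{u}} (F : P ⟶ Q) :
    isofibrations F ↔ ∀ (p : P.Ob) (e : IsoFrom Q (Map.obj F p)),
      ∃ e' : IsoFrom P p, e'.map F = e := by
  simp only [isofibrations, isIsomorphism_iff]
  constructor
  · intro h p e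
    obtain ⟨p', φ, ⟨g, hg⟩, hp, hφ⟩ := h p e.target e.hom ⟨e.inv, e.isInverse⟩
    exact ⟨⟨p', φ, g, hg⟩, IsoFrom.ext_hom hp hφ⟩
  · rintro h p q ψ ⟨g, hg⟩
    obtain ⟨e', he⟩ := h p ⟨q, ψ, g, hg⟩
    refine ⟨e'.target, e'.hom, ⟨e'.inv, e'.isInverse⟩, congrArg IsoFrom.target he, ?_⟩
    have : ∀ {e₁ e₂ : IsoFrom Q (Map.obj F p)}, e₁ = e₂ → HEq e₁.hom e₂.hom := by
      rintro _ _ rfl; rfl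
    exact this he

/-- A fully faithful functor reflects isomorphisms. -/
theorem Map.FullyFaithful.isInverse {F : Map P Q} (hF : F.FullyFaithful) {a b : P.Ob}
    {f : P.Hom (fun _ : Fin 1 => a) b} {g : P.Hom (fun _ : Fin 1 => b) a}
    (h : IsInverse (F.map f) (F.map g)) : IsInverse f g :=
  ⟨(hF _ _).1 ((F.map_post g f).trans (h.1.trans (F.map_id a).symm)),
    (hF _ _).1 ((F.map_post f g).trans (h.2.trans (F.map_id b).symm))⟩

/-- Isomorphisms between objects in the image of a fully faithful functor can be lifted. -/
theorem Map.FullyFaithful.exists_isoFrom {F : Map P Q} (hF : F.FullyFaithful) {a b : P.Ob}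
    (e : IsoFrom Q (F.obj a)) (he : e.target = F.obj b) :
    ∃ e' : IsoFrom P a, e'.target = b ∧ e'.map F = e := by
  obtain ⟨t, f, g, h⟩ := e
  obtain rfl : t = F.obj b := he
  obtain ⟨f, rfl⟩ := (hF (fun _ : Fin 1 => a) b).2 f
  obtain ⟨g, rfl⟩ := (hF (fun _ : Fin 1 => b) a).2 g
  exact ⟨⟨b, f, g, hF.isInverse h⟩, rfl, rfl⟩

theorem Map.FullyFaithful.injective_heq {F : Map P Q} (hF : F.FullyFaithful) {n : ℕ}
    {p : Fin n → P.Ob} {b : P.Ob} {ψ ψ' : P.Hom p b} (h : HEq (F.map ψ) (F.map ψ')) : ψ = ψ' :=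
  (hF p b).1 (eq_of_heq h)

/-- If `F` and `F ≫ G` are fully faithful, `G` is bijective on morphisms between objects that are
isomorphic to objects in the image of `F`. -/
theorem bijective_map_of_isoFrom (F : Map P Q) (G : Map Q R) (hF : F.FullyFaithful)
    (hFG : ∀ {n : ℕ} (p : Fin n → P.Ob) (b : P.Ob),
      Function.Bijective fun ψ : P.Hom p b => G.map (F.map ψ))
    {n : ℕ} {p : Fin n → P.Ob} {b : P.Ob} (e : ∀ i, IsoFrom Q (F.obj (p i)))
    (e₀ : IsoFrom Q (F.obj b)) :
    Function.Bijective fun ψ : Q.Hom (fun i => (e i).target) e₀.target => G.map ψ := by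
  have h₁ := conj_bijective e₀.isInverse (fun i => (e i).isInverse.symm)
  -- conjugation by the `e i` reduces the claim to morphisms between objects in the image of `F`
  have h₂ := conj_bijective (e₀.map G).isInverse (fun i => ((e i).map G).isInverse.symm)
  have h₃ : Function.Bijective fun ψ : Q.Hom (fun i => F.obj (p i)) (F.obj b) => G.map ψ :=
    (Function.Bijective.of_comp_iff _ (hF p b)).1 (hFG p b)
  refine (Function.Bijective.of_comp_iff _ h₁).1 ?_
  have h₄ := h₂.comp h₃
  refine (congrArg Function.Bijective (funext fun ψ => ?_)).mpr h₄
  exact (G.map_post _ _).trans (congrArg _ (G.map_pre _ _))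

/-- If `F` and `F ≫ G` are equivalences, `G` is fully faithful because all objects are isomorphic to
objects in the image of `F`; the other cases are direct. -/
instance : equivalences.{u}.HasTwoOutOfThreeProperty where
  comp_mem {P Q R} F G hF hG := by
    rw [equivalences_iff] at *
    refine ⟨fun r => ?_, fun p b => (hG.2 _ _).comp (hF.2 p b)⟩
    obtain ⟨q, e, rfl⟩ := hG.1 r
    obtain ⟨p, e', rfl⟩ := hF.1 q
    exact ⟨p, (e'.map G).trans e, rfl⟩
  of_postcomp {P Q R} F G hG hFG := by
    rw [equivalences_iff] at *
    refine ⟨fun q => ?_, fun p b => ?_⟩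
    · obtain ⟨p, e, he⟩ := hFG.1 (Map.obj G q)
      obtain ⟨e', he', -⟩ := Map.FullyFaithful.exists_isoFrom hG.2 (a := Map.obj F p) e he
      exact ⟨p, e', he'⟩
    · exact (Function.Bijective.of_comp_iff' (hG.2 _ _) _).1 (hFG.2 p b)
  of_precomp {P Q R} F G hF hFG := by
    rw [equivalences_iff] at *
    refine ⟨fun r => ?_, fun {n} q b => ?_⟩
    · obtain ⟨p, e, rfl⟩ := hFG.1 r
      exact ⟨Map.obj F p, e, rfl⟩
    · choose p e he using hF.1
      have key := bijective_map_of_isoFrom F G hF.2 hFG.2 (fun i => e (q i)) (e b)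
      have aux : ∀ (q' : Fin n → Q.Ob) (b' : Q.Ob), (fun i => (e (q i)).target) = q' →
          (e b).target = b' → Function.Bijective fun ψ : Q.Hom q' b' => Map.map G ψ := by
        rintro _ _ rfl rfl; exact key
      exact aux q b (funext fun i => he _) (he b)

end NSOperad

/-! ### A common generalization of non-symmetric and symmetric operads -/

/-- An operad which, if the proposition `s` holds, is endowed with actions of the symmetric groups.
For `s = False` this is a non-symmetric operad, for `s = True` a symmetric operad. -/
structure ActOperad (s : Prop) extends NSOperad.{u} where
  act : s → {m n : ℕ} → (σ : Fin m ≃ Fin n) → {p : Fin n → Ob} → {b : Ob} → Hom p b →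
    Hom (fun i => p (σ i)) b
  act_refl : ∀ (h : s) {n : ℕ} {p : Fin n → Ob} {b : Ob} (ψ : Hom p b),
    act h (Equiv.refl (Fin n)) ψ = ψ
  act_act : ∀ (h : s) {l m n : ℕ} (τ : Fin l ≃ Fin m) (σ : Fin m ≃ Fin n) {p : Fin n → Ob}
    {b : Ob} (ψ : Hom p b), act h τ (act h σ ψ) = act h (τ.trans σ) ψ
  comp_act : ∀ (h : s) {n : ℕ} {p : Fin n → Ob} {b : Ob} (ψ : Hom p b)
    {k k' : Fin n → ℕ} {q : ∀ i, Fin (k i) → Ob} (φ : ∀ i, Hom (q i) (p i))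
    (τ : ∀ i, Fin (k' i) ≃ Fin (k i)),
    HEq (comp ψ (fun i => act h (τ i) (φ i))) (act h (blockSum τ) (comp ψ φ))
  act_comp : ∀ (h : s) {m n : ℕ} (σ : Fin m ≃ Fin n) {p : Fin n → Ob} {b : Ob} (ψ : Hom p b)
    {k : Fin n → ℕ} {q : ∀ i, Fin (k i) → Ob} (φ : ∀ i, Hom (q i) (p i)),
    HEq (comp (act h σ ψ) (fun i => φ (σ i))) (act h (blockPerm σ k) (comp ψ φ))

namespace ActOperad

variable {s : Prop}

/-- A functor that is compatible with the actions of the symmetric groups, if there are any. -/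
structure Map (P Q : ActOperad.{u} s) extends NSOperad.Map P.toNSOperad Q.toNSOperad where
  map_act : ∀ (h : s) {m n : ℕ} (σ : Fin m ≃ Fin n) {p : Fin n → P.Ob} {b : P.Ob} (ψ : P.Hom p b),
    map (P.act h σ ψ) = Q.act h σ (map ψ)

instance : Category.{u} (ActOperad.{u} s) where
  Hom := Map
  id P := { obj := fun a => a, map := fun ψ => ψ, map_id := fun _ => rfl,
            map_comp := fun _ _ _ _ => rfl, map_act := fun _ _ _ _ _ _ _ => rfl }
  comp F G :=
    { obj := fun a => G.obj (F.obj a)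
      map := fun ψ => G.map (F.map ψ)
      map_id := fun a => by rw [F.map_id, G.map_id]
      map_comp := fun ψ _ _ φ => by rw [F.map_comp, G.map_comp]
      map_act := fun h _ _ σ _ _ ψ => by rw [F.map_act h, G.map_act h] }

/-- The functor that forgets the actions of the symmetric groups. -/
def forget : ActOperad.{u} s ⥤ NSOperad.{u} where
  obj P := P.toNSOperad
  map F := F.toMap

theorem Map.toMap_injective {P Q : ActOperad.{u} s} :
    Function.Injective (Map.toMap : Map P Q → _) := by
  rintro ⟨F, _⟩ ⟨G, _⟩ rfl
  rfl

theorem hom_ext {P Q : ActOperad.{u} s} {F G : P ⟶ Q} (h : Map.toMap F = Map.toMap G) : F = G :=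
  Map.toMap_injective h

theorem hom_ext_heq {P Q : ActOperad.{u} s} {F G : P ⟶ Q}
    (h : ∀ a, (Map.toMap F).obj a = (Map.toMap G).obj a)
    (h' : ∀ {n : ℕ} {p : Fin n → P.Ob} {b : P.Ob} (ψ : P.Hom p b),
      HEq ((Map.toMap F).map ψ) ((Map.toMap G).map ψ)) : F = G :=
  hom_ext (NSOperad.Map.ext_heq h h')

/-- The action respects heterogeneous equality of permutations and morphisms. -/
theorem act_heq {P : ActOperad.{u} s} (h : s) {m m' n n' : ℕ} {σ : Fin m ≃ Fin n}
    {σ' : Fin m' ≃ Fin n'} {p : Fin n → P.Ob} {p' : Fin n' → P.Ob} {b b' : P.Ob}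
    (hp : List.ofFn p = List.ofFn p') (hb : b = b') {ψ : P.Hom p b} {ψ' : P.Hom p' b'}
    (hψ : HEq ψ ψ') (hσ : ∀ i i', i.val = i'.val → (σ i).val = (σ' i').val) :
    HEq (P.act h σ ψ) (P.act h σ' ψ') := by
  obtain ⟨rfl, hp⟩ := Sigma.mk.inj_iff.1 (List.ofFn_inj'.1 hp)
  cases hp; cases hb; cases hψ
  obtain rfl : m = m' := by
    have h₁ := Fintype.card_congr σ
    have h₂ := Fintype.card_congr σ'
    simp only [Fintype.card_fin] at h₁ h₂
    omega
  obtain rfl : σ = σ' := Equiv.ext fun i => Fin.ext (hσ i i rfl)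
  rfl

/-- Equivariance for a unary morphism after `ψ`: the block sum of one permutation `σ` is `σ`. -/
theorem post_act (P : ActOperad.{u} s) (h : s) {m n : ℕ} (σ : Fin m ≃ Fin n) {p : Fin n → P.Ob}
    {b b' : P.Ob} (θ : P.Hom (fun _ : Fin 1 => b) b') (ψ : P.Hom p b) :
    NSOperad.post θ (P.act h σ ψ) = P.act h σ (NSOperad.post θ ψ) := by
  refine eq_of_heq ((NSOperad.post_heq _ _).trans
    ((P.comp_act h θ (fun _ : Fin 1 => ψ) fun _ => σ).trans ?_))
  refine act_heq h (ofFn_concat_one fun _ : Fin 1 => p) rfl (NSOperad.post_heq θ ψ).symm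
    fun i i' hi => ?_
  simp only [blockSum, Equiv.trans_apply, finSigmaFinEquiv_one]
  simp only [Equiv.sigmaCongrRight_apply]
  rw [show (finSigmaFinEquiv.symm i).2 = i' from
    Fin.ext ((finSigmaFinEquiv_symm_snd_of_one i).trans hi)]

/-- Equivariance for unary morphisms before `ψ`: permuting blocks of length one by `σ` is `σ`. -/
theorem pre_act (P : ActOperad.{u} s) (h : s) {m n : ℕ} (σ : Fin m ≃ Fin n) {p p' : Fin n → P.Ob}
    {b : P.Ob} (ψ : P.Hom p b) (η : ∀ i, P.Hom (fun _ : Fin 1 => p' i) (p i)) :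
    NSOperad.pre (p' := fun i => p' (σ i)) (P.act h σ ψ) (fun i => η (σ i)) =
      P.act h σ (NSOperad.pre ψ η) := by
  refine eq_of_heq ((NSOperad.pre_heq _ _).trans ((P.act_comp h σ ψ η).trans ?_))
  refine act_heq h (ofFn_concat_of_ones p') rfl (NSOperad.pre_heq ψ η).symm fun i i' hi => ?_
  have e : (finSigmaFinEquiv.symm i).1 = i' :=
    Fin.ext ((finSigmaFinEquiv_symm_fst_of_one i).trans hi)
  rw [← e]
  simp only [blockPerm, Equiv.trans_apply]
  rw [← finSigmaFinEquiv_symm_fst_of_one, Equiv.symm_apply_apply]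
  rfl

end ActOperad

/-- A non-symmetric operad, as an operad with no actions. -/
def NSOperad.toAct : NSOperad.{u} ⥤ ActOperad.{u} False where
  obj P :=
    { P with
      act := fun h => h.elim
      act_refl := fun h => h.elim
      act_act := fun h => h.elim
      comp_act := fun h => h.elim
      act_comp := fun h => h.elim }
  map F := ActOperad.Map.mk F (fun h => h.elim)

/-- A symmetric operad, as an operad with actions of the symmetric groups. -/
def SymOperad.toAct : SymOperad.{u} ⥤ ActOperad.{u} True where
  obj P :=
    { P with
      act := fun _ => P.act
      act_refl := fun _ => P.act_refl
      act_act := fun _ => P.act_act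
      comp_act := fun _ => P.comp_act
      act_comp := fun _ => P.act_comp }
  map F := ActOperad.Map.mk F.toMap (fun _ => F.map_act)

instance : NSOperad.toAct.{u}.IsEquivalence where
  faithful := ⟨fun h => congrArg ActOperad.Map.toMap h⟩
  full := ⟨fun F => ⟨ActOperad.Map.toMap F, rfl⟩⟩
  essSurj := ⟨fun P => ⟨P.toNSOperad,
    ⟨{ hom := ActOperad.Map.mk (𝟙 P.toNSOperad : P.toNSOperad ⟶ P.toNSOperad) fun h => h.elim
       inv := ActOperad.Map.mk (𝟙 P.toNSOperad : P.toNSOperad ⟶ P.toNSOperad) fun h => h.elim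
       hom_inv_id := rfl
       inv_hom_id := rfl }⟩⟩⟩

theorem SymOperad.Map.toMap_injective {P Q : SymOperad.{u}} :
    Function.Injective (SymOperad.Map.toMap : SymOperad.Map P Q → _) := by
  rintro ⟨F, _⟩ ⟨G, _⟩ rfl
  rfl

theorem SymOperad.hom_ext {P Q : SymOperad.{u}} {F G : P ⟶ Q} (h : Map.toMap F = Map.toMap G) :
    F = G :=
  SymOperad.Map.toMap_injective h

instance : SymOperad.toAct.{u}.IsEquivalence where
  faithful := ⟨fun h => SymOperad.hom_ext (congrArg ActOperad.Map.toMap h)⟩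
  full := ⟨fun F => ⟨SymOperad.Map.mk (ActOperad.Map.toMap F) (ActOperad.Map.map_act F trivial),
    rfl⟩⟩
  essSurj := ⟨fun P => ⟨{ P with
      act := P.act trivial
      act_refl := P.act_refl trivial
      act_act := P.act_act trivial
      comp_act := P.comp_act trivial
      act_comp := P.act_comp trivial }, ⟨Iso.refl P⟩⟩⟩

open Limits

/-! ### Limits -/

namespace ActOperad

variable {s : Prop}

section Products

variable {ι : Type u} (f : ι → ActOperad.{u} s)

/-- Morphisms of a product with inputs that agree as lists are compared componentwise. -/
theorem pi_heq {m n : ℕ} {p : Fin m → ∀ j, (f j).Ob} {p' : Fin n → ∀ j, (f j).Ob}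
    {b : ∀ j, (f j).Ob} (h : List.ofFn p = List.ofFn p')
    {x : ∀ j, (f j).Hom (fun i => p i j) (b j)} {y : ∀ j, (f j).Hom (fun i => p' i j) (b j)}
    (hxy : ∀ j, HEq (x j) (y j)) : HEq x y := by
  obtain ⟨rfl, h⟩ := Sigma.mk.inj_iff.1 (List.ofFn_inj'.1 h)
  cases h
  exact heq_of_eq (funext fun j => eq_of_heq (hxy j))

/-- The product of a family of operads. -/
def pi : ActOperad.{u} s where
  Ob := ∀ j, (f j).Ob
  Hom p b := ∀ j, (f j).Hom (fun i => p i j) (b j)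
  id a j := (f j).id (a j)
  comp ψ _ _ φ j := (f j).comp (ψ j) (fun i => φ i j)
  id_comp {_ p _} ψ := pi_heq f (ofFn_concat_one fun _ : Fin 1 => p) fun j => (f j).id_comp (ψ j)
  comp_id ψ := pi_heq f (ofFn_concat_of_ones _) fun j => (f j).comp_id (ψ j)
  assoc ψ _ _ φ _ r χ := pi_heq f (ofFn_concat_concat r) fun j =>
    (f j).assoc (ψ j) (fun i => φ i j) (fun i t => χ i t j)
  act h _ _ σ _ _ ψ j := (f j).act h σ (ψ j)
  act_refl h _ _ _ ψ := funext fun j => (f j).act_refl h (ψ j)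
  act_act h _ _ _ τ σ _ _ ψ := funext fun j => (f j).act_act h τ σ (ψ j)
  comp_act h _ _ _ ψ _ _ q φ τ := pi_heq f
    (congrArg List.ofFn (funext fun j => (concat_blockSum q τ j).symm)) fun j =>
      (f j).comp_act h (ψ j) (fun i => φ i j) τ
  act_comp h _ _ σ _ _ ψ _ q φ := pi_heq f
    (congrArg List.ofFn (funext fun j => (concat_blockPerm q σ j).symm)) fun j =>
      (f j).act_comp h σ (ψ j) (fun i => φ i j)

/-- The projections of a product of operads. -/
def piProj (j : ι) : pi f ⟶ f j where
  obj a := a j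
  map ψ := ψ j
  map_id _ := rfl
  map_comp _ _ _ _ := rfl
  map_act _ _ _ _ _ _ _ := rfl

/-- The functor to a product with given components. -/
def piLift {P : ActOperad.{u} s} (F : ∀ j, P ⟶ f j) : P ⟶ pi f where
  obj a j := (Map.toMap (F j)).obj a
  map ψ j := (Map.toMap (F j)).map ψ
  map_id a := funext fun j => (F j).map_id a
  map_comp ψ _ _ φ := funext fun j => (F j).map_comp ψ φ
  map_act h _ _ σ _ _ ψ := funext fun j => Map.map_act (F j) h σ ψ

instance : HasProducts.{u} (ActOperad.{u} s) :=
  hasProducts_of_limit_fans (fun f => Fan.mk (pi f) (piProj f)) fun f =>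
    Fan.IsLimit.mk _ (fun t => piLift f t.proj) (fun _ _ => rfl) fun t m hm => by
      have (K : ∀ j, _ ⟶ f j) (h : ∀ j, m ≫ piProj f j = K j) : m = piLift f K := by
        obtain rfl : (fun j => m ≫ piProj f j) = K := funext h
        rfl
      exact this _ hm

end Products

section Equalizers

variable {P Q : ActOperad.{u} s} (F G : P ⟶ Q)

/-- Morphisms of an equalizer with inputs that agree as lists are compared in the source operad. -/
theorem equalizer_heq {m n : ℕ} {p : Fin m → {a : P.Ob // (Map.toMap F).obj a = (Map.toMap G).obj a}}
    {p' : Fin n → {a : P.Ob // (Map.toMap F).obj a = (Map.toMap G).obj a}}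
    {b : {a : P.Ob // (Map.toMap F).obj a = (Map.toMap G).obj a}}
    (h : List.ofFn p = List.ofFn p')
    {x : {ψ : P.Hom (fun i => (p i).1) b.1 // HEq ((Map.toMap F).map ψ) ((Map.toMap G).map ψ)}}
    {y : {ψ : P.Hom (fun i => (p' i).1) b.1 // HEq ((Map.toMap F).map ψ) ((Map.toMap G).map ψ)}}
    (hxy : HEq x.1 y.1) : HEq x y := by
  obtain ⟨rfl, h⟩ := Sigma.mk.inj_iff.1 (List.ofFn_inj'.1 h)
  cases h
  exact heq_of_eq (Subtype.ext (eq_of_heq hxy))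

/-- The equalizer of two functors. -/
def equalizer : ActOperad.{u} s where
  Ob := {a : P.Ob // (Map.toMap F).obj a = (Map.toMap G).obj a}
  Hom p b := {ψ : P.Hom (fun i => (p i).1) b.1 // HEq ((Map.toMap F).map ψ) ((Map.toMap G).map ψ)}
  id a := ⟨P.id a.1, by
    rw [NSOperad.Map.map_id, NSOperad.Map.map_id]
    exact NSOperad.id_heq a.2⟩
  comp {n p b} ψ k q φ := ⟨P.comp ψ.1 (fun i => (φ i).1), by
    rw [NSOperad.Map.map_comp, NSOperad.Map.map_comp]
    refine NSOperad.comp_heq (congrArg List.ofFn (funext fun i => (p i).2)) b.2 ψ.2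
      fun i i' h => ?_
    obtain rfl := Fin.ext h
    exact ⟨congrArg List.ofFn (funext fun j => (q i j).2), (φ i).2⟩⟩
  id_comp {_ p _} ψ := equalizer_heq F G (ofFn_concat_one fun _ : Fin 1 => p) (P.id_comp ψ.1)
  comp_id ψ := equalizer_heq F G (ofFn_concat_of_ones _) (P.comp_id ψ.1)
  assoc ψ _ _ φ _ r χ := equalizer_heq F G (ofFn_concat_concat r)
    (P.assoc ψ.1 (fun i => (φ i).1) (fun i t => (χ i t).1))
  act h _ _ σ p b ψ := ⟨P.act h σ ψ.1, by
    rw [Map.map_act _ h, Map.map_act _ h]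
    refine act_heq h (congrArg List.ofFn (funext fun i => (p i).2)) b.2 ψ.2
      fun i i' h => ?_
    obtain rfl := Fin.ext h
    rfl⟩
  act_refl h _ _ _ ψ := Subtype.ext (P.act_refl h ψ.1)
  act_act h _ _ _ τ σ _ _ ψ := Subtype.ext (P.act_act h τ σ ψ.1)
  comp_act h _ _ _ ψ _ _ q φ τ := equalizer_heq F G
    (congrArg List.ofFn (funext fun j => (concat_blockSum q τ j).symm))
      (P.comp_act h ψ.1 (fun i => (φ i).1) τ)
  act_comp h _ _ σ _ _ ψ _ q φ := equalizer_heq F G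
    (congrArg List.ofFn (funext fun j => (concat_blockPerm q σ j).symm))
      (P.act_comp h σ ψ.1 (fun i => (φ i).1))

/-- The inclusion of an equalizer. -/
def equalizerι : equalizer F G ⟶ P where
  obj a := a.1
  map ψ := ψ.1
  map_id _ := rfl
  map_comp _ _ _ _ := rfl
  map_act _ _ _ _ _ _ _ := rfl

theorem equalizer_condition : equalizerι F G ≫ F = equalizerι F G ≫ G :=
  hom_ext_heq (fun a => a.2) (fun ψ => ψ.2)

/-- The functor to an equalizer induced by a functor that equalizes. -/
def equalizerLift {R : ActOperad.{u} s} (K : R ⟶ P) (h : K ≫ F = K ≫ G) : R ⟶ equalizer F G where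
  obj a := ⟨(Map.toMap K).obj a, congrArg (fun H => (Map.toMap H).obj a) h⟩
  map ψ := ⟨(Map.toMap K).map ψ, NSOperad.Map.congr_map (congrArg Map.toMap h) ψ⟩
  map_id a := Subtype.ext (K.map_id a)
  map_comp ψ _ _ φ := Subtype.ext (K.map_comp ψ φ)
  map_act h _ _ σ _ _ ψ := Subtype.ext (Map.map_act K h σ ψ)

instance : HasEqualizers (ActOperad.{u} s) := by
  have (P Q : ActOperad.{u} s) (F G : P ⟶ Q) : HasLimit (parallelPair F G) :=
    ⟨⟨⟨Fork.ofι (equalizerι F G) (equalizer_condition F G),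
      Fork.IsLimit.mk _ (fun t => equalizerLift F G t.ι t.condition) (fun _ => rfl)
        fun t m hm => by
          have (K : _ ⟶ P) (hK : K ≫ F = K ≫ G) (h : m ≫ equalizerι F G = K) :
              m = equalizerLift F G K hK := by
            subst h; rfl
          exact this _ _ hm⟩⟩⟩
  exact hasEqualizers_of_hasLimit_parallelPair _

end Equalizers

instance : HasLimits (ActOperad.{u} s) :=
  has_limits_of_hasEqualizers_and_products

/-! ### Colimits -/

section Colimits

variable {J : Type u} [Category.{u} J] (F : J ⥤ ActOperad.{u} s)

/-- Two objects in a diagram of operads are identified in the colimit if they are identified in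
every cocone. -/
def colimitObSetoid : Setoid (Σ j, (F.obj j).Ob) where
  r x y := ∀ c : Cocone F, (Map.toMap (c.ι.app x.1)).obj x.2 = (Map.toMap (c.ι.app y.1)).obj y.2
  iseqv := ⟨fun _ _ => rfl, fun h c => (h c).symm, fun h h' c => (h c).trans (h' c)⟩

/-- The objects of the colimit of a diagram of operads. -/
def ColimitOb : Type u := Quotient (colimitObSetoid F)

variable {F} in
/-- The object of the colimit represented by an object in the diagram. -/
def ColimitOb.mk {j : J} (a : (F.obj j).Ob) : ColimitOb F := Quotient.mk (colimitObSetoid F) ⟨j, a⟩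

variable {F} in
/-- The value on an object of the functor from the colimit to a cocone. -/
def ColimitOb.eval (c : Cocone F) : ColimitOb F → c.pt.Ob :=
  Quotient.lift (fun x => (Map.toMap (c.ι.app x.1)).obj x.2) fun _ _ h => h c

/-- Formal composites of morphisms in a diagram of operads. -/
inductive ColimitTerm : {n : ℕ} → (Fin n → ColimitOb F) → ColimitOb F → Type u
  | of {j : J} {n : ℕ} {p : Fin n → (F.obj j).Ob} {b : (F.obj j).Ob} (ψ : (F.obj j).Hom p b) :
      ColimitTerm (fun i => ColimitOb.mk (p i)) (ColimitOb.mk b)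
  | id (a : ColimitOb F) : ColimitTerm (fun _ : Fin 1 => a) a
  | comp {n : ℕ} {p : Fin n → ColimitOb F} {b : ColimitOb F} (ψ : ColimitTerm p b)
      {k : Fin n → ℕ} {q : ∀ i, Fin (k i) → ColimitOb F} (φ : ∀ i, ColimitTerm (q i) (p i)) :
      ColimitTerm (concat q) b
  | act (h : s) {m n : ℕ} (σ : Fin m ≃ Fin n) {p : Fin n → ColimitOb F} {b : ColimitOb F}
      (ψ : ColimitTerm p b) : ColimitTerm (fun i => p (σ i)) b

variable {F} in
/-- The value of a formal composite in a cocone. -/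
def ColimitTerm.eval (c : Cocone F) : {n : ℕ} → {p : Fin n → ColimitOb F} → {b : ColimitOb F} →
    ColimitTerm F p b → c.pt.Hom (fun i => (p i).eval c) (b.eval c)
  | _, _, _, .of (j := j) ψ => (Map.toMap (c.ι.app j)).map ψ
  | _, _, _, .id a => c.pt.id (a.eval c)
  | _, _, _, .comp ψ φ => c.pt.comp (ψ.eval c) (fun i => (φ i).eval c)
  | _, _, _, .act h σ ψ => c.pt.act h σ (ψ.eval c)

/-- Two formal composites are identified in the colimit if they have the same value in every
cocone. -/
def colimitHomSetoid {n : ℕ} (p : Fin n → ColimitOb F) (b : ColimitOb F) :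
    Setoid (ColimitTerm F p b) where
  r x y := ∀ c : Cocone F, x.eval c = y.eval c
  iseqv := ⟨fun _ _ => rfl, fun h c => (h c).symm, fun h h' c => (h c).trans (h' c)⟩

/-- The morphisms of the colimit of a diagram of operads. -/
def ColimitHom {n : ℕ} (p : Fin n → ColimitOb F) (b : ColimitOb F) : Type u :=
  Quotient (colimitHomSetoid F p b)

namespace ColimitHom

variable {F}

/-- The morphism represented by a formal composite. -/
def mk {n : ℕ} {p : Fin n → ColimitOb F} {b : ColimitOb F} (x : ColimitTerm F p b) :
    ColimitHom F p b :=
  Quotient.mk _ x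

/-- The value on a morphism of the functor from the colimit to a cocone. -/
def eval (c : Cocone F) {n : ℕ} {p : Fin n → ColimitOb F} {b : ColimitOb F}
    (x : ColimitHom F p b) : c.pt.Hom (fun i => (p i).eval c) (b.eval c) :=
  Quotient.lift (s := colimitHomSetoid F p b) (fun x => x.eval c) (fun _ _ h => h c) x

/-- A formal composite that represents a morphism. -/
noncomputable def out {n : ℕ} {p : Fin n → ColimitOb F} {b : ColimitOb F} (x : ColimitHom F p b) :
    ColimitTerm F p b :=
  Quotient.out x

theorem mk_out {n : ℕ} {p : Fin n → ColimitOb F} {b : ColimitOb F} (x : ColimitHom F p b) :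
    mk x.out = x :=
  Quotient.out_eq x

theorem eval_out (c : Cocone F) {n : ℕ} {p : Fin n → ColimitOb F} {b : ColimitOb F}
    (x : ColimitHom F p b) : x.out.eval c = x.eval c := by
  conv_rhs => rw [← mk_out x]
  rfl

/-- Morphisms of the colimit are equal as soon as their values in all cocones are. -/
theorem ext {n : ℕ} {p : Fin n → ColimitOb F} {b : ColimitOb F} {x y : ColimitHom F p b}
    (h : ∀ c : Cocone F, x.eval c = y.eval c) : x = y := by
  induction x using Quotient.ind
  induction y using Quotient.ind
  exact Quotient.sound h

theorem ext_heq {m n : ℕ} {p : Fin m → ColimitOb F} {p' : Fin n → ColimitOb F}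
    {b b' : ColimitOb F} (hp : List.ofFn p = List.ofFn p') (hb : b = b')
    {x : ColimitHom F p b} {y : ColimitHom F p' b'}
    (h : ∀ c : Cocone F, HEq (x.eval c) (y.eval c)) : HEq x y := by
  obtain ⟨rfl, hp⟩ := Sigma.mk.inj_iff.1 (List.ofFn_inj'.1 hp)
  cases hp; cases hb
  exact heq_of_eq (ext fun c => eq_of_heq (h c))

/-- The composition in the colimit. -/
noncomputable def comp {n : ℕ} {p : Fin n → ColimitOb F} {b : ColimitOb F} (ψ : ColimitHom F p b)
    {k : Fin n → ℕ} {q : ∀ i, Fin (k i) → ColimitOb F} (φ : ∀ i, ColimitHom F (q i) (p i)) :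
    ColimitHom F (concat q) b :=
  mk (.comp ψ.out fun i => (φ i).out)

theorem eval_comp (c : Cocone F) {n : ℕ} {p : Fin n → ColimitOb F} {b : ColimitOb F}
    (ψ : ColimitHom F p b) {k : Fin n → ℕ} {q : ∀ i, Fin (k i) → ColimitOb F}
    (φ : ∀ i, ColimitHom F (q i) (p i)) :
    (comp ψ φ).eval c = c.pt.comp (ψ.eval c) (fun i => (φ i).eval c) := by
  simp only [← eval_out]
  exact eval_out c (mk (.comp ψ.out fun i => (φ i).out))

/-- The action of the symmetric groups on the colimit. -/
noncomputable def act (h : s) {m n : ℕ} (σ : Fin m ≃ Fin n) {p : Fin n → ColimitOb F}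
    {b : ColimitOb F} (ψ : ColimitHom F p b) : ColimitHom F (fun i => p (σ i)) b :=
  mk (.act h σ ψ.out)

theorem eval_act (c : Cocone F) (h : s) {m n : ℕ} (σ : Fin m ≃ Fin n) {p : Fin n → ColimitOb F}
    {b : ColimitOb F} (ψ : ColimitHom F p b) :
    (act h σ ψ).eval c = c.pt.act h σ (ψ.eval c) := by
  simp only [← eval_out]
  exact eval_out c (mk (.act h σ ψ.out))

end ColimitHom

/-- The colimit of a diagram of operads. Its morphisms are the formal composites of morphisms of
the diagram, two of them being identified if they have the same value in every cocone; hence all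
laws hold because they hold in every cocone. -/
noncomputable def colimitOperad : ActOperad.{u} s where
  Ob := ColimitOb F
  Hom p b := ColimitHom F p b
  id a := .mk (.id a)
  comp ψ _ _ φ := ψ.comp φ
  id_comp {_ p _} ψ := ColimitHom.ext_heq (ofFn_concat_one fun _ : Fin 1 => p) rfl fun c => by
    rw [ColimitHom.eval_comp]
    exact c.pt.id_comp (ψ.eval c)
  comp_id ψ := ColimitHom.ext_heq (ofFn_concat_of_ones _) rfl fun c => by
    rw [ColimitHom.eval_comp]
    exact c.pt.comp_id (ψ.eval c)
  assoc ψ _ _ φ _ r χ := ColimitHom.ext_heq (ofFn_concat_concat r) rfl fun c => by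
    simp only [ColimitHom.eval_comp]
    exact c.pt.assoc (ψ.eval c) (fun i => (φ i).eval c) (fun i t => (χ i t).eval c)
  act h _ _ σ _ _ ψ := ψ.act h σ
  act_refl h _ _ _ ψ := ColimitHom.ext fun c => by
    rw [ColimitHom.eval_act]
    exact c.pt.act_refl h (ψ.eval c)
  act_act h _ _ _ τ σ _ _ ψ := ColimitHom.ext fun c => by
    refine Eq.trans ?_ ((c.pt.act_act h τ σ (ψ.eval c)).trans (ψ.eval_act c h _).symm)
    rw [ColimitHom.eval_act, ColimitHom.eval_act]
  comp_act h _ _ _ ψ _ _ q φ τ := ColimitHom.ext_heq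
    (congrArg List.ofFn (funext fun j => (concat_blockSum q τ j).symm)) rfl fun c => by
      simp only [ColimitHom.eval_act, ColimitHom.eval_comp]
      exact c.pt.comp_act h (ψ.eval c) (fun i => (φ i).eval c) τ
  act_comp h _ _ σ _ _ ψ _ q φ := ColimitHom.ext_heq
    (congrArg List.ofFn (funext fun j => (concat_blockPerm q σ j).symm)) rfl fun c => by
      simp only [ColimitHom.eval_act, ColimitHom.eval_comp]
      exact c.pt.act_comp h σ (ψ.eval c) (fun i => (φ i).eval c)

/-- The functors from a diagram of operads to its colimit. -/
noncomputable def colimitι (j : J) : F.obj j ⟶ colimitOperad F where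
  obj a := ColimitOb.mk a
  map ψ := .mk (.of ψ)
  map_id a := ColimitHom.ext fun c => (c.ι.app j).map_id a
  map_comp ψ _ _ φ := ColimitHom.ext fun c => by
    refine ((c.ι.app j).map_comp ψ φ).trans ?_
    exact (ColimitHom.eval_comp c (.mk (.of ψ)) fun i => .mk (.of (φ i))).symm
  map_act h _ _ σ _ _ ψ := ColimitHom.ext fun c => by
    refine (Map.map_act (c.ι.app j) h σ ψ).trans ?_
    exact (ColimitHom.eval_act c h σ (.mk (.of ψ))).symm

/-- The cocone from a diagram of operads to its colimit. -/
noncomputable def colimitOperadCocone : Cocone F where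
  pt := colimitOperad F
  ι :=
    { app := colimitι F
      naturality := fun j j' f => by
        have e (c : Cocone F) := congrArg Map.toMap (c.w f)
        have h (a : (F.obj j).Ob) : ColimitOb.mk (F := F) ((Map.toMap (F.map f)).obj a) =
            ColimitOb.mk a :=
          Quotient.sound fun c => congrArg (fun G => NSOperad.Map.obj G a) (e c)
        exact hom_ext_heq h fun ψ => ColimitHom.ext_heq
          (congrArg List.ofFn (funext fun i => h _)) (h _) fun c =>
            NSOperad.Map.congr_map (e c) ψ }

/-- The functor from the colimit to a cocone. -/
noncomputable def colimitDesc (c : Cocone F) : colimitOperad F ⟶ c.pt where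
  obj a := a.eval c
  map ψ := ψ.eval c
  map_id _ := rfl
  map_comp ψ _ _ φ := ψ.eval_comp c φ
  map_act h _ _ σ _ _ ψ := ψ.eval_act c h σ

/-- A functor out of the colimit that is compatible with a cocone sends each formal composite to its
value in the cocone; this gives uniqueness. -/
theorem map_colimitTerm {c : Cocone F} (m : colimitOperad F ⟶ c.pt)
    (hm : ∀ j, colimitι F j ≫ m = c.ι.app j) {n : ℕ} {p : Fin n → ColimitOb F} {b : ColimitOb F}
    (x : ColimitTerm F p b) : HEq ((Map.toMap m).map (ColimitHom.mk x)) (x.eval c) := by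
  have hm' (a : ColimitOb F) : (Map.toMap m).obj a = a.eval c := by
    induction a using Quotient.ind with
    | _ a => exact congrArg (fun H => (Map.toMap H).obj a.2) (hm a.1)
  induction x with
  | of ψ => exact NSOperad.Map.congr_map (congrArg Map.toMap (hm _)) ψ
  | id a => exact (heq_of_eq (NSOperad.Map.map_id (Map.toMap m) a)).trans (NSOperad.id_heq (hm' a))
  | @comp n p b ψ k q φ ihψ ihφ =>
    have e : ColimitHom.mk (.comp ψ φ) = (ColimitHom.mk ψ).comp fun i => ColimitHom.mk (φ i) :=
      ColimitHom.ext fun c => (ColimitHom.eval_comp c (.mk ψ) fun i => .mk (φ i)).symm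
    rw [e]
    refine (heq_of_eq (NSOperad.Map.map_comp (Map.toMap m) (ColimitHom.mk ψ)
      fun i => ColimitHom.mk (φ i))).trans ?_
    refine NSOperad.comp_heq (congrArg List.ofFn (funext fun i => hm' _)) (hm' _) ihψ
      fun i i' h => ?_
    obtain rfl := Fin.ext h
    exact ⟨congrArg List.ofFn (funext fun t => hm' _), ihφ i⟩
  | @act h m' n σ p b ψ ih =>
    have e : ColimitHom.mk (.act h σ ψ) = (ColimitHom.mk ψ).act h σ :=
      ColimitHom.ext fun c => (ColimitHom.eval_act c h σ (.mk ψ)).symm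
    rw [e]
    refine (heq_of_eq (Map.map_act m h σ (ColimitHom.mk ψ))).trans ?_
    refine act_heq h (congrArg List.ofFn (funext fun i => hm' _)) (hm' _) ih fun i i' hi => ?_
    obtain rfl := Fin.ext hi
    rfl

/-- The cocone of formal composites is a colimit. -/
noncomputable def isColimitColimitOperadCocone : IsColimit (colimitOperadCocone F) where
  desc c := colimitDesc F c
  fac _ _ := rfl
  uniq c m hm := by
    refine hom_ext_heq (fun a => ?_) (fun ψ => ?_)
    · induction a using Quotient.ind with
      | _ a => exact congrArg (fun H => (Map.toMap H).obj a.2) (hm a.1)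
    · induction ψ using Quotient.ind with
      | _ x => exact map_colimitTerm F m hm x

end Colimits

instance : HasColimits (ActOperad.{u} s) where
  has_colimits_of_shape _ _ := ⟨fun F => ⟨⟨⟨_, isColimitColimitOperadCocone F⟩⟩⟩⟩

end ActOperad

/-! ### Germs in filtered diagrams of types -/

section Germs

variable {J : Type u} [SmallCategory J] [IsFiltered J]

/-- The colimit of a filtered diagram of types, described by germs. -/
def FilteredGerm (G : J ⥤ Type u) : Type u :=
  Quotient ⟨Types.FilteredColimit.Rel G, Types.FilteredColimit.rel_equiv G⟩

namespace FilteredGerm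

variable {G : J ⥤ Type u}

/-- The germ of an element. -/
def mk {j : J} (x : G.obj j) : FilteredGerm G := Quotient.mk _ ⟨j, x⟩

theorem exists_rep (x : FilteredGerm G) : ∃ (j : J) (y : G.obj j), mk y = x := by
  induction x using Quotient.ind with
  | _ x => exact ⟨x.1, x.2, rfl⟩

theorem mk_eq_iff {i j : J} {x : G.obj i} {y : G.obj j} :
    mk x = mk y ↔ ∃ (k : J) (f : i ⟶ k) (g : j ⟶ k), G.map f x = G.map g y :=
  Quotient.eq

theorem mk_map {i j : J} (f : i ⟶ j) (x : G.obj i) : mk (G.map f x) = mk x :=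
  mk_eq_iff.2 ⟨j, 𝟙 j, f, by simp⟩

/-- Finitely many arrows out of one object of a filtered category can be equalized. -/
theorem exists_finite_span {ι : Type} [Finite ι] {j : J} {k : ι → J} (f : ∀ i, j ⟶ k i) :
    ∃ (l : J) (g : ∀ i, k i ⟶ l) (h : j ⟶ l), ∀ i, f i ≫ g i = h := by
  have : Fact (Cardinal.aleph0.{0}).IsRegular := Cardinal.fact_isRegular_aleph0
  have : IsCardinalFiltered J Cardinal.aleph0.{0} := (isCardinalFiltered_aleph0_iff J).2 ‹_›
  exact IsCardinalFiltered.wideSpan f ((hasCardinalLT_aleph0_iff ι).2 ‹_›)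

/-- Finitely many equalities between germs hold at a common later stage. -/
theorem exists_map_eq {ι : Type} [Finite ι] {j : J} {x y : ι → G.obj j}
    (h : ∀ i, mk (x i) = mk (y i)) : ∃ (l : J) (f : j ⟶ l), ∀ i, G.map f (x i) = G.map f (y i) := by
  have (i : ι) : ∃ (k : J) (f : j ⟶ k), G.map f (x i) = G.map f (y i) := by
    obtain ⟨k, f, g, e⟩ := mk_eq_iff.1 (h i)
    refine ⟨IsFiltered.coeq f g, f ≫ IsFiltered.coeqHom f g, ?_⟩
    conv_rhs => rw [IsFiltered.coeq_condition]
    simp [e]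
  choose k f hf using this
  obtain ⟨l, g, h, hg⟩ := exists_finite_span f
  exact ⟨l, h, fun i => by simp [← hg i, hf i]⟩

end FilteredGerm

end Germs

/-! ### Filtered colimits -/

namespace NSOperad

/-- A morphism of an operad, with arbitrary inputs and target. -/
structure Mor (P : NSOperad.{u}) : Type u where
  {arity : ℕ}
  {inputs : Fin arity → P.Ob}
  {target : P.Ob}
  hom : P.Hom inputs target

variable {P : NSOperad.{u}}

theorem Mor.mk_eq {m n : ℕ} {p : Fin m → P.Ob} {p' : Fin n → P.Ob} {b b' : P.Ob}
    {ψ : P.Hom p b} {ψ' : P.Hom p' b'} (h : List.ofFn p = List.ofFn p') (hb : b = b')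
    (hψ : HEq ψ ψ') : Mor.mk ψ = Mor.mk ψ' := by
  obtain ⟨rfl, h⟩ := Sigma.mk.inj_iff.1 (List.ofFn_inj'.1 h)
  cases h; cases hb; cases hψ; rfl

theorem Mor.of_mk_eq {m n : ℕ} {p : Fin m → P.Ob} {p' : Fin n → P.Ob} {b b' : P.Ob}
    {ψ : P.Hom p b} {ψ' : P.Hom p' b'} (h : Mor.mk ψ = Mor.mk ψ') :
    List.ofFn p = List.ofFn p' ∧ b = b' ∧ HEq ψ ψ' := by
  cases h; exact ⟨rfl, rfl, HEq.rfl⟩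

theorem Mor.heq_of_mk_eq {n : ℕ} {p p' : Fin n → P.Ob} {b b' : P.Ob}
    {ψ : P.Hom p b} {ψ' : P.Hom p' b'} (h : Mor.mk ψ = Mor.mk ψ') :
    p = p' ∧ b = b' ∧ HEq ψ ψ' := by
  cases h; exact ⟨rfl, rfl, HEq.rfl⟩

theorem Mor.mk_castHom {m n : ℕ} {p : Fin m → P.Ob} {p' : Fin n → P.Ob} {b b' : P.Ob}
    (h : List.ofFn p = List.ofFn p') (hb : b = b') (ψ : P.Hom p b) :
    Mor.mk (castHom h hb ψ) = Mor.mk ψ :=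
  Mor.mk_eq h.symm hb.symm (castHom_heq h hb ψ)

/-- The functor that sends an operad to its set of objects. -/
def ob : NSOperad.{u} ⥤ Type u where
  obj P := P.Ob
  map F := TypeCat.ofHom (Map.obj F)

/-- The functor that sends an operad to the set of all its morphisms. -/
def mor : NSOperad.{u} ⥤ Type u where
  obj P := P.Mor
  map F := TypeCat.ofHom fun x => ⟨Map.map F x.hom⟩

end NSOperad

namespace ActOperad

open NSOperad (Mor)

variable {s : Prop}

theorem map_comp_obj {J : Type u} [SmallCategory J] (F : J ⥤ ActOperad.{u} s) {i j k : J}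
    (f : i ⟶ j) (g : j ⟶ k) (a : (F.obj i).Ob) :
    (Map.toMap (F.map (f ≫ g))).obj a =
      (Map.toMap (F.map g)).obj ((Map.toMap (F.map f)).obj a) := by
  rw [F.map_comp]; rfl

section Filtered

variable {J : Type u} [SmallCategory J] [IsFiltered J] (F : J ⥤ ActOperad.{u} s)

/-- The objects of a filtered colimit of operads. -/
abbrev GermOb : Type u := FilteredGerm (F ⋙ forget ⋙ NSOperad.ob)

/-- All the morphisms of a filtered colimit of operads. -/
abbrev GermMor : Type u := FilteredGerm (F ⋙ forget ⋙ NSOperad.mor)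

variable {F}

/-- The germ of an object. -/
def germOb {j : J} (a : (F.obj j).Ob) : GermOb F :=
  FilteredGerm.mk (G := F ⋙ forget ⋙ NSOperad.ob) (j := j) a

/-- The germ of a morphism. -/
def germMor {j : J} {n : ℕ} {p : Fin n → (F.obj j).Ob} {b : (F.obj j).Ob}
    (ψ : (F.obj j).Hom p b) : GermMor F :=
  FilteredGerm.mk (G := F ⋙ forget ⋙ NSOperad.mor) (j := j) (Mor.mk ψ)

/-- The inputs of a germ of morphisms. -/
def GermMor.inputs (x : GermMor F) : List (GermOb F) :=
  Quotient.lift (fun x : Σ j, Mor (F.obj j).toNSOperad =>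
      List.ofFn fun i => germOb (x.2.inputs i)) (by
    rintro ⟨i, x⟩ ⟨j, y⟩ ⟨k, f, g, h⟩
    have h' := congrArg (fun z : Mor (F.obj k).toNSOperad =>
      List.ofFn fun i => germOb (z.inputs i)) h
    refine Eq.trans ?_ (h'.trans ?_)
    · exact congrArg List.ofFn (funext fun _ => (FilteredGerm.mk_map f _).symm)
    · exact congrArg List.ofFn (funext fun _ => FilteredGerm.mk_map g _)) x

/-- The target of a germ of morphisms. -/
def GermMor.target (x : GermMor F) : GermOb F :=
  Quotient.lift (fun x : Σ j, Mor (F.obj j).toNSOperad => germOb x.2.target) (by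
    rintro ⟨i, x⟩ ⟨j, y⟩ ⟨k, f, g, h⟩
    have h' := congrArg (fun z : Mor (F.obj k).toNSOperad => germOb z.target) h
    refine Eq.trans ?_ (h'.trans ?_)
    · exact (FilteredGerm.mk_map f _).symm
    · exact FilteredGerm.mk_map g _) x

variable (F) in
/-- The condition that a germ of morphisms has given inputs and target. -/
def GermMor.HasType {n : ℕ} (p : Fin n → GermOb F) (b : GermOb F) (x : GermMor F) : Prop :=
  GermMor.inputs x = List.ofFn p ∧ GermMor.target x = b

variable (F) in
/-- The morphisms of a filtered colimit of operads, with given inputs and target. -/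
abbrev GermHom {n : ℕ} (p : Fin n → GermOb F) (b : GermOb F) : Type u :=
  {x : GermMor F // GermMor.HasType F p b x}

/-- A morphism of the diagram, as a morphism of the filtered colimit. -/
def germHom {j : J} {n : ℕ} {p : Fin n → (F.obj j).Ob} {b : (F.obj j).Ob}
    (ψ : (F.obj j).Hom p b) : GermHom F (fun i => germOb (p i)) (germOb b) :=
  ⟨germMor ψ, rfl, rfl⟩

theorem germHom_heq {m n : ℕ} {p : Fin m → GermOb F} {p' : Fin n → GermOb F} {b b' : GermOb F}
    (h : List.ofFn p = List.ofFn p') (hb : b = b') {x : GermHom F p b} {y : GermHom F p' b'}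
    (hxy : x.1 = y.1) : HEq x y := by
  subst hb
  exact label_heq (P := GermMor.HasType F) h hxy

theorem germOb_map {i j : J} (f : i ⟶ j) (a : (F.obj i).Ob) :
    germOb ((Map.toMap (F.map f)).obj a) = germOb a :=
  FilteredGerm.mk_map (G := F ⋙ forget ⋙ NSOperad.ob) f a

theorem germMor_map {i j : J} (f : i ⟶ j) {n : ℕ} {p : Fin n → (F.obj i).Ob} {b : (F.obj i).Ob}
    (ψ : (F.obj i).Hom p b) : germMor ((Map.toMap (F.map f)).map ψ) = germMor ψ :=
  FilteredGerm.mk_map (G := F ⋙ forget ⋙ NSOperad.mor) f (Mor.mk ψ)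

theorem germMor_castHom {j : J} {m n : ℕ} {p : Fin m → (F.obj j).Ob} {p' : Fin n → (F.obj j).Ob}
    {b b' : (F.obj j).Ob} (h : List.ofFn p = List.ofFn p') (hb : b = b') (ψ : (F.obj j).Hom p b) :
    germMor (NSOperad.castHom h hb ψ) = germMor ψ :=
  congrArg (FilteredGerm.mk (G := F ⋙ forget ⋙ NSOperad.mor) (j := j)) (Mor.mk_castHom h hb ψ)

theorem germMor_congr {j : J} {m n : ℕ} {p : Fin m → (F.obj j).Ob} {p' : Fin n → (F.obj j).Ob}
    {b b' : (F.obj j).Ob} {ψ : (F.obj j).Hom p b} {ψ' : (F.obj j).Hom p' b'}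
    (h : List.ofFn p = List.ofFn p') (hb : b = b') (hψ : HEq ψ ψ') : germMor ψ = germMor ψ' :=
  congrArg (FilteredGerm.mk (G := F ⋙ forget ⋙ NSOperad.mor) (j := j)) (Mor.mk_eq h hb hψ)

/-- The inputs and the target of a representative represent the inputs and the target of a germ. -/
theorem germ_type {j : J} {n : ℕ} {p' : Fin n → (F.obj j).Ob} {b' : (F.obj j).Ob}
    {ψ' : (F.obj j).Hom p' b'} {p : Fin n → GermOb F} {b : GermOb F} {ψ : GermHom F p b}
    (h : germMor ψ' = ψ.1) : (∀ i, germOb (p' i) = p i) ∧ germOb b' = b := by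
  have h₁ := ψ.2.1
  have h₂ := ψ.2.2
  rw [← h] at h₁ h₂
  exact ⟨fun i => congrFun (List.ofFn_injective h₁) i, h₂⟩

/-- Every morphism of the filtered colimit is the germ of a morphism of the same arity. -/
theorem exists_germHom_rep {n : ℕ} {p : Fin n → GermOb F} {b : GermOb F} (ψ : GermHom F p b) :
    ∃ (j : J) (p' : Fin n → (F.obj j).Ob) (b' : (F.obj j).Ob) (ψ' : (F.obj j).Hom p' b'),
      germMor ψ' = ψ.1 := by
  obtain ⟨x, hx, hb⟩ := ψ
  obtain ⟨j, ⟨ψ'⟩, rfl⟩ := FilteredGerm.exists_rep x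
  obtain rfl := (Sigma.mk.inj_iff.1 (List.ofFn_inj'.1 hx)).1
  exact ⟨j, _, _, ψ', rfl⟩

/-- A morphism whose target is the germ of a given object is represented, at a later stage, by
a morphism whose target is the image of that object. -/
theorem exists_germHom_rep_over {j : J} (a : (F.obj j).Ob) {n : ℕ} {p : Fin n → GermOb F}
    {b : GermOb F} (ψ : GermHom F p b) (h : germOb a = b) :
    ∃ (l : J) (f : j ⟶ l) (p' : Fin n → (F.obj l).Ob)
      (ψ' : (F.obj l).Hom p' ((Map.toMap (F.map f)).obj a)), germMor ψ' = ψ.1 := by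
  obtain ⟨i, p', b', ψ', hψ⟩ := exists_germHom_rep ψ
  obtain ⟨k, f, g, e⟩ := FilteredGerm.mk_eq_iff.1 ((germ_type hψ).2.trans h.symm)
  have e' : (Map.toMap (F.map f)).obj b' = (Map.toMap (F.map g)).obj a := e
  exact ⟨k, g, _, NSOperad.castHom rfl e' ((Map.toMap (F.map f)).map ψ'), by
    rw [germMor_castHom, germMor_map, hψ]⟩

/-- The version of `exists_germHom_rep_over` for finitely many morphisms. -/
theorem exists_germHom_reps_over {ι : Type} [Finite ι] {j : J} (a : ι → (F.obj j).Ob) {k : ι → ℕ}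
    {q : ∀ i, Fin (k i) → GermOb F} {b : ι → GermOb F} (φ : ∀ i, GermHom F (q i) (b i))
    (h : ∀ i, germOb (a i) = b i) :
    ∃ (l : J) (f : j ⟶ l) (q' : ∀ i, Fin (k i) → (F.obj l).Ob)
      (φ' : ∀ i, (F.obj l).Hom (q' i) ((Map.toMap (F.map f)).obj (a i))),
      ∀ i, germMor (φ' i) = (φ i).1 := by
  choose l f q' φ' hφ using fun i => exists_germHom_rep_over (a i) (φ i) (h i)
  obtain ⟨m, g, f', hg⟩ := FilteredGerm.exists_finite_span f
  refine ⟨m, f', _, fun i => NSOperad.castHom rfl ?_ ((Map.toMap (F.map (g i))).map (φ' i)),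
    fun i => ?_⟩
  · rw [← map_comp_obj, hg]
  · rw [germMor_castHom, germMor_map, hφ]

/-- The germ of a composite depends only on the germs of the morphisms involved. -/
theorem germMor_comp_congr {i j : J} {n : ℕ} {k : Fin n → ℕ}
    {p : Fin n → (F.obj i).Ob} {b : (F.obj i).Ob} {ψ : (F.obj i).Hom p b}
    {q : ∀ t, Fin (k t) → (F.obj i).Ob} {φ : ∀ t, (F.obj i).Hom (q t) (p t)}
    {p' : Fin n → (F.obj j).Ob} {b' : (F.obj j).Ob} {ψ' : (F.obj j).Hom p' b'}
    {q' : ∀ t, Fin (k t) → (F.obj j).Ob} {φ' : ∀ t, (F.obj j).Hom (q' t) (p' t)}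
    (hψ : germMor ψ = germMor ψ') (hφ : ∀ t, germMor (φ t) = germMor (φ' t)) :
    germMor ((F.obj i).comp ψ φ) = germMor ((F.obj j).comp ψ' φ') := by
  obtain ⟨m, f, g, -⟩ := IsFilteredOrEmpty.cocone_objs i j
  -- the equality for `ψ`, indexed by `none`, and those for the `φ t` hold at a common stage
  have key (x : Option (Fin n)) : FilteredGerm.mk (G := F ⋙ forget ⋙ NSOperad.mor) (j := m)
      (x.elim (Mor.mk ((Map.toMap (F.map f)).map ψ))
        fun t => Mor.mk ((Map.toMap (F.map f)).map (φ t))) =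
      FilteredGerm.mk (G := F ⋙ forget ⋙ NSOperad.mor) (j := m)
      (x.elim (Mor.mk ((Map.toMap (F.map g)).map ψ'))
        fun t => Mor.mk ((Map.toMap (F.map g)).map (φ' t))) := by
    cases x with
    | none => exact (germMor_map f ψ).trans (hψ.trans (germMor_map g ψ').symm)
    | some t => exact (germMor_map f (φ t)).trans ((hφ t).trans (germMor_map g (φ' t)).symm)
  obtain ⟨l, h, e⟩ := FilteredGerm.exists_map_eq key
  rw [← germMor_map f, ← germMor_map g, ← germMor_map h, ← germMor_map h]
  simp only [NSOperad.Map.map_comp]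
  obtain ⟨e₁, e₂, e₃⟩ := Mor.heq_of_mk_eq (e none)
  refine germMor_congr ?_ e₂ (NSOperad.comp_heq (congrArg List.ofFn e₁) e₂ e₃ fun t t' ht => ?_)
  · refine congrArg List.ofFn (funext fun x => ?_)
    exact congrFun (Mor.heq_of_mk_eq (e (some (finSigmaFinEquiv.symm x).1))).1 _
  · obtain rfl := Fin.ext ht
    obtain ⟨e₁, e₂, e₃⟩ := Mor.heq_of_mk_eq (e (some t))
    exact ⟨congrArg List.ofFn e₁, e₃⟩

/-- The germ of the result of the action depends only on the germ of the morphism. -/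
theorem germMor_act_congr (h : s) {i j : J} {m n : ℕ} (σ : Fin m ≃ Fin n)
    {p : Fin n → (F.obj i).Ob} {b : (F.obj i).Ob} {ψ : (F.obj i).Hom p b}
    {p' : Fin n → (F.obj j).Ob} {b' : (F.obj j).Ob} {ψ' : (F.obj j).Hom p' b'}
    (hψ : germMor ψ = germMor ψ') :
    germMor ((F.obj i).act h σ ψ) = germMor ((F.obj j).act h σ ψ') := by
  obtain ⟨l, f, g, e⟩ := FilteredGerm.mk_eq_iff.1 hψ
  rw [← germMor_map f, ← germMor_map g, Map.map_act, Map.map_act]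
  obtain ⟨e₁, e₂, e₃⟩ := Mor.heq_of_mk_eq e
  refine germMor_congr (congrArg List.ofFn (funext fun x => congrFun e₁ _)) e₂
    (act_heq h (congrArg List.ofFn e₁) e₂ e₃ fun t t' ht => ?_)
  obtain rfl := Fin.ext ht
  rfl

namespace GermHom

/-- Composable germs have composable representatives at a common stage. -/
theorem exists_comp {n : ℕ} {p : Fin n → GermOb F} {b : GermOb F} (ψ : GermHom F p b)
    {k : Fin n → ℕ} {q : ∀ i, Fin (k i) → GermOb F} (φ : ∀ i, GermHom F (q i) (p i)) :
    ∃ x : GermHom F (concat q) b, ∃ (j : J) (p' : Fin n → (F.obj j).Ob) (b' : (F.obj j).Ob)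
      (ψ' : (F.obj j).Hom p' b') (q' : ∀ t, Fin (k t) → (F.obj j).Ob)
      (φ' : ∀ t, (F.obj j).Hom (q' t) (p' t)),
      germMor ψ' = ψ.1 ∧ (∀ i, germMor (φ' i) = (φ i).1) ∧
        x.1 = germMor ((F.obj j).comp ψ' φ') := by
  obtain ⟨j, p', b', ψ', hψ⟩ := exists_germHom_rep ψ
  obtain ⟨l, f, q', φ', hφ⟩ := exists_germHom_reps_over p' φ (germ_type hψ).1
  rw [← germMor_map f] at hψ
  refine ⟨⟨germMor ((F.obj l).comp ((Map.toMap (F.map f)).map ψ') φ'), ?_, (germ_type hψ).2⟩,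
    l, _, _, _, _, φ', hψ, hφ, rfl⟩
  exact congrArg List.ofFn (funext fun x =>
    (germ_type (hφ (finSigmaFinEquiv.symm x).1)).1 (finSigmaFinEquiv.symm x).2)

/-- The composition of a filtered colimit of operads. -/
noncomputable def comp {n : ℕ} {p : Fin n → GermOb F} {b : GermOb F} (ψ : GermHom F p b)
    {k : Fin n → ℕ} {q : ∀ i, Fin (k i) → GermOb F} (φ : ∀ i, GermHom F (q i) (p i)) :
    GermHom F (concat q) b :=
  (exists_comp ψ φ).choose

/-- The composition of germs can be computed on any composable representatives. -/
theorem comp_eq {n : ℕ} {p : Fin n → GermOb F} {b : GermOb F} {ψ : GermHom F p b}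
    {k : Fin n → ℕ} {q : ∀ i, Fin (k i) → GermOb F} {φ : ∀ i, GermHom F (q i) (p i)}
    {j : J} {p' : Fin n → (F.obj j).Ob} {b' : (F.obj j).Ob} {ψ' : (F.obj j).Hom p' b'}
    {q' : ∀ t, Fin (k t) → (F.obj j).Ob} {φ' : ∀ t, (F.obj j).Hom (q' t) (p' t)}
    (hψ : germMor ψ' = ψ.1) (hφ : ∀ i, germMor (φ' i) = (φ i).1) :
    germMor ((F.obj j).comp ψ' φ') = (comp ψ φ).1 := by
  obtain ⟨j, p', b', ψ', q', φ', hψ', hφ', e⟩ := (exists_comp ψ φ).choose_spec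
  refine Eq.trans ?_ e.symm
  exact germMor_comp_congr (hψ.trans hψ'.symm) fun i => (hφ i).trans (hφ' i).symm

theorem exists_act (h : s) {m n : ℕ} (σ : Fin m ≃ Fin n) {p : Fin n → GermOb F} {b : GermOb F}
    (ψ : GermHom F p b) :
    ∃ x : GermHom F (fun i => p (σ i)) b, ∃ (j : J) (p' : Fin n → (F.obj j).Ob)
      (b' : (F.obj j).Ob) (ψ' : (F.obj j).Hom p' b'),
      germMor ψ' = ψ.1 ∧ x.1 = germMor ((F.obj j).act h σ ψ') := by
  obtain ⟨j, p', b', ψ', hψ⟩ := exists_germHom_rep ψ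
  exact ⟨⟨germMor ((F.obj j).act h σ ψ'),
    congrArg List.ofFn (funext fun x => (germ_type hψ).1 (σ x)), (germ_type hψ).2⟩,
    j, p', b', ψ', hψ, rfl⟩

/-- The action of the symmetric groups on a filtered colimit of operads. -/
noncomputable def act (h : s) {m n : ℕ} (σ : Fin m ≃ Fin n) {p : Fin n → GermOb F} {b : GermOb F}
    (ψ : GermHom F p b) : GermHom F (fun i => p (σ i)) b :=
  (exists_act h σ ψ).choose

/-- The action on germs can be computed on any representative. -/
theorem act_eq (h : s) {m n : ℕ} (σ : Fin m ≃ Fin n) {p : Fin n → GermOb F} {b : GermOb F}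
    {ψ : GermHom F p b} {j : J} {p' : Fin n → (F.obj j).Ob} {b' : (F.obj j).Ob}
    {ψ' : (F.obj j).Hom p' b'} (hψ : germMor ψ' = ψ.1) :
    germMor ((F.obj j).act h σ ψ') = (act h σ ψ).1 := by
  obtain ⟨j, p', b', ψ', hψ', e⟩ := (exists_act h σ ψ).choose_spec
  exact (germMor_act_congr h σ (hψ.trans hψ'.symm)).trans e.symm

/-- The identities of a filtered colimit of operads. -/
def id (a : GermOb F) : GermHom F (fun _ : Fin 1 => a) a :=
  ⟨Quotient.lift (fun x : Σ j, (F.obj j).Ob => germMor ((F.obj x.1).id x.2)) (by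
    rintro ⟨i, x⟩ ⟨j, y⟩ ⟨k, f, g, e⟩
    have e' : (Map.toMap (F.map f)).obj x = (Map.toMap (F.map g)).obj y := e
    refine (germMor_map f _).symm.trans (Eq.trans ?_ (germMor_map g _))
    rw [NSOperad.Map.map_id, NSOperad.Map.map_id]
    exact germMor_congr (congrArg List.ofFn (funext fun _ => e')) e' (NSOperad.id_heq e')) a, by
    induction a using Quotient.ind
    exact ⟨rfl, rfl⟩⟩

theorem id_eq {j : J} {a : (F.obj j).Ob} {a' : GermOb F} (h : germOb a = a') :
    germMor ((F.obj j).id a) = (id a').1 := by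
  subst h; rfl

end GermHom

variable (F) in
/-- An explicit description of a filtered colimit of operads: the objects and morphisms are germs
of objects and morphisms. -/
noncomputable def germOperad : ActOperad.{u} s where
  Ob := GermOb F
  Hom p b := GermHom F p b
  id a := GermHom.id a
  comp ψ _ _ φ := GermHom.comp ψ φ
  id_comp {n p b} ψ := label_heq (P := GermMor.HasType F) (ofFn_concat_one fun _ : Fin 1 => p) (by
    obtain ⟨j, p', b', ψ', hψ⟩ := exists_germHom_rep ψ
    rw [← GermHom.comp_eq (GermHom.id_eq (germ_type hψ).2) (q' := fun _ => p')
      (φ' := fun _ => ψ') (fun _ => hψ), ← hψ]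
    exact germMor_congr (ofFn_concat_one fun _ : Fin 1 => p') rfl ((F.obj j).id_comp ψ'))
  comp_id {n p b} ψ := label_heq (P := GermMor.HasType F) (ofFn_concat_of_ones p) (by
    obtain ⟨j, p', b', ψ', hψ⟩ := exists_germHom_rep ψ
    rw [← GermHom.comp_eq hψ (fun i => GermHom.id_eq ((germ_type hψ).1 i)), ← hψ]
    exact germMor_congr (ofFn_concat_of_ones p') rfl ((F.obj j).comp_id ψ'))
  assoc {n p b} ψ k q φ l r χ := label_heq (P := GermMor.HasType F) (ofFn_concat_concat r) (by
    obtain ⟨j, p', b', ψ', hψ⟩ := exists_germHom_rep ψ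
    obtain ⟨j₁, f, q', φ', hφ⟩ := exists_germHom_reps_over p' φ (germ_type hψ).1
    obtain ⟨j₂, g, r', χ', hχ⟩ := exists_germHom_reps_over
      (ι := Σ i, Fin (k i)) (fun x => q' x.1 x.2) (fun x => χ x.1 x.2)
      (fun x => (germ_type (hφ x.1)).1 x.2)
    rw [← germMor_map f, ← germMor_map g] at hψ
    have hφ' := fun i => (germMor_map g (φ' i)).trans (hφ i)
    have h₁ (i) := GermHom.comp_eq (hφ' i) (fun t => hχ ⟨i, t⟩)
    have h₂ := GermHom.comp_eq hψ hφ'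
    rw [← GermHom.comp_eq hψ h₁, ← GermHom.comp_eq h₂
      (fun x => hχ ⟨(finSigmaFinEquiv.symm x).1, (finSigmaFinEquiv.symm x).2⟩)]
    exact germMor_congr (ofFn_concat_concat fun i t => r' ⟨i, t⟩) rfl
      ((F.obj j₂).assoc _ _ fun i t => χ' ⟨i, t⟩))
  act h _ _ σ _ _ ψ := GermHom.act h σ ψ
  act_refl h _ _ _ ψ := Subtype.ext (by
    obtain ⟨j, p', b', ψ', hψ⟩ := exists_germHom_rep ψ
    exact (GermHom.act_eq h _ hψ).symm.trans
      ((congrArg germMor ((F.obj j).act_refl h ψ')).trans hψ))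
  act_act h _ _ _ τ σ _ _ ψ := Subtype.ext (by
    obtain ⟨j, p', b', ψ', hψ⟩ := exists_germHom_rep ψ
    rw [← GermHom.act_eq h τ (GermHom.act_eq h σ hψ), (F.obj j).act_act]
    exact GermHom.act_eq h (τ.trans σ) hψ)
  comp_act h _ _ _ ψ _ _ q φ τ := label_heq (P := GermMor.HasType F)
    (congrArg List.ofFn (funext fun j => (concat_blockSum q τ j).symm)) (by
      obtain ⟨j, p', b', ψ', hψ⟩ := exists_germHom_rep ψ
      obtain ⟨l, f, q', φ', hφ⟩ := exists_germHom_reps_over p' φ (germ_type hψ).1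
      rw [← germMor_map f] at hψ
      rw [← GermHom.comp_eq hψ (fun i => GermHom.act_eq h (τ i) (hφ i)),
        ← GermHom.act_eq h _ (GermHom.comp_eq hψ hφ)]
      exact germMor_congr (congrArg List.ofFn (funext fun j => (concat_blockSum q' τ j).symm)) rfl
        ((F.obj l).comp_act h _ φ' τ))
  act_comp h _ _ σ _ _ ψ _ q φ := label_heq (P := GermMor.HasType F)
    (congrArg List.ofFn (funext fun j => (concat_blockPerm q σ j).symm)) (by
      obtain ⟨j, p', b', ψ', hψ⟩ := exists_germHom_rep ψ
      obtain ⟨l, f, q', φ', hφ⟩ := exists_germHom_reps_over p' φ (germ_type hψ).1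
      rw [← germMor_map f] at hψ
      rw [← GermHom.comp_eq (GermHom.act_eq h σ hψ) (fun i => hφ (σ i)),
        ← GermHom.act_eq h _ (GermHom.comp_eq hψ hφ)]
      exact germMor_congr (congrArg List.ofFn (funext fun j => (concat_blockPerm q' σ j).symm)) rfl
        ((F.obj l).act_comp h σ _ φ'))

variable (F) in
/-- The cocone of germs. -/
noncomputable def germCocone : Cocone F where
  pt := germOperad F
  ι :=
    { app := fun _ =>
        { obj := fun a => germOb a
          map := fun ψ => germHom ψ
          map_id := fun _ => rfl
          map_comp := fun ψ _ _ φ => Subtype.ext (GermHom.comp_eq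
            (ψ := germHom ψ) (φ := fun i => germHom (φ i)) rfl fun _ => rfl)
          map_act := fun h _ _ σ _ _ ψ => Subtype.ext (GermHom.act_eq h σ (ψ := germHom ψ) rfl) }
      naturality := fun _ _ f => hom_ext_heq (germOb_map f) fun {_ p b} ψ =>
        germHom_heq (congrArg List.ofFn (funext fun i => germOb_map f (p i))) (germOb_map f b)
          (germMor_map f ψ) }

/-- The value on an object of the functor from a filtered colimit to a cocone. -/
def germDescOb (c : Cocone F) (a : GermOb F) : c.pt.Ob :=
  Quotient.lift (fun x : Σ j, (F.obj j).Ob => (Map.toMap (c.ι.app x.1)).obj x.2) (by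
    rintro ⟨i, x⟩ ⟨j, y⟩ ⟨k, f, g, e⟩
    have e' := congrArg (Map.toMap (c.ι.app k)).obj
      (show (Map.toMap (F.map f)).obj x = (Map.toMap (F.map g)).obj y from e)
    have hf := congrArg (fun H => (Map.toMap H).obj x) (c.w f)
    have hg := congrArg (fun H => (Map.toMap H).obj y) (c.w g)
    exact hf.symm.trans (e'.trans hg)) a

/-- The functor from a filtered colimit to a cocone, on all morphisms. -/
def germDescMor (c : Cocone F) (x : GermMor F) : Mor c.pt.toNSOperad :=
  Quotient.lift (fun x : Σ j, Mor (F.obj j).toNSOperad =>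
      Mor.mk ((Map.toMap (c.ι.app x.1)).map x.2.hom)) (by
    rintro ⟨i, x⟩ ⟨j, y⟩ ⟨k, f, g, e⟩
    have e' := congrArg (fun z : Mor (F.obj k).toNSOperad =>
      Mor.mk ((Map.toMap (c.ι.app k)).map z.hom))
      (show Mor.mk ((Map.toMap (F.map f)).map x.hom) = Mor.mk ((Map.toMap (F.map g)).map y.hom)
        from e)
    have hf := congrArg (fun H => Mor.mk ((Map.toMap H).map x.hom)) (c.w f)
    have hg := congrArg (fun H => Mor.mk ((Map.toMap H).map y.hom)) (c.w g)
    exact hf.symm.trans (e'.trans hg)) x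

/-- The value of a germ in a cocone has the expected inputs and target, up to equality. -/
theorem exists_germDescMor_eq (c : Cocone F) {n : ℕ} {p : Fin n → GermOb F} {b : GermOb F}
    (ψ : GermHom F p b) :
    ∃ ψ' : c.pt.Hom (fun i => germDescOb c (p i)) (germDescOb c b),
      Mor.mk ψ' = germDescMor c ψ.1 := by
  obtain ⟨j, p', b', ψ', hψ⟩ := exists_germHom_rep ψ
  obtain ⟨hp, hb⟩ := germ_type hψ
  refine ⟨NSOperad.castHom (congrArg List.ofFn (funext fun i => ?_)) ?_
    ((Map.toMap (c.ι.app j)).map ψ'), ?_⟩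
  · rw [← hp]; rfl
  · rw [← hb]; rfl
  · rw [Mor.mk_castHom, ← hψ]; rfl

/-- The functor from a filtered colimit to a cocone, on morphisms. -/
noncomputable def germDescHom (c : Cocone F) {n : ℕ} {p : Fin n → GermOb F} {b : GermOb F}
    (ψ : GermHom F p b) : c.pt.Hom (fun i => germDescOb c (p i)) (germDescOb c b) :=
  (exists_germDescMor_eq c ψ).choose

/-- The functor to a cocone can be computed on any representative. -/
theorem germDescHom_heq (c : Cocone F) {n : ℕ} {p : Fin n → GermOb F} {b : GermOb F}
    {ψ : GermHom F p b} {j : J} {p' : Fin n → (F.obj j).Ob} {b' : (F.obj j).Ob}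
    {ψ' : (F.obj j).Hom p' b'} (hψ : germMor ψ' = ψ.1) :
    HEq ((Map.toMap (c.ι.app j)).map ψ') (germDescHom c ψ) := by
  have h := (exists_germDescMor_eq c ψ).choose_spec.trans (congrArg (germDescMor c) hψ.symm)
  exact (Mor.of_mk_eq h).2.2.symm

/-- The functor from a filtered colimit to a cocone. -/
noncomputable def germDesc (c : Cocone F) : germOperad F ⟶ c.pt where
  obj a := germDescOb c a
  map ψ := germDescHom c ψ
  map_id a := by
    obtain ⟨j, a, rfl⟩ := FilteredGerm.exists_rep a
    refine eq_of_heq ((germDescHom_heq c (GermHom.id_eq rfl)).symm.trans ?_)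
    exact heq_of_eq (NSOperad.Map.map_id (Map.toMap (c.ι.app j)) a)
  map_comp ψ k q φ := by
    obtain ⟨j, p', b', ψ', hψ⟩ := exists_germHom_rep ψ
    obtain ⟨l, f, q', φ', hφ⟩ := exists_germHom_reps_over p' φ (germ_type hψ).1
    rw [← germMor_map f] at hψ
    refine eq_of_heq ((germDescHom_heq c (GermHom.comp_eq hψ hφ)).symm.trans ?_)
    rw [NSOperad.Map.map_comp]
    refine NSOperad.comp_heq (congrArg List.ofFn (funext fun i => ?_)) ?_
      (germDescHom_heq c hψ) fun i i' hi => ?_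
    · rw [← (germ_type hψ).1]; rfl
    · rw [← (germ_type hψ).2]; rfl
    · obtain rfl := Fin.ext hi
      refine ⟨congrArg List.ofFn (funext fun t => ?_), germDescHom_heq c (hφ i)⟩
      rw [← (germ_type (hφ i)).1]; rfl
  map_act h m n σ p b ψ := by
    obtain ⟨j, p', b', ψ', hψ⟩ := exists_germHom_rep ψ
    refine eq_of_heq ((germDescHom_heq c (GermHom.act_eq h σ hψ)).symm.trans ?_)
    rw [Map.map_act]
    refine act_heq h (congrArg List.ofFn (funext fun i => ?_)) ?_
      (germDescHom_heq c hψ) fun i i' hi => ?_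
    · rw [← (germ_type hψ).1]; rfl
    · rw [← (germ_type hψ).2]; rfl
    · obtain rfl := Fin.ext hi
      rfl

variable (F) in
/-- The cocone of germs is a colimit. -/
noncomputable def isColimitGermCocone : IsColimit (germCocone F) where
  desc c := germDesc c
  fac c j := hom_ext_heq (fun a => rfl) fun ψ => (germDescHom_heq c (ψ := germHom ψ) rfl).symm
  uniq c m hm := by
    have h (a : GermOb F) : (Map.toMap m).obj a = germDescOb c a := by
      obtain ⟨j, a, rfl⟩ := FilteredGerm.exists_rep a
      exact congrArg (fun H => (Map.toMap H).obj a) (hm j)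
    refine hom_ext_heq h fun {n p b} ψ => ?_
    obtain ⟨j, p', b', ψ', hψ⟩ := exists_germHom_rep (F := F) (p := p) (b := b) ψ
    refine HEq.trans ?_ (germDescHom_heq c hψ)
    refine HEq.trans ?_ (NSOperad.Map.congr_map (congrArg Map.toMap (hm j)) ψ')
    obtain ⟨hp, hb⟩ := germ_type hψ
    exact NSOperad.Map.map_heq _ (congrArg List.ofFn (funext fun i => (hp i).symm)) hb.symm
      (germHom_heq (congrArg List.ofFn (funext fun i => (hp i).symm)) hb.symm hψ.symm)

instance : PreservesColimit F (forget ⋙ NSOperad.ob) := by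
  refine preservesColimit_of_preserves_colimit_cocone (isColimitGermCocone F) ?_
  refine Types.FilteredColimit.isColimitOf _ _ (fun x => ?_) (fun i j x y h => ?_)
  · obtain ⟨j, y, h⟩ := FilteredGerm.exists_rep (G := F ⋙ forget ⋙ NSOperad.ob) x
    exact ⟨j, y, h.symm⟩
  · exact FilteredGerm.mk_eq_iff (G := F ⋙ forget ⋙ NSOperad.ob).1 h

instance : PreservesColimit F (forget ⋙ NSOperad.mor) := by
  refine preservesColimit_of_preserves_colimit_cocone (isColimitGermCocone F) ?_
  refine Types.FilteredColimit.isColimitOf _ _ (fun x => ?_) (fun i j x y h => ?_)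
  · obtain ⟨ψ⟩ := (show Mor (germOperad F).toNSOperad from x)
    obtain ⟨j, p', b', ψ', hψ⟩ := exists_germHom_rep (F := F) ψ
    obtain ⟨hp, hb⟩ := germ_type hψ
    refine ⟨j, Mor.mk ψ', ?_⟩
    refine Mor.mk_eq (P := (germOperad F).toNSOperad)
      (congrArg List.ofFn (funext fun i => (hp i).symm)) hb.symm ?_
    exact germHom_heq (congrArg List.ofFn (funext fun i => (hp i).symm)) hb.symm hψ.symm
  · refine FilteredGerm.mk_eq_iff (G := F ⋙ forget ⋙ NSOperad.mor).1 ?_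
    exact congrArg (fun z : Mor (germOperad F).toNSOperad => z.hom.1) h

end Filtered

open NSOperad (IsoFrom)

/-! ### Weak equivalences, cofibrations and fibrations -/

/-- The fully faithful and essentially surjective functors. -/
def equivalences : MorphismProperty (ActOperad.{u} s) :=
  NSOperad.equivalences.inverseImage forget

/-- The functors that are injective on objects. -/
def injectiveOnObjects : MorphismProperty (ActOperad.{u} s) :=
  NSOperad.injectiveOnObjects.inverseImage forget

/-- The functors along which isomorphisms can be lifted. -/
def isofibrations : MorphismProperty (ActOperad.{u} s) :=
  NSOperad.isofibrations.inverseImage forget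

theorem equivalences_iff {P Q : ActOperad.{u} s} (F : P ⟶ Q) :
    equivalences F ↔ (Map.toMap F).EssSurjective ∧ (Map.toMap F).FullyFaithful :=
  NSOperad.equivalences_iff (forget.map F)

theorem isofibrations_iff {P Q : ActOperad.{u} s} (F : P ⟶ Q) :
    isofibrations F ↔ ∀ (p : P.Ob) (e : IsoFrom Q.toNSOperad ((Map.toMap F).obj p)),
      ∃ e' : IsoFrom P.toNSOperad p, e'.map (Map.toMap F) = e :=
  NSOperad.isofibrations_iff (forget.map F)

end ActOperad

/-- The trivial fibrations are the fully faithful functors that are surjective on objects. -/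
theorem NSOperad.isofibrations_inf_equivalences_iff {P Q : NSOperad.{u}} (F : P ⟶ Q) :
    (isofibrations ⊓ equivalences) F ↔ Function.Surjective (Map.obj F) ∧ Map.FullyFaithful F := by
  change isofibrations F ∧ equivalences F ↔ _
  rw [equivalences_iff, isofibrations_iff]
  constructor
  · rintro ⟨h, h', h''⟩
    refine ⟨fun q => ?_, h''⟩
    obtain ⟨p, e, rfl⟩ := h' q
    obtain ⟨e', rfl⟩ := h p e
    exact ⟨e'.target, rfl⟩
  · rintro ⟨h, h'⟩
    refine ⟨fun p e => ?_, fun q => ?_, h'⟩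
    · obtain ⟨b, hb⟩ := h e.target
      obtain ⟨e', -, he'⟩ := Map.FullyFaithful.exists_isoFrom h' e hb.symm
      exact ⟨e', he'⟩
    · obtain ⟨p, rfl⟩ := h q
      exact ⟨p, IsoFrom.refl _, rfl⟩

namespace ActOperad

open NSOperad (IsoFrom)

variable {s : Prop}

theorem isofibrations_inf_equivalences_iff {P Q : ActOperad.{u} s} (F : P ⟶ Q) :
    (isofibrations ⊓ equivalences) F ↔
      Function.Surjective (Map.toMap F).obj ∧ (Map.toMap F).FullyFaithful :=
  NSOperad.isofibrations_inf_equivalences_iff (forget.map F)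

instance : (equivalences.{u} (s := s)).HasTwoOutOfThreeProperty :=
  inferInstanceAs (NSOperad.equivalences.inverseImage forget).HasTwoOutOfThreeProperty

/-! ### Induced operads and conjugate functors -/

/-- The operad with set of objects `X` whose morphisms are those of `P` between the images of the
objects under `f`. -/
def induced (P : ActOperad.{u} s) {X : Type u} (f : X → P.Ob) : ActOperad.{u} s where
  Ob := X
  Hom p b := P.Hom (fun i => f (p i)) (f b)
  id a := P.id (f a)
  comp ψ _ _ φ := P.comp ψ φ
  id_comp ψ := P.id_comp ψ
  comp_id ψ := P.comp_id ψ
  assoc ψ _ _ φ _ _ χ := P.assoc ψ φ χ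
  act h _ _ σ _ _ ψ := P.act h σ ψ
  act_refl h _ _ _ ψ := P.act_refl h ψ
  act_act h _ _ _ τ σ _ _ ψ := P.act_act h τ σ ψ
  comp_act h _ _ _ ψ _ _ _ φ τ := P.comp_act h ψ φ τ
  act_comp h _ _ σ _ _ ψ _ _ φ := P.act_comp h σ ψ φ

/-- The fully faithful functor from an induced operad. -/
def inducedProj (P : ActOperad.{u} s) {X : Type u} (f : X → P.Ob) : P.induced f ⟶ P where
  obj a := f a
  map ψ := ψ
  map_id _ := rfl
  map_comp _ _ _ _ := rfl
  map_act _ _ _ _ _ _ _ := rfl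

theorem fullyFaithful_inducedProj (P : ActOperad.{u} s) {X : Type u} (f : X → P.Ob) :
    (Map.toMap (P.inducedProj f)).FullyFaithful :=
  fun _ _ => Function.bijective_id

/-- Conjugating the values of a functor by isomorphisms gives a functor. -/
def conj {P Q : ActOperad.{u} s} (G : P ⟶ Q)
    (e : ∀ a, IsoFrom Q.toNSOperad ((Map.toMap G).obj a)) : P ⟶ Q where
  toMap := (Map.toMap G).conj e
  map_act h _ _ σ p b ψ :=
    (congrArg (NSOperad.post (e b).hom)
      ((congrArg (fun χ => NSOperad.pre (p' := fun i => (e (p (σ i))).target) χ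
          fun i => (e (p (σ i))).inv) (Map.map_act G h σ ψ)).trans
        (pre_act Q h σ ((Map.toMap G).map ψ) fun i => (e (p i)).inv))).trans
      (post_act Q h σ (e b).hom
        (NSOperad.pre ((Map.toMap G).map ψ) fun i => (e (p i)).inv))

theorem conj_congr {P Q : ActOperad.{u} s} {G G' : P ⟶ Q} (h : G = G')
    {e : ∀ a, IsoFrom Q.toNSOperad ((Map.toMap G).obj a)}
    {e' : ∀ a, IsoFrom Q.toNSOperad ((Map.toMap G').obj a)} (he : ∀ a, HEq (e a) (e' a)) :
    conj G e = conj G' e' := by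
  subst h
  obtain rfl : e = e' := funext fun a => eq_of_heq (he a)
  rfl

theorem conj_refl {P Q : ActOperad.{u} s} (G : P ⟶ Q) : conj G (fun _ => IsoFrom.refl _) = G :=
  hom_ext (NSOperad.Map.conj_refl (Map.toMap G))

theorem conj_comp {P Q R : ActOperad.{u} s} (G : P ⟶ Q)
    (e : ∀ a, IsoFrom Q.toNSOperad ((Map.toMap G).obj a)) (H : Q ⟶ R) :
    conj G e ≫ H = conj (G ≫ H) (fun a => (e a).map (Map.toMap H)) :=
  hom_ext_heq (fun _ => rfl) fun _ => heq_of_eq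
    (((Map.toMap H).map_post _ _).trans (congrArg _ ((Map.toMap H).map_pre _ _)))

/-! ### Cofibrations and trivial fibrations -/

/-- Functors can be lifted along a fully faithful functor as soon as their values on objects can. -/
theorem exists_lift_of_fullyFaithful {P Q R : ActOperad.{u} s} {F : P ⟶ Q}
    (hF : (Map.toMap F).FullyFaithful) (G : R ⟶ Q) (o : R.Ob → P.Ob)
    (ho : ∀ a, (Map.toMap F).obj (o a) = (Map.toMap G).obj a) :
    ∃ L : R ⟶ P, (∀ a, (Map.toMap L).obj a = o a) ∧ L ≫ F = G := by
  have (n : ℕ) (p : Fin n → R.Ob) (b : R.Ob) (ψ : R.Hom p b) :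
      ∃ ψ' : P.Hom (fun i => o (p i)) (o b),
        HEq ((Map.toMap F).map ψ') ((Map.toMap G).map ψ) := by
    obtain ⟨ψ', hψ⟩ := (hF (fun i => o (p i)) (o b)).2 (NSOperad.castHom
      (congrArg List.ofFn (funext fun i => (ho (p i)).symm)) (ho b).symm ((Map.toMap G).map ψ))
    exact ⟨ψ', (heq_of_eq hψ).trans (NSOperad.castHom_heq _ _ _)⟩
  choose m hm using this
  refine ⟨{ obj := o, map := fun ψ => m _ _ _ ψ, map_id := fun a => ?_,
            map_comp := fun {n p b} ψ {k q} φ => ?_, map_act := fun h _ _ σ _ _ ψ => ?_ },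
    fun _ => rfl, hom_ext_heq ho fun ψ => hm _ _ _ ψ⟩
  · refine hF.injective_heq ((hm _ _ _ _).trans ?_)
    rw [NSOperad.Map.map_id, NSOperad.Map.map_id]
    exact NSOperad.id_heq (ho a).symm
  · refine hF.injective_heq ((hm _ _ _ _).trans ?_)
    rw [NSOperad.Map.map_comp, NSOperad.Map.map_comp]
    refine NSOperad.comp_heq (congrArg List.ofFn (funext fun i => (ho _).symm)) (ho _).symm
      (hm _ _ _ ψ).symm fun i i' hi => ?_
    obtain rfl := Fin.ext hi
    exact ⟨congrArg List.ofFn (funext fun i => (ho _).symm), (hm _ _ _ (φ i)).symm⟩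
  · refine hF.injective_heq ((hm _ _ _ _).trans ?_)
    rw [Map.map_act G h, Map.map_act F h]
    refine act_heq h (congrArg List.ofFn (funext fun i => (ho _).symm)) (ho _).symm
      (hm _ _ _ ψ).symm fun i i' hi => ?_
    obtain rfl := Fin.ext hi
    rfl

/-- Functors that agree on objects agree if their composites with a fully faithful functor do. -/
theorem hom_ext_of_fullyFaithful {P Q R : ActOperad.{u} s} {F : P ⟶ Q}
    (hF : (Map.toMap F).FullyFaithful) {K L : R ⟶ P} (h : K ≫ F = L ≫ F)
    (ho : ∀ a, (Map.toMap K).obj a = (Map.toMap L).obj a) : K = L := by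
  refine hom_ext_heq ho fun {n p b} ψ => ?_
  have e : (Map.toMap K).map ψ = NSOperad.castHom
      (congrArg List.ofFn (funext fun i => (ho (p i)).symm)) (ho b).symm ((Map.toMap L).map ψ) := by
    refine hF.injective_heq ((NSOperad.Map.congr_map (congrArg Map.toMap h) ψ).trans ?_)
    exact (NSOperad.Map.map_castHom (Map.toMap F) _ _ ((Map.toMap L).map ψ)).symm
  exact (heq_of_eq e).trans (NSOperad.castHom_heq _ _ _)

/-- Cofibrations lift against trivial fibrations: the lift is chosen on objects, prescribed by the
top functor on the image of `i` and given by surjectivity elsewhere, and extends by full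
faithfulness. -/
theorem hasLiftingProperty_of_injectiveOnObjects {A B X Y : ActOperad.{u} s} (i : A ⟶ B)
    (p : X ⟶ Y) (hi : injectiveOnObjects i) (hp : (isofibrations ⊓ equivalences) p) :
    HasLiftingProperty i p := by
  obtain ⟨hp, hp'⟩ := (isofibrations_inf_equivalences_iff p).1 hp
  refine ⟨fun {u v} sq => ?_⟩
  have (b : B.Ob) : ∃ x : X.Ob, (Map.toMap p).obj x = (Map.toMap v).obj b ∧
      ∀ a, (Map.toMap i).obj a = b → x = (Map.toMap u).obj a := by
    by_cases hb : ∃ a, (Map.toMap i).obj a = b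
    · obtain ⟨a, rfl⟩ := hb
      refine ⟨(Map.toMap u).obj a, congrArg (fun H => (Map.toMap H).obj a) sq.w, fun a' h => ?_⟩
      rw [hi h]
    · obtain ⟨x, hx⟩ := hp ((Map.toMap v).obj b)
      exact ⟨x, hx, fun a h => (hb ⟨a, h⟩).elim⟩
  choose o ho ho' using this
  obtain ⟨L, hL, hL'⟩ := exists_lift_of_fullyFaithful hp' v o ho
  refine ⟨⟨⟨L, hom_ext_of_fullyFaithful hp' ?_ fun a => ?_, hL'⟩⟩⟩
  · rw [Category.assoc, hL', sq.w]
  · exact (hL _).trans (ho' _ a rfl)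

/-- `F : A ⟶ B` factors through the operad induced by `F` and the identity on the disjoint union of the
objects of `A` and `B`. -/
instance : (injectiveOnObjects.{u} (s := s)).HasFactorization (isofibrations ⊓ equivalences) where
  nonempty_mapFactorizationData {A B} F :=
    ⟨{Z := B.induced (Sum.elim (Map.toMap F).obj fun b => b)
      i := { obj := Sum.inl
             map := fun ψ => (Map.toMap F).map ψ
             map_id := fun a => F.map_id a
             map_comp := fun ψ _ _ φ => F.map_comp ψ φ
             map_act := fun h _ _ σ _ _ ψ => Map.map_act F h σ ψ }
      p := B.inducedProj _
      hi := Sum.inl_injective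
      hp := (isofibrations_inf_equivalences_iff _).2
        ⟨fun b => ⟨Sum.inr b, rfl⟩, fullyFaithful_inducedProj _ _⟩ }⟩

/-! ### Mapping path operads -/

section Path

variable {A B : ActOperad.{u} s} (F : A ⟶ B)

/-- The mapping path operad of `F : A ⟶ B`: its objects are the isomorphisms with source the image
of an object of `A`, its morphisms are those of `A`. -/
def path : ActOperad.{u} s :=
  A.induced (X := Σ a : A.Ob, IsoFrom B.toNSOperad ((Map.toMap F).obj a)) Sigma.fst

/-- The functor to the mapping path operad given by the identity isomorphisms. -/
def pathι : A ⟶ path F where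
  obj a := ⟨a, IsoFrom.refl _⟩
  map ψ := ψ
  map_id _ := rfl
  map_comp _ _ _ _ := rfl
  map_act _ _ _ _ _ _ _ := rfl

/-- The functor from the mapping path operad to the source. -/
def pathProj : path F ⟶ A := A.inducedProj _

/-- The functor from the mapping path operad given by the targets of the isomorphisms. -/
def pathπ : path F ⟶ B := conj (pathProj F ≫ F) fun x => x.2

theorem pathι_pathπ : pathι F ≫ pathπ F = F := conj_refl F

/-- Every object of the mapping path operad is isomorphic to an object of `A`. -/
def pathIso (x : (path F).Ob) : IsoFrom (path F).toNSOperad ((Map.toMap (pathι F)).obj x.1) where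
  target := x
  hom := A.id x.1
  inv := A.id x.1
  isInverse := NSOperad.Map.FullyFaithful.isInverse (F := Map.toMap (pathProj F))
    (fullyFaithful_inducedProj A _) (NSOperad.isInverse_id x.1)

theorem pathIso_pathι (a : A.Ob) : pathIso F ((Map.toMap (pathι F)).obj a) = IsoFrom.refl _ := rfl

/-- The composite of the projection from the mapping path operad and the inclusion into it is
conjugate to the identity. -/
theorem conj_pathIso : conj (pathProj F ≫ pathι F) (pathIso F) = 𝟙 (path F) :=
  hom_ext_of_fullyFaithful (F := pathProj F) (fullyFaithful_inducedProj A _)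
    ((conj_comp _ _ _).trans (conj_refl (pathProj F))) fun _ => rfl

theorem injectiveOnObjects_pathι : injectiveOnObjects (pathι F) :=
  fun _ _ h => congrArg Sigma.fst h

theorem equivalences_pathι : equivalences (pathι F) :=
  (equivalences_iff _).2 ⟨fun x => ⟨x.1, pathIso F x, rfl⟩, fun _ _ => Function.bijective_id⟩

/-- An isomorphism `e` out of the target of an object `F a ≅ b` of the mapping path operad lifts to the
isomorphism, given by the identity of `a`, to the composite `F a ≅ b ≅ b'`. -/
theorem isofibrations_pathπ : isofibrations (pathπ F) := by
  refine (isofibrations_iff _).2 fun x e => ?_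
  let y : (path F).Ob := ⟨x.1, x.2.trans e⟩
  let e' : IsoFrom (path F).toNSOperad x := ⟨y, A.id x.1, A.id x.1,
    NSOperad.Map.FullyFaithful.isInverse (F := Map.toMap (pathProj F))
      (fullyFaithful_inducedProj A _) (NSOperad.isInverse_id x.1)⟩
  refine ⟨e', IsoFrom.ext_hom rfl (heq_of_eq ?_)⟩
  have h₁ : NSOperad.pre ((Map.toMap F).map (A.id x.1)) (fun _ : Fin 1 => x.2.inv) = x.2.inv := by
    rw [NSOperad.Map.map_id]
    exact NSOperad.id_pre x.2.inv
  exact (congrArg (NSOperad.post (NSOperad.post e.hom x.2.hom)) h₁).trans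
    (NSOperad.post_post_cancel e.hom x.2.isInverse)

end Path

end ActOperad

/-! ### Retracts -/

namespace NSOperad

theorem Map.congr_obj {P Q : NSOperad.{u}} {F G : P ⟶ Q} (h : F = G) (a : P.Ob) :
    Map.obj F a = Map.obj G a := by
  rw [h]

instance : injectiveOnObjects.{u}.IsStableUnderRetracts where
  of_retract {_ _ _ _ f g} r hg a b hab := by
    have h (x) : Map.obj r.r.left (Map.obj r.i.left x) = x := Map.congr_obj r.retract_left x
    have h' (x) : Map.obj g (Map.obj r.i.left x) = Map.obj r.i.right (Map.obj f x) :=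
      Map.congr_obj r.i_w x
    rw [← h a, ← h b, hg ((h' a).trans ((congrArg _ hab).trans (h' b).symm))]

/-- Transport of an isomorphism along an equality of its source. -/
theorem IsoFrom.exists_heq {P : NSOperad.{u}} {a a' : P.Ob} (h : a = a') (e : IsoFrom P a) :
    ∃ e' : IsoFrom P a', HEq e' e ∧ e'.target = e.target := by
  subst h
  exact ⟨e, HEq.rfl, rfl⟩

instance : isofibrations.{u}.IsStableUnderRetracts where
  of_retract {P Q P' Q' f g} r hg := by
    rw [isofibrations_iff] at *
    intro a e
    have h₁ := Map.congr_obj r.i_w a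
    obtain ⟨e₁, he₁, -⟩ := (e.map r.i.right).exists_heq h₁.symm
    obtain ⟨e₂, rfl⟩ := hg _ e₁
    have h₂ := Map.congr_obj r.retract_left a
    obtain ⟨e₃, he₃, -⟩ := (e₂.map r.r.left).exists_heq h₂
    refine ⟨e₃, eq_of_heq ?_⟩
    refine (IsoFrom.map_heq rfl h₂.symm he₃).trans ?_
    have h₃ : HEq ((e₂.map r.r.left).map f) ((e₂.map g).map r.r.right) :=
      IsoFrom.map_heq (F := r.r.left ≫ f) (G := g ≫ r.r.right) r.r_w rfl (HEq.refl e₂)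
    refine h₃.trans ((IsoFrom.map_heq rfl h₁ he₁).trans ?_)
    exact IsoFrom.map_heq (F := r.i.right ≫ r.r.right) (G := 𝟙 Q) r.retract_right rfl (HEq.refl e)

instance : equivalences.{u}.IsStableUnderRetracts where
  of_retract {P Q P' Q' f g} r hg := by
    rw [equivalences_iff] at *
    obtain ⟨hg, hg'⟩ := hg
    refine ⟨fun q => ?_, fun {n} p b => ⟨fun ψ ψ' h => ?_, fun χ => ?_⟩⟩
    · obtain ⟨p', e, he⟩ := hg (Map.obj r.i.right q)
      obtain ⟨e', -, he'⟩ := (e.map r.r.right).exists_heq (Map.congr_obj r.r_w p').symm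
      exact ⟨Map.obj r.r.left p', e', he'.trans
        ((congrArg (Map.obj r.r.right) he).trans (Map.congr_obj r.retract_right q))⟩
    · have h₁ : HEq (Map.map g (Map.map r.i.left ψ)) (Map.map g (Map.map r.i.left ψ')) :=
        (Map.congr_map r.i_w ψ).trans ((heq_of_eq (congrArg (Map.map r.i.right) h)).trans
          (Map.congr_map r.i_w ψ').symm)
      have h₂ := congrArg (Map.map r.r.left) (hg'.injective_heq h₁)
      exact eq_of_heq ((Map.congr_map r.retract_left ψ).symm.trans
        ((heq_of_eq h₂).trans (Map.congr_map r.retract_left ψ')))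
    · have h₁ (x) := Map.congr_obj r.i_w x
      have h₂ (x) := Map.congr_obj r.retract_left x
      obtain ⟨ω, hω⟩ := (hg' (fun i => Map.obj r.i.left (p i)) (Map.obj r.i.left b)).2
        (castHom (congrArg List.ofFn (funext fun i => (h₁ (p i)).symm)) (h₁ b).symm
          (Map.map r.i.right χ))
      refine ⟨castHom (congrArg List.ofFn (funext fun i => h₂ (p i))) (h₂ b)
        (Map.map r.r.left ω), eq_of_heq ((Map.map_castHom f _ _ _).trans ?_)⟩
      refine (Map.congr_map r.r_w ω).trans ?_
      refine (heq_of_eq (congrArg (Map.map r.r.right) hω)).trans ?_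
      exact (Map.map_castHom r.r.right _ _ _).trans (Map.congr_map r.retract_right χ)

end NSOperad

namespace ActOperad

open NSOperad (IsoFrom)

variable {s : Prop}

instance : (injectiveOnObjects.{u} (s := s)).IsStableUnderRetracts :=
  inferInstanceAs (NSOperad.injectiveOnObjects.inverseImage forget).IsStableUnderRetracts

instance : (isofibrations.{u} (s := s)).IsStableUnderRetracts :=
  inferInstanceAs (NSOperad.isofibrations.inverseImage forget).IsStableUnderRetracts

instance : (equivalences.{u} (s := s)).IsStableUnderRetracts :=
  inferInstanceAs (NSOperad.equivalences.inverseImage forget).IsStableUnderRetracts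

/-! ### Trivial cofibrations and fibrations -/

/-- Isofibrations lift isomorphisms, and thereby extensions of functors to the mapping path operad,
all of whose objects are isomorphic to objects of the source. -/
theorem hasLiftingProperty_pathι {A B X Y : ActOperad.{u} s} (F : A ⟶ B) (p : X ⟶ Y)
    (hp : isofibrations p) : HasLiftingProperty (pathι F) p := by
  rw [isofibrations_iff] at hp
  refine ⟨fun {u v} sq => ?_⟩
  have ho (a : A.Ob) : (Map.toMap p).obj ((Map.toMap u).obj a) =
      (Map.toMap v).obj ((Map.toMap (pathι F)).obj a) := congrArg (fun H => (Map.toMap H).obj a) sq.w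
  -- lifts of the isomorphisms `pathIso F x`, which are identities on the image of `pathι F`
  have (x : (path F).Ob) : ∃ d : IsoFrom X.toNSOperad ((Map.toMap u).obj x.1),
      HEq (d.map (Map.toMap p)) ((pathIso F x).map (Map.toMap v)) ∧
      ∀ a, (Map.toMap (pathι F)).obj a = x → HEq d (IsoFrom.refl ((Map.toMap u).obj a)) := by
    by_cases hx : ∃ a, (Map.toMap (pathι F)).obj a = x
    · obtain ⟨a, rfl⟩ := hx
      refine ⟨IsoFrom.refl _, ?_, fun a' h => ?_⟩
      · rw [IsoFrom.map_refl, pathIso_pathι, IsoFrom.map_refl]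
        exact IsoFrom.refl_heq (ho a)
      · obtain rfl := injectiveOnObjects_pathι F h
        rfl
    · obtain ⟨e, he, -⟩ := ((pathIso F x).map (Map.toMap v)).exists_heq (ho x.1).symm
      obtain ⟨d, rfl⟩ := hp _ e
      exact ⟨d, he, fun a h => (hx ⟨a, h⟩).elim⟩
  choose d hd hd' using this
  -- the lift sends `x` to the target of `d x`
  refine ⟨⟨⟨conj (pathProj F ≫ u) d, ?_, ?_⟩⟩⟩
  · refine (conj_congr (G' := u) rfl fun a => hd' _ a rfl).trans (conj_refl u)
  · refine (conj_comp (pathProj F ≫ u) d p).trans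
      ((conj_congr (G' := (pathProj F ≫ pathι F) ≫ v) ?_ hd).trans ?_)
    · rw [Category.assoc, Category.assoc, sq.w]
    · exact (conj_comp (pathProj F ≫ pathι F) (pathIso F) v).symm.trans
        (by rw [conj_pathIso, Category.id_comp])

/-- A trivial cofibration `i` is a retract of the inclusion into its mapping path operad, since
`pathπ i` is then a trivial fibration; hence it lifts against isofibrations. -/
theorem hasLiftingProperty_of_isofibrations {A B X Y : ActOperad.{u} s} (i : A ⟶ B) (p : X ⟶ Y)
    (hi : (injectiveOnObjects ⊓ equivalences) i) (hp : isofibrations p) :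
    HasLiftingProperty i p := by
  have hπ : equivalences (pathπ i) :=
    equivalences.of_precomp (pathι i) (pathπ i) (equivalences_pathι i)
      (by rw [pathι_pathπ]; exact hi.2)
  have := hasLiftingProperty_of_injectiveOnObjects i (pathπ i) hi.1 ⟨isofibrations_pathπ i, hπ⟩
  have sq : CommSq (pathι i) i (pathπ i) (𝟙 B) := ⟨by rw [pathι_pathπ, Category.comp_id]⟩
  have := hasLiftingProperty_pathι i p hp
  have r : RetractArrow i (pathι i) :=
    { i := Arrow.homMk (𝟙 A) sq.lift (by simp)
      r := Arrow.homMk (𝟙 A) (pathπ i) (by simp [pathι_pathπ])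
      retract := by ext1 <;> simp }
  have : (MorphismProperty.ofHoms fun _ : Unit => p).llp.IsStableUnderRetracts := inferInstance
  refine MorphismProperty.of_retract (P := (MorphismProperty.ofHoms fun _ : Unit => p).llp) r
    (fun _ _ q hq => ?_) p ⟨()⟩
  obtain ⟨⟩ := hq
  assumption

instance : (injectiveOnObjects.{u} (s := s) ⊓ equivalences).HasFactorization isofibrations where
  nonempty_mapFactorizationData {_ _} F :=
    ⟨{Z := path F
      i := pathι F
      p := pathπ F
      fac := pathι_pathπ F
      hi := ⟨injectiveOnObjects_pathι F, equivalences_pathι F⟩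
      hp := isofibrations_pathπ F }⟩

/-! ### The model structures -/

/-- The canonical model structure. -/
instance : ModelCategory (ActOperad.{u} s) :=
  letI : CategoryWithCofibrations (ActOperad.{u} s) := ⟨injectiveOnObjects⟩
  letI : CategoryWithFibrations (ActOperad.{u} s) := ⟨isofibrations⟩
  letI : CategoryWithWeakEquivalences (ActOperad.{u} s) := ⟨equivalences⟩
  { categoryWithCofibrations := ⟨injectiveOnObjects⟩
    categoryWithFibrations := ⟨isofibrations⟩
    categoryWithWeakEquivalences := ⟨equivalences⟩
    cm2 := (inferInstance : (equivalences (s := s)).HasTwoOutOfThreeProperty)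
    cm3a := (inferInstance : (equivalences (s := s)).IsStableUnderRetracts)
    cm3b := (inferInstance : (isofibrations (s := s)).IsStableUnderRetracts)
    cm3c := (inferInstance : (injectiveOnObjects (s := s)).IsStableUnderRetracts)
    cm4a := fun i p hi hi' hp => hasLiftingProperty_of_isofibrations i p
      ⟨(cofibration_iff i).1 hi, (weakEquivalence_iff i).1 hi'⟩ ((fibration_iff p).1 hp)
    cm4b := fun i p hi hp hp' => hasLiftingProperty_of_injectiveOnObjects i p
      ((cofibration_iff i).1 hi) ⟨(fibration_iff p).1 hp, (weakEquivalence_iff p).1 hp'⟩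
    cm5a := (inferInstance : ((injectiveOnObjects (s := s) ⊓ equivalences).HasFactorization isofibrations))
    cm5b := (inferInstance : ((injectiveOnObjects (s := s)).HasFactorization (isofibrations ⊓ equivalences))) }

end ActOperad

/-- The canonical model structure on the category of non-symmetric operads. Its classes correspond
by definition to those on `ActOperad False`. -/
noncomputable abbrev NSOperad.modelCategory : ModelCategory NSOperad.{u} :=
  letI : CategoryWithCofibrations NSOperad.{u} := ⟨injectiveOnObjects⟩
  letI : CategoryWithFibrations NSOperad.{u} := ⟨isofibrations⟩
  letI : CategoryWithWeakEquivalences NSOperad.{u} := ⟨equivalences⟩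
  ModelCategory.transport NSOperad.toAct.asEquivalence rfl rfl rfl

/-- The canonical model structure on the category of symmetric operads. -/
noncomputable abbrev SymOperad.modelCategory : ModelCategory SymOperad.{u} :=
  letI : CategoryWithCofibrations SymOperad.{u} := ⟨injectiveOnObjects⟩
  letI : CategoryWithFibrations SymOperad.{u} := ⟨isofibrations⟩
  letI : CategoryWithWeakEquivalences SymOperad.{u} := ⟨equivalences⟩
  ModelCategory.transport SymOperad.toAct.asEquivalence rfl rfl rfl

/-! ### Finite presentability of families of parallel morphisms -/

section Stages

variable {J : Type u} [SmallCategory J] [IsFiltered J] {G : J ⥤ Type u} {t : Cocone G}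

/-- Finitely many elements of a filtered colimit come from a common stage. -/
theorem exists_finite_rep (ht : IsColimit t) {ι : Type} [Finite ι] (x : ι → t.pt) :
    ∃ (j : J) (y : ι → G.obj j), ∀ i, t.ι.app j (y i) = x i := by
  choose j y hy using fun i => Types.jointly_surjective_of_isColimit ht (x i)
  have : Fact (Cardinal.aleph0.{0}).IsRegular := Cardinal.fact_isRegular_aleph0
  have : IsCardinalFiltered J Cardinal.aleph0.{0} := (isCardinalFiltered_aleph0_iff J).2 ‹_›
  have hι := (hasCardinalLT_aleph0_iff ι).2 ‹_›
  refine ⟨IsCardinalFiltered.max j hι, fun i => G.map (IsCardinalFiltered.toMax j hι i) (y i),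
    fun i => ?_⟩
  rw [← hy i]
  exact ConcreteCategory.congr_hom (t.w (IsCardinalFiltered.toMax j hι i)) (y i)

/-- Finitely many equalities in a filtered colimit hold at a common later stage. -/
theorem exists_finite_map_eq (ht : IsColimit t) {ι : Type} [Finite ι] {j : J} {x y : ι → G.obj j}
    (h : ∀ i, t.ι.app j (x i) = t.ι.app j (y i)) :
    ∃ (k : J) (f : j ⟶ k), ∀ i, G.map f (x i) = G.map f (y i) := by
  choose k f hf using fun i => (Types.FilteredColimit.isColimit_eq_iff' ht _ _).1 (h i)
  obtain ⟨l, g, h, hg⟩ := FilteredGerm.exists_finite_span f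
  exact ⟨l, h, fun i => by simp [← hg i, hf i]⟩

end Stages

namespace NSOperad

/-- A family of parallel `n`-ary morphisms. -/
structure ParallelFamily (n : ℕ) (S : Type) (P : NSOperad.{u}) : Type u where
  inputs : Fin n → P.Ob
  target : P.Ob
  hom : S → P.Hom inputs target

variable {n : ℕ} {S : Type}

theorem ParallelFamily.ext_heq {P : NSOperad.{u}} {x y : ParallelFamily n S P}
    (h : ∀ i, x.inputs i = y.inputs i) (h' : x.target = y.target)
    (h'' : ∀ s, HEq (x.hom s) (y.hom s)) : x = y := by
  obtain ⟨p, b, ψ⟩ := x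
  obtain ⟨p', b', ψ'⟩ := y
  obtain rfl : p = p' := funext h
  obtain rfl : b = b' := h'
  obtain rfl : ψ = ψ' := funext fun s => eq_of_heq (h'' s)
  rfl

/-- The image of a family of parallel morphisms under a functor. -/
def ParallelFamily.map {P Q : NSOperad.{u}} (F : Map P Q) (x : ParallelFamily n S P) :
    ParallelFamily n S Q :=
  ⟨fun i => F.obj (x.inputs i), F.obj x.target, fun s => F.map (x.hom s)⟩

/-- The functor that sends an operad to the set of its families of parallel morphisms. -/
def parallel (n : ℕ) (S : Type) : NSOperad.{u} ⥤ Type u where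
  obj P := ParallelFamily n S P
  map F := TypeCat.ofHom (ParallelFamily.map F)

/-- If objects and single morphisms commute with a filtered colimit, so do finite families of parallel
morphisms. -/
instance {C : Type w} [Category.{u} C] (U : C ⥤ NSOperad.{u}) {J : Type u} [SmallCategory J]
    [IsFiltered J] (F : J ⥤ C) [PreservesColimit F (U ⋙ ob)] [PreservesColimit F (U ⋙ mor)]
    [Finite S] : PreservesColimit F (U ⋙ parallel n S) where
  preserves {c} hc := by
    have hob := isColimitOfPreserves (U ⋙ ob) hc
    have hmor := isColimitOfPreserves (U ⋙ mor) hc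
    refine ⟨Types.FilteredColimit.isColimitOf' _ _ (fun x => ?_) (fun j x y h => ?_)⟩
    · obtain ⟨p, b, ψ⟩ := (show ParallelFamily n S (U.obj c.pt) from x)
      -- representatives of the inputs, of the target (indexed by `none`) and of the morphisms
      obtain ⟨j₁, o₁, ho₁⟩ := exists_finite_rep hob
        (fun i : Option (Fin n) => (i.elim b p : (U.obj c.pt).Ob))
      obtain ⟨j₂, ω₂, hω₂⟩ := exists_finite_rep hmor
        (fun s => (Mor.mk (ψ s) : (U.obj c.pt).Mor))
      obtain ⟨j, o, ω, ho, hω⟩ : ∃ (j : J) (o : Option (Fin n) → (U.obj (F.obj j)).Ob)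
          (ω : S → (U.obj (F.obj j)).Mor),
          (∀ i, Map.obj (U.map (c.ι.app j)) (o i) = i.elim b p) ∧
          ∀ s, Mor.mk (Map.map (U.map (c.ι.app j)) (ω s).hom) = Mor.mk (ψ s) := by
        refine ⟨IsFiltered.max j₁ j₂,
          fun i => (F ⋙ U ⋙ ob).map (IsFiltered.leftToMax j₁ j₂) (o₁ i),
          fun s => (F ⋙ U ⋙ mor).map (IsFiltered.rightToMax j₁ j₂) (ω₂ s), fun i => ?_, fun s => ?_⟩
        · exact (ConcreteCategory.congr_hom (((U ⋙ ob).mapCocone c).w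
            (IsFiltered.leftToMax j₁ j₂)) (o₁ i)).trans (ho₁ i)
        · exact (ConcreteCategory.congr_hom (((U ⋙ mor).mapCocone c).w
            (IsFiltered.rightToMax j₁ j₂)) (ω₂ s)).trans (hω₂ s)
      have (s : S) : ∃ (q : Fin n → (U.obj (F.obj j)).Ob) (a : (U.obj (F.obj j)).Ob)
          (χ : (U.obj (F.obj j)).Hom q a),
          Mor.mk (Map.map (U.map (c.ι.app j)) χ) = Mor.mk (ψ s) := by
        have h := hω s
        generalize ω s = z at h
        obtain ⟨χ⟩ := z
        obtain rfl := by simpa using congrArg List.length (Mor.of_mk_eq h).1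
        exact ⟨_, _, χ, h⟩
      choose q a χ hχ using this
      -- the inputs and targets of the `χ s` agree with the chosen objects at a later stage
      obtain ⟨k, f, hf⟩ := exists_finite_map_eq hob
        (x := fun t : S × Option (Fin n) => (t.2.elim (a t.1) (q t.1) : (U.obj (F.obj j)).Ob))
        (y := fun t => o t.2) (by
          rintro ⟨s, i⟩
          obtain ⟨hp, hb, -⟩ := Mor.heq_of_mk_eq (hχ s)
          refine Eq.trans ?_ (ho i).symm
          cases i with
          | none => exact hb
          | some i => exact congrFun hp i)
      have hq (s : S) (i : Fin n) : Map.obj (U.map (F.map f)) (q s i) =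
          Map.obj (U.map (F.map f)) (o (some i)) := hf ⟨s, some i⟩
      have ha (s : S) : Map.obj (U.map (F.map f)) (a s) =
          Map.obj (U.map (F.map f)) (o none) := hf ⟨s, none⟩
      have hk : U.map (F.map f) ≫ U.map (c.ι.app k) = U.map (c.ι.app j) := by
        rw [← U.map_comp, c.w]
      refine ⟨k, ⟨fun i => Map.obj (U.map (F.map f)) (o (some i)),
        Map.obj (U.map (F.map f)) (o none),
        fun s => castHom (congrArg List.ofFn (funext (hq s))) (ha s)
          (Map.map (U.map (F.map f)) (χ s))⟩,
        ParallelFamily.ext_heq (fun i => ?_) ?_ (fun s => ?_)⟩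
      · exact ((Map.congr_obj hk _).trans (ho (some i))).symm
      · exact ((Map.congr_obj hk _).trans (ho none)).symm
      · refine HEq.symm ((Map.map_castHom (U.map (c.ι.app k))
          (congrArg List.ofFn (funext (hq s))) (ha s) _).trans ?_)
        exact (Map.congr_map hk (χ s)).trans (Mor.heq_of_mk_eq (hχ s)).2.2
    · change ParallelFamily n S (U.obj (F.obj j)) at x y
      obtain ⟨p, b, ψ⟩ := x
      obtain ⟨p', b', ψ'⟩ := y
      have hp (i : Option (Fin n)) : Map.obj (U.map (c.ι.app j)) (i.elim b p) =
          Map.obj (U.map (c.ι.app j)) (i.elim b' p') := by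
        cases i with
        | none => exact congrArg ParallelFamily.target h
        | some i => exact congrArg (fun z : ParallelFamily n S (U.obj c.pt) => z.inputs i) h
      have hψ (s : S) : Mor.mk (Map.map (U.map (c.ι.app j)) (ψ s)) =
          Mor.mk (Map.map (U.map (c.ι.app j)) (ψ' s)) :=
        congrArg (fun z : ParallelFamily n S (U.obj c.pt) => Mor.mk (z.hom s)) h
      obtain ⟨k₁, f₁, hf₁⟩ := exists_finite_map_eq hob hp
      obtain ⟨k₂, f₂, hf₂⟩ := exists_finite_map_eq hmor (x := fun s => Mor.mk (ψ s))
        (y := fun s => Mor.mk (ψ' s)) hψ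
      obtain ⟨k, g₁, g₂, e⟩ := IsFiltered.span f₁ f₂
      have h₁ (i : Option (Fin n)) : Map.obj (U.map (F.map (f₁ ≫ g₁))) (i.elim b p) =
          Map.obj (U.map (F.map (f₁ ≫ g₁))) (i.elim b' p') := by
        rw [F.map_comp, U.map_comp]
        exact congrArg (Map.obj (U.map (F.map g₁))) (hf₁ i)
      have h₂ (s : S) : Mor.mk (Map.map (U.map (F.map (f₁ ≫ g₁))) (ψ s)) =
          Mor.mk (Map.map (U.map (F.map (f₁ ≫ g₁))) (ψ' s)) := by
        rw [e, F.map_comp, U.map_comp]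
        exact congrArg (fun z : Mor _ => Mor.mk (Map.map (U.map (F.map g₂)) z.hom)) (hf₂ s)
      exact ⟨k, f₁ ≫ g₁, ParallelFamily.ext_heq (fun i => h₁ (some i)) (h₁ none)
        fun s => (Mor.heq_of_mk_eq (h₂ s)).2.2⟩

end NSOperad

/-! ### Lifting properties with respect to corepresenting objects -/

/-- If `A` and `B` corepresent `D` and `E` and precomposition with `i : A ⟶ B` corresponds to `ρ`,
then `F` has the right lifting property with respect to `i` if and only if the map from `E.obj X`
to the fibre product of `D.obj X` and `E.obj Y` is surjective. -/
theorem hasLiftingProperty_iff_of_corepresentableBy {C : Type w} [Category.{v} C]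
    {D E : C ⥤ Type v} {A B : C} (α : D.CorepresentableBy A) (β : E.CorepresentableBy B)
    {i : A ⟶ B} {ρ : ∀ X, E.obj X → D.obj X}
    (hρ : ∀ (X : C) (g : B ⟶ X), α.homEquiv (i ≫ g) = ρ X (β.homEquiv g)) {X Y : C} (F : X ⟶ Y) :
    HasLiftingProperty i F ↔ ∀ (x : D.obj X) (y : E.obj Y), D.map F x = ρ Y y →
      ∃ z : E.obj X, ρ X z = x ∧ E.map F z = y := by
  constructor
  · intro h x y hxy
    have sq : CommSq (α.homEquiv.symm x) i F (β.homEquiv.symm y) := ⟨α.homEquiv.injective (by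
      rw [α.homEquiv_comp, hρ, Equiv.apply_symm_apply, Equiv.apply_symm_apply, hxy])⟩
    refine ⟨β.homEquiv sq.lift, ?_, ?_⟩
    · rw [← hρ, sq.fac_left, Equiv.apply_symm_apply]
    · rw [← β.homEquiv_comp, sq.fac_right, Equiv.apply_symm_apply]
  · refine fun h => ⟨fun {f g} sq => ?_⟩
    obtain ⟨z, hz, hz'⟩ := h (α.homEquiv f) (β.homEquiv g) (by rw [← α.homEquiv_comp, ← hρ, sq.w])
    refine ⟨⟨⟨β.homEquiv.symm z, α.homEquiv.injective ?_, β.homEquiv.injective ?_⟩⟩⟩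
    · rw [hρ, Equiv.apply_symm_apply, hz]
    · rw [β.homEquiv_comp, Equiv.apply_symm_apply, hz']

theorem rlp_sup {C : Type w} [Category.{v} C] (W W' : MorphismProperty C) {X Y : C} (F : X ⟶ Y) :
    (W ⊔ W').rlp F ↔ W.rlp F ∧ W'.rlp F :=
  ⟨fun h => ⟨fun _ _ i hi => h i (Or.inl hi), fun _ _ i hi => h i (Or.inr hi)⟩,
    fun h _ _ i hi => hi.elim (h.1 i) (h.2 i)⟩

theorem rlp_ofHoms {C : Type w} [Category.{v} C] {ι : Type*} {A B : ι → C} (i : ∀ k, A k ⟶ B k)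
    {X Y : C} (F : X ⟶ Y) :
    (MorphismProperty.ofHoms i).rlp F ↔ ∀ k, HasLiftingProperty (i k) F :=
  ⟨fun h k => h _ ⟨k⟩, fun h _ _ _ hi => by obtain ⟨k⟩ := hi; exact h k⟩

namespace NSOperad

/-- The restriction of a family of parallel morphisms along a map of index sets. -/
def ParallelFamily.comap {n : ℕ} {S T : Type} (g : S → T) {P : NSOperad.{u}}
    (x : ParallelFamily n T P) : ParallelFamily n S P :=
  ⟨x.inputs, x.target, fun s => x.hom (g s)⟩

/-- The functor that sends an operad to the set of its isomorphisms. -/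
def isos : NSOperad.{u} ⥤ Type u where
  obj P := Σ a : P.Ob, IsoFrom P a
  map F := TypeCat.ofHom fun x => ⟨Map.obj F x.1, x.2.map F⟩

/-- The target of an isomorphism if `e` is true, its source otherwise. -/
def endpoint (e : Bool) {P : NSOperad.{u}} (x : Σ a : P.Ob, IsoFrom P a) : P.Ob :=
  cond e x.2.target x.1

section LiftingProperties

variable {C : Type w} [Category.{u} C] {U : C ⥤ NSOperad.{u}} {A B X Y : C} {i : A ⟶ B}
  (F : X ⟶ Y)

/-- Lifting against `∅ ⟶ ⋆`. -/
theorem hasLiftingProperty_iff_surjective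
    (α : ((Functor.const C).obj PUnit.{u + 1}).CorepresentableBy A)
    (β : (U ⋙ ob).CorepresentableBy B) (i : A ⟶ B) :
    HasLiftingProperty i F ↔ Function.Surjective (Map.obj (U.map F)) := by
  rw [hasLiftingProperty_iff_of_corepresentableBy α β (ρ := fun _ _ => PUnit.unit) fun _ _ => rfl]
  exact ⟨fun h y => (h PUnit.unit y rfl).imp fun _ hz => hz.2,
    fun h _ y _ => (h y).imp fun _ hz => ⟨rfl, hz⟩⟩

/-- Lifting against `⋆ ⟶ H`. If `⋆` is sent to the target of the isomorphism of `H`, the inverses of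
isomorphisms are lifted. -/
theorem hasLiftingProperty_iff_isofibrations (α : (U ⋙ ob).CorepresentableBy A)
    (β : (U ⋙ isos).CorepresentableBy B) (e : Bool)
    (h : ∀ (X : C) (g : B ⟶ X), α.homEquiv (i ≫ g) = endpoint e (P := U.obj X) (β.homEquiv g)) :
    HasLiftingProperty i F ↔ isofibrations (U.map F) := by
  rw [hasLiftingProperty_iff_of_corepresentableBy α β (ρ := fun X => endpoint e (P := U.obj X)) h,
    isofibrations_iff]
  change (∀ (x : (U.obj X).Ob) (y : Σ b : (U.obj Y).Ob, IsoFrom (U.obj Y) b),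
    Map.obj (U.map F) x = endpoint e y → ∃ z : Σ a : (U.obj X).Ob, IsoFrom (U.obj X) a,
      endpoint e z = x ∧ (⟨Map.obj (U.map F) z.1, z.2.map (U.map F)⟩ :
        Σ b : (U.obj Y).Ob, IsoFrom (U.obj Y) b) = y) ↔ _
  have hsymm {P : NSOperad.{u}} {y z : Σ b : P.Ob, IsoFrom P b} (h : y = z) :
      (⟨y.2.target, y.2.symm⟩ : Σ b : P.Ob, IsoFrom P b) = ⟨z.2.target, z.2.symm⟩ := by rw [h]
  cases e
  · refine ⟨fun h x j => ?_, ?_⟩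
    · obtain ⟨⟨_, j'⟩, rfl, hj⟩ := h x ⟨_, j⟩ rfl
      exact ⟨j', eq_of_heq (Sigma.mk.inj hj).2⟩
    · rintro h x ⟨_, j⟩ rfl
      obtain ⟨j', rfl⟩ := h x j
      exact ⟨⟨x, j'⟩, rfl, rfl⟩
  · refine ⟨fun h x j => ?_, ?_⟩
    · obtain ⟨⟨_, j'⟩, rfl, hj⟩ := h x ⟨_, j.symm⟩ rfl
      exact ⟨j'.symm, eq_of_heq (Sigma.mk.inj (hsymm hj)).2⟩
    · rintro h x ⟨_, j⟩ hx
      obtain ⟨j', hj'⟩ : ∃ j' : IsoFrom (U.obj X) x,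
          (⟨_, j'.map (U.map F)⟩ : Σ b : (U.obj Y).Ob, IsoFrom (U.obj Y) b) = ⟨j.target, j.symm⟩ := by
        change Map.obj (U.map F) x = j.target at hx
        obtain ⟨k, hk, -⟩ := j.symm.exists_heq hx.symm
        obtain ⟨j', rfl⟩ := h x k
        exact ⟨j', Sigma.ext hx hk⟩
      exact ⟨⟨_, j'.symm⟩, rfl, hsymm hj'⟩

variable {S T : Type}

/-- Lifting against `∂Ar_n ⟶ Ar_n`. -/
theorem hasLiftingProperty_iff_map_surjective [IsEmpty S] [Unique T] {n : ℕ}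
    (α : (U ⋙ parallel n S).CorepresentableBy A) (β : (U ⋙ parallel n T).CorepresentableBy B)
    (f : S → T) (h : ∀ (X : C) (g : B ⟶ X),
      α.homEquiv (i ≫ g) = ParallelFamily.comap f (P := U.obj X) (β.homEquiv g)) :
    HasLiftingProperty i F ↔ ∀ (p : Fin n → (U.obj X).Ob) (b : (U.obj X).Ob),
      Function.Surjective fun ψ : (U.obj X).Hom p b => Map.map (U.map F) ψ := by
  rw [hasLiftingProperty_iff_of_corepresentableBy α β
    (ρ := fun X => ParallelFamily.comap f (P := U.obj X)) h]
  change (∀ (x : ParallelFamily n S (U.obj X)) (y : ParallelFamily n T (U.obj Y)),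
    ParallelFamily.map (U.map F) x = y.comap f →
      ∃ z : ParallelFamily n T (U.obj X), z.comap f = x ∧ z.map (U.map F) = y) ↔ _
  constructor
  · intro h p b χ
    obtain ⟨⟨p', b', ψ⟩, hz, hz'⟩ := h ⟨p, b, isEmptyElim⟩ ⟨_, _, fun _ => χ⟩
      (ParallelFamily.ext_heq (fun _ => rfl) rfl isEmptyElim)
    obtain rfl : p' = p := congrArg ParallelFamily.inputs hz
    obtain rfl : b' = b := congrArg ParallelFamily.target hz
    refine ⟨ψ default, eq_of_heq ?_⟩
    have := congrArg (fun z : ParallelFamily n T (U.obj Y) => Mor.mk (z.hom default)) hz'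
    exact (Mor.heq_of_mk_eq this).2.2
  · rintro h ⟨p, b, _⟩ ⟨q, c, χ⟩ hx
    have hq := congrArg ParallelFamily.inputs hx
    have hc := congrArg ParallelFamily.target hx
    cases hq
    cases hc
    choose ψ hψ using fun t => h p b (χ t)
    exact ⟨⟨p, b, ψ⟩, ParallelFamily.ext_heq (fun _ => rfl) rfl isEmptyElim,
      ParallelFamily.ext_heq (fun _ => rfl) rfl fun t => heq_of_eq (hψ t)⟩

/-- Lifting against `PAr_n ⟶ Ar_n`. -/
theorem hasLiftingProperty_iff_map_injective [Unique T] {n : ℕ}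
    (α : (U ⋙ parallel n S).CorepresentableBy A) (β : (U ⋙ parallel n T).CorepresentableBy B)
    (f : S → T) {a b : S} (hab : a ≠ b) (hS : ∀ s, s = a ∨ s = b) (h : ∀ (X : C) (g : B ⟶ X),
      α.homEquiv (i ≫ g) = ParallelFamily.comap f (P := U.obj X) (β.homEquiv g)) :
    HasLiftingProperty i F ↔ ∀ (p : Fin n → (U.obj X).Ob) (b : (U.obj X).Ob),
      Function.Injective fun ψ : (U.obj X).Hom p b => Map.map (U.map F) ψ := by
  rw [hasLiftingProperty_iff_of_corepresentableBy α β
    (ρ := fun X => ParallelFamily.comap f (P := U.obj X)) h]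
  change (∀ (x : ParallelFamily n S (U.obj X)) (y : ParallelFamily n T (U.obj Y)),
    ParallelFamily.map (U.map F) x = y.comap f →
      ∃ z : ParallelFamily n T (U.obj X), z.comap f = x ∧ z.map (U.map F) = y) ↔ _
  constructor
  · classical
    intro h p c ψ ψ' hψ
    obtain ⟨⟨_, _, χ⟩, hz, -⟩ := h ⟨p, c, fun s => if s = a then ψ else ψ'⟩
      ⟨_, _, fun _ => Map.map (U.map F) ψ⟩ (ParallelFamily.ext_heq (fun _ => rfl) rfl fun s => by
        rcases hS s with rfl | rfl
        · exact heq_of_eq (by simp [ParallelFamily.map, ParallelFamily.comap])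
        · refine heq_of_eq ?_
          simp only [ParallelFamily.map, ParallelFamily.comap, if_neg hab.symm]
          exact hψ.symm)
    have key (s : S) : HEq (χ default) (if s = a then ψ else ψ') := by
      have := congrArg (fun z : ParallelFamily n S (U.obj X) => Mor.mk (z.hom s)) hz
      rw [← Subsingleton.elim (f s) default]
      exact (Mor.heq_of_mk_eq this).2.2
    have h₁ := key a
    have h₂ := key b
    rw [if_pos rfl] at h₁
    rw [if_neg hab.symm] at h₂
    exact eq_of_heq (h₁.symm.trans h₂)
  · rintro h ⟨p, c, ψ⟩ ⟨q, d, χ⟩ hx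
    have hq := congrArg ParallelFamily.inputs hx
    have hc := congrArg ParallelFamily.target hx
    cases hq
    cases hc
    have hχ (s : S) : Map.map (U.map F) (ψ s) = χ default := by
      have := congrArg (fun z : ParallelFamily n S (U.obj Y) => Mor.mk (z.hom s)) hx
      rw [← Subsingleton.elim (f s) default]
      exact eq_of_heq (Mor.heq_of_mk_eq this).2.2
    exact ⟨⟨p, c, fun _ => ψ a⟩, ParallelFamily.ext_heq (fun _ => rfl) rfl fun s =>
        heq_of_eq (h p c ((hχ a).trans (hχ s).symm)),
      ParallelFamily.ext_heq (fun _ => rfl) rfl fun t =>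
        heq_of_eq ((hχ a).trans (by rw [Subsingleton.elim t default]))⟩

end LiftingProperties

end NSOperad

/-! ### The small object argument -/

section SmallObject

attribute [local instance] Cardinal.fact_isRegular_aleph0 Cardinal.orderBotAleph0OrdToType

instance isFiltered_aleph0_ord_toType : IsFiltered (Cardinal.aleph0.{u}).ord.ToType :=
  isFiltered_of_isCardinalFiltered _ Cardinal.aleph0.{u}

theorem isSmall_sup {C : Type w} [Category.{v} C] (W W' : MorphismProperty C)
    [MorphismProperty.IsSmall.{u} W] [MorphismProperty.IsSmall.{u} W'] :
    MorphismProperty.IsSmall.{u} (W ⊔ W') := by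
  rw [sup_eq_iSup]
  have (b : Bool) : MorphismProperty.IsSmall.{u} (cond b W W') := by
    cases b <;> assumption
  exact MorphismProperty.isSmall_iSup _

/-- A small set of morphisms with finitely presentable sources permits the small object
argument. -/
theorem hasSmallObjectArgument_of_preservesColimit {C : Type w} [Category.{u} C] [HasColimits C]
    (I : MorphismProperty C) [MorphismProperty.IsSmall.{u} I]
    (h : ∀ {A B : C} (i : A ⟶ B), I i → ∀ {J : Type u} [SmallCategory J] [IsFiltered J] (F : J ⥤ C),
      PreservesColimit F (coyoneda.obj (Opposite.op A))) :
    MorphismProperty.HasSmallObjectArgument.{u} I where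
  exists_cardinal := ⟨Cardinal.aleph0, inferInstance, inferInstance,
    { preservesColimit := fun i hi _ hf => h i hi hf.F }⟩

theorem preservesColimit_coyoneda {C : Type w} [Category.{v} C] {J : Type u} [Category.{u} J]
    {F : J ⥤ C} {D : C ⥤ Type v} {A : C} (α : D.CorepresentableBy A) [PreservesColimit F D] :
    PreservesColimit F (coyoneda.obj (Opposite.op A)) :=
  preservesColimit_of_natIso F α.toIso.symm

instance {C : Type w} [Category.{v} C] {J : Type u} [SmallCategory J] [IsFiltered J] (F : J ⥤ C) :
    PreservesColimit F ((Functor.const C).obj PUnit.{u + 1}) where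
  preserves _ := ⟨Types.FilteredColimit.isColimitOf' _ _
    (fun _ => ⟨(IsFiltered.nonempty (C := J)).some, PUnit.unit, rfl⟩) fun j _ _ _ => ⟨j, 𝟙 j, rfl⟩⟩

end SmallObject

/-! ### Functors out of the operads `∅`, `⋆` and `H` -/

/-- An element of `D.obj A` from which every element of a value of `D` is obtained by a unique
morphism exhibits `A` as a corepresenting object of `D`. -/
noncomputable def corepresentableByOfBijective {C : Type w} [Category.{v} C] {D : C ⥤ Type v}
    {A : C} (x : D.obj A) (h : ∀ Y : C, Function.Bijective fun g : A ⟶ Y => D.map g x) :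
    D.CorepresentableBy A where
  homEquiv {Y} := Equiv.ofBijective _ (h Y)
  homEquiv_comp f g := by simp

theorem ofFn_one {X : Type u} (p : Fin 1 → X) : List.ofFn p = [p 0] := by
  simp

theorem ofFn_comp_of_singleton {X Y : Type u} (o : X → Y) {n : ℕ} {p : Fin n → X} {a : X}
    (h : List.ofFn p = [a]) :
    List.ofFn (fun i => o (p i)) = List.ofFn (fun _ : Fin 1 => o a) := by
  rw [show (fun i => o (p i)) = o ∘ p from rfl, ← List.map_ofFn, h]
  simp

namespace NSOperad

theorem IsoFrom.heq_of_hom_heq {P : NSOperad.{u}} {a a' : P.Ob} (ha : a = a') {e : IsoFrom P a}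
    {e' : IsoFrom P a'} (h : e.target = e'.target) (h' : HEq e.hom e'.hom) : HEq e e' := by
  subst ha
  exact heq_of_eq (IsoFrom.ext_hom h h')

/-- The morphism `a → b` of the operad with exactly one unary morphism between any two objects. -/
def unaryIndiscreteHom {X : Type u} (a b : X) :
    (unaryIndiscrete X).Hom (fun _ : Fin 1 => a) b :=
  ⟨PUnit.unit, rfl⟩

theorem unaryIndiscrete_heq {X : Type u} {n : ℕ} {p : Fin n → X} {a b : X}
    (ψ : (unaryIndiscrete X).Hom p b) (h : List.ofFn p = [a]) :
    HEq ψ (unaryIndiscreteHom a b) :=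
  label_heq (P := (unaryLabelling X).Allowed) (h.trans (by simp)) rfl

theorem exists_ofFn_eq_of_unaryIndiscrete {X : Type u} {n : ℕ} {p : Fin n → X} {b : X}
    (ψ : (unaryIndiscrete X).Hom p b) : ∃ a, List.ofFn p = [a] := by
  obtain rfl : n = 1 := ψ.2
  exact ⟨p 0, by simp⟩

section Lift

variable {X : Type u} {Q : NSOperad.{u}}

/-- A functor out of the operad with exactly one unary morphism between any two objects is a
coherent system of unary morphisms. -/
theorem exists_map_unaryIndiscrete (o : X → Q.Ob)
    (θ : ∀ a b, Q.Hom (fun _ : Fin 1 => o a) (o b)) (hid : ∀ a, θ a a = Q.id (o a))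
    (hcomp : ∀ a b c, post (θ b c) (θ a b) = θ a c) :
    ∃ F : unaryIndiscrete X ⟶ Q, (∀ a, Map.obj F a = o a) ∧
      ∀ a b, HEq (Map.map F (unaryIndiscreteHom a b)) (θ a b) := by
  have (n : ℕ) (p : Fin n → X) (b : X) (ψ : (unaryIndiscrete X).Hom p b) :
      ∃ χ : Q.Hom (fun i => o (p i)) (o b), ∀ a, List.ofFn p = [a] → HEq χ (θ a b) := by
    obtain ⟨a, ha⟩ := exists_ofFn_eq_of_unaryIndiscrete ψ
    refine ⟨castHom (ofFn_comp_of_singleton o ha).symm rfl (θ a b), fun a' ha' => ?_⟩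
    obtain rfl : a = a' := by simpa using ha.symm.trans ha'
    exact castHom_heq _ _ _
  choose m hm using this
  refine ⟨{ obj := o, map := fun ψ => m _ _ _ ψ, map_id := fun a => ?_,
            map_comp := fun {n p b} ψ {k q} φ => ?_ }, fun _ => rfl, fun a b => ?_⟩
  · exact eq_of_heq ((hm _ _ _ _ a (ofFn_one _)).trans (heq_of_eq (hid a)))
  · obtain rfl : n = 1 := ψ.2
    obtain ⟨a, ha⟩ := exists_ofFn_eq_of_unaryIndiscrete (φ 0)
    have hq : List.ofFn (concat q) = [a] := (ofFn_concat_one q).trans ha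
    have hθ : HEq (Q.comp (m _ _ _ ψ) fun i => m _ _ _ (φ i))
        (Q.comp (θ (p 0) b) fun _ : Fin 1 => θ a (p 0)) := by
      refine comp_heq (ofFn_comp_of_singleton o (ofFn_one p)) rfl (hm _ _ _ ψ _ (ofFn_one p))
        fun i i' _ => ?_
      obtain rfl := Subsingleton.elim i 0
      exact ⟨ofFn_comp_of_singleton o ha, hm _ _ _ (φ 0) a ha⟩
    refine eq_of_heq ((hm _ _ _ _ a hq).trans (HEq.trans ?_ hθ.symm))
    exact (heq_of_eq (hcomp a (p 0) b).symm).trans (post_heq _ _)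
  · exact hm _ _ _ _ a (ofFn_one _)

theorem unaryIndiscrete_hom_ext {F G : unaryIndiscrete X ⟶ Q} (h : ∀ a, Map.obj F a = Map.obj G a)
    (h' : ∀ a b, HEq (Map.map F (unaryIndiscreteHom a b)) (Map.map G (unaryIndiscreteHom a b))) :
    F = G := by
  refine Map.ext_heq h fun {n p b} ψ => ?_
  obtain rfl : n = 1 := ψ.2
  have hp : List.ofFn p = [p 0] := ofFn_one p
  have hψ := unaryIndiscrete_heq ψ hp
  have h₁ : HEq (Map.map F ψ) (Map.map F (unaryIndiscreteHom (p 0) b)) :=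
    Map.map_heq F (hp.trans (ofFn_one fun _ => p 0).symm) rfl hψ
  have h₂ : HEq (Map.map G ψ) (Map.map G (unaryIndiscreteHom (p 0) b)) :=
    Map.map_heq G (hp.trans (ofFn_one fun _ => p 0).symm) rfl hψ
  exact h₁.trans ((h' _ _).trans h₂.symm)

end Lift

/-- `∅` corepresents the one-point set. -/
theorem bijective_map_empty (Q : NSOperad.{u}) : Function.Bijective
    fun _ : unaryIndiscrete PEmpty.{u + 1} ⟶ Q => PUnit.unit.{u + 1} := by
  refine ⟨fun F G _ => unaryIndiscrete_hom_ext (fun a => a.elim) fun a => a.elim, fun _ => ?_⟩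
  obtain ⟨F, -⟩ := exists_map_unaryIndiscrete (X := PEmpty.{u + 1}) (Q := Q) PEmpty.elim
    (fun a => a.elim) (fun a => a.elim) fun a => a.elim
  exact ⟨F, rfl⟩

/-- `⋆` corepresents objects. -/
theorem bijective_map_star (Q : NSOperad.{u}) : Function.Bijective
    fun F : unaryIndiscrete PUnit.{u + 1} ⟶ Q => Map.obj F PUnit.unit := by
  refine ⟨fun F G h => unaryIndiscrete_hom_ext (fun _ => h) fun a _ => ?_, fun b => ?_⟩
  · have h₁ := Map.map_id F a
    have h₂ := Map.map_id G a
    exact (heq_of_eq h₁).trans ((id_heq h).trans (heq_of_eq h₂.symm))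
  · obtain ⟨F, hF, -⟩ := exists_map_unaryIndiscrete (X := PUnit.{u + 1}) (fun _ => b)
      (fun _ _ => Q.id b) (fun _ => rfl) fun _ _ _ => id_post _
    exact ⟨F, hF _⟩

/-- The isomorphism of `H`. -/
def freeIso : Σ a : (unaryIndiscrete (ULift.{u} Bool)).Ob, IsoFrom (unaryIndiscrete _) a :=
  ⟨ULift.up false, ULift.up true, unaryIndiscreteHom _ _, unaryIndiscreteHom _ _,
    rfl, rfl⟩

/-- `H` corepresents isomorphisms. -/
theorem bijective_map_freeIso (Q : NSOperad.{u}) : Function.Bijective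
    fun F : unaryIndiscrete (ULift.{u} Bool) ⟶ Q => isos.map F freeIso := by
  refine ⟨fun F G h => ?_, ?_⟩
  · have h₁ : Map.obj F (ULift.up false) = Map.obj G (ULift.up false) := congrArg Sigma.fst h
    have h₂ : Map.obj F (ULift.up true) = Map.obj G (ULift.up true) :=
      congrArg (fun z : Σ a : Q.Ob, IsoFrom Q a => z.2.target) h
    have h₃ := congrArg (fun z : Σ a : Q.Ob, IsoFrom Q a => Mor.mk z.2.hom) h
    have h₄ := congrArg (fun z : Σ a : Q.Ob, IsoFrom Q a => Mor.mk z.2.inv) h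
    have ho (a) : Map.obj F a = Map.obj G a := by
      obtain ⟨_ | _⟩ := a
      exacts [h₁, h₂]
    refine unaryIndiscrete_hom_ext ho fun a b => ?_
    have hid (a) : HEq (Map.map F (unaryIndiscreteHom a a)) (Map.map G (unaryIndiscreteHom a a)) :=
      (heq_of_eq (Map.map_id F a)).trans ((id_heq (ho a)).trans (heq_of_eq (Map.map_id G a).symm))
    obtain ⟨_ | _⟩ := a <;> obtain ⟨_ | _⟩ := b
    exacts [hid _, (Mor.heq_of_mk_eq h₃).2.2, (Mor.heq_of_mk_eq h₄).2.2, hid _]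
  · rintro ⟨a, e⟩
    let o : ULift.{u} Bool → Q.Ob := fun x => cond x.down e.target a
    obtain ⟨F, hF, hF'⟩ := exists_map_unaryIndiscrete (Q := Q) o
      (fun x y => match x, y with
        | ⟨false⟩, ⟨false⟩ => Q.id a
        | ⟨false⟩, ⟨true⟩ => e.hom
        | ⟨true⟩, ⟨false⟩ => e.inv
        | ⟨true⟩, ⟨true⟩ => Q.id e.target)
      (by rintro ⟨_ | _⟩ <;> rfl)
      (by
        rintro ⟨_ | _⟩ ⟨_ | _⟩ ⟨_ | _⟩
        exacts [id_post _, post_id _, e.isInverse.post_left, id_post _, id_post _,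
          e.isInverse.post_right, post_id _, id_post _])
    exact ⟨F, Sigma.ext (hF _) (IsoFrom.heq_of_hom_heq (hF _) (hF _)
      (hF' (ULift.up false) (ULift.up true)))⟩

end NSOperad

/-- Permutations act trivially on unary morphisms. -/
theorem SymOperad.act_heq_of_unary (P : SymOperad.{u}) {m n : ℕ} (hn : n = 1) (σ : Fin m ≃ Fin n)
    {p : Fin n → P.Ob} {b : P.Ob} (ψ : P.Hom p b) : HEq (P.act σ ψ) ψ := by
  obtain rfl : m = n := by simpa using Fintype.card_congr σ
  subst hn
  obtain rfl : σ = Equiv.refl _ := Subsingleton.elim _ _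
  exact heq_of_eq (P.act_refl ψ)

/-- Functors of symmetric operads out of an operad with unary morphisms only are functors of the
underlying operads. -/
theorem SymOperad.bijective_toMap_unaryIndiscrete {X : Type u} (Q : SymOperad.{u}) :
    Function.Bijective fun F : unaryIndiscrete X ⟶ Q => forget.map F := by
  refine ⟨fun F G h => SymOperad.hom_ext h, fun F => ?_⟩
  refine ⟨SymOperad.Map.mk F fun {m n} σ p b ψ => ?_, rfl⟩
  have hσ : List.ofFn (fun i => p (σ i)) = List.ofFn p := by
    obtain ⟨a, ha⟩ := NSOperad.exists_ofFn_eq_of_unaryIndiscrete ψ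
    exact (List.perm_singleton.1 ((perm_ofFn_comp σ p).trans (List.Perm.of_eq ha))).trans ha.symm
  exact eq_of_heq ((NSOperad.Map.map_heq F hσ rfl ((unaryIndiscrete X).act_heq_of_unary ψ.2 σ ψ)).trans
    (Q.act_heq_of_unary ψ.2 σ (NSOperad.Map.map F ψ)).symm)

/-! ### Functors out of the operads `Ar_n`, `∂Ar_n` and `PAr_n` -/

theorem ofFn_comp_of_eq {X Y : Type u} (o : X → Y) {m n : ℕ} {p : Fin m → X} {p' : Fin n → X}
    (h : List.ofFn p = List.ofFn p') :
    List.ofFn (fun i => o (p i)) = List.ofFn (fun i => o (p' i)) := by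
  rw [show (fun i => o (p i)) = o ∘ p from rfl, show (fun i => o (p' i)) = o ∘ p' from rfl,
    ← List.map_ofFn, h, List.map_ofFn]

theorem eq_one_of_ofFn_eq_singleton {X : Type u} {n : ℕ} {p : Fin n → X} {a : X}
    (h : List.ofFn p = [a]) : n = 1 := by
  simpa using congrArg List.length h

/-- Suppose that a morphism of the operad of a labelling is an identity unless only identities can be
composed into its inputs. Then a functor out of this operad is a map on objects and morphisms that
preserves identities. -/
def Labelling.lift {X M : Type u} [AddCommMonoid M] (L : Labelling X M) {Q : NSOperad.{u}}
    (o : X → Q.Ob)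
    (m : ∀ {n : ℕ} {p : Fin n → X} {b : X}, L.operad.Hom p b → Q.Hom (fun i => o (p i)) (o b))
    (hid : ∀ {n : ℕ} {p : Fin n → X} {b : X} (ψ : L.operad.Hom p b), List.ofFn p = [b] →
      HEq (m ψ) (Q.id (o b)))
    (hL : ∀ {n : ℕ} {p : Fin n → X} {b : X} {x : M}, L.Allowed p b x →
      (List.ofFn p = [b] ∧ x = 0) ∨ ∀ (i : Fin n) {k : ℕ} {q : Fin k → X} {y : M},
        L.Allowed q (p i) y → List.ofFn q = [p i] ∧ y = 0) :
    NSOperad.Map L.operad Q where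
  obj := o
  map := m
  map_id a := eq_of_heq (hid (L.operad.id a) (ofFn_one _))
  map_comp {n p b} ψ k q φ := by
    have hm {n n' : ℕ} {p : Fin n → X} {p' : Fin n' → X} {b b' : X} {ψ : L.operad.Hom p b}
        {ψ' : L.operad.Hom p' b'} (h : List.ofFn p = List.ofFn p') (hb : b = b')
        (hψ : ψ.1 = ψ'.1) : HEq (m ψ) (m ψ') := by
      have := label_heq (P := L.Allowed) h (b := b) (x := ψ) (y := hb ▸ ψ') (by cases hb; exact hψ)
      obtain ⟨rfl, h⟩ := Sigma.mk.inj_iff.1 (List.ofFn_inj'.1 h)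
      cases h; cases hb; cases this; rfl
    rcases hL ψ.2 with ⟨hp, hx⟩ | h
    · obtain rfl : n = 1 := eq_one_of_ofFn_eq_singleton hp
      obtain rfl : p 0 = b := List.singleton_inj.1 ((ofFn_one p).symm.trans hp)
      have h₁ : HEq (m (L.operad.comp ψ φ)) (m (φ 0)) :=
        hm (ofFn_concat_one q) rfl (by simp [Labelling.operad, hx])
      have h₂ : HEq (Q.comp (m ψ) fun i => m (φ i))
          (Q.comp (Q.id (o (p 0))) fun _ : Fin 1 => m (φ 0)) :=
        NSOperad.comp_heq (ofFn_comp_of_singleton o hp) rfl (hid ψ hp) fun i i' _ => by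
          obtain rfl := Subsingleton.elim i 0
          exact ⟨rfl, HEq.rfl⟩
      exact eq_of_heq (h₁.trans (h₂.trans (Q.id_comp _)).symm)
    · have h' (i) := h i (φ i).2
      have h₁ : HEq (m (L.operad.comp ψ φ)) (m ψ) :=
        hm (ofFn_concat_of_singleton fun i => (h' i).1) rfl (by simp [Labelling.operad, (h' _).2])
      have h₂ : HEq (Q.comp (m ψ) fun i => m (φ i)) (Q.comp (m ψ) fun i => Q.id (o (p i))) :=
        NSOperad.comp_heq_right _ fun i =>
          ⟨ofFn_comp_of_singleton o (h' i).1, hid (φ i) (h' i).1⟩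
      exact eq_of_heq (h₁.trans (h₂.trans (Q.comp_id _)).symm)

theorem ulift_eq_zero {x : ULift.{u} ℕ} (h : x.down = 0) : x = 0 := ULift.ext _ _ h

/-- The values on objects of the functor out of `Ar_n` determined by a family of morphisms. -/
def NSOperad.ParallelFamily.ob {n : ℕ} {S : Type} {Q : NSOperad.{u}} (x : ParallelFamily n S Q)
    (a : ULift.{u} (Fin (n + 1))) : Q.Ob :=
  Fin.cases x.target x.inputs a.down

namespace NSOperad

/-- The generators of `arrows n S`. -/
def arrowsFamily (n : ℕ) (S : Set ℕ) : ParallelFamily n S (arrows.{u} n S) :=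
  ⟨fun i => ULift.up i.succ, ULift.up 0, fun s => ⟨ULift.up s, Or.inr ⟨rfl, rfl, s.2⟩⟩⟩

theorem ParallelFamily.ofFn_ob {n : ℕ} {S : Type} {Q : NSOperad.{u}} (x : ParallelFamily n S Q)
    {m : ℕ} {p : Fin m → ULift.{u} (Fin (n + 1))} (h : List.ofFn p = arrowInputs n) :
    List.ofFn (fun i => x.ob (p i)) = List.ofFn x.inputs :=
  ofFn_comp_of_eq x.ob h

theorem singleton_ne_arrowInputs {n : ℕ} : [ULift.up 0] ≠ arrowInputs.{u} n := fun h =>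
  zero_not_mem_arrowInputs n (h ▸ List.mem_singleton_self _)

/-- Every family of parallel morphisms is the image of the generators of `arrows n S`. No two
generators are composable, since `0` is not an input of a generator. -/
theorem exists_map_arrows {n : ℕ} {S : Set ℕ} {Q : NSOperad.{u}} (x : ParallelFamily n S Q) :
    ∃ F : arrows n S ⟶ Q, (arrowsFamily n S).map F = x := by
  have (m : ℕ) (p : Fin m → ULift.{u} (Fin (n + 1))) (b : ULift.{u} (Fin (n + 1)))
      (ψ : (arrows n S).Hom p b) : ∃ χ : Q.Hom (fun i => x.ob (p i)) (x.ob b),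
      (List.ofFn p = [b] → HEq χ (Q.id (x.ob b))) ∧ (List.ofFn p = arrowInputs n → b = ULift.up 0 →
        ∀ s : S, ψ.1.down = s → HEq χ (x.hom s)) := by
    obtain ⟨y, hy⟩ := ψ
    rcases hy with ⟨hp, -⟩ | ⟨hp, rfl, hs⟩
    · refine ⟨castHom (ofFn_comp_of_singleton x.ob hp).symm rfl (Q.id (x.ob b)),
        fun _ => castHom_heq _ _ _, ?_⟩
      rintro hp' rfl
      exact (singleton_ne_arrowInputs (hp.symm.trans hp')).elim
    · refine ⟨castHom (x.ofFn_ob hp).symm rfl (x.hom ⟨_, hs⟩), fun hp' =>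
        (singleton_ne_arrowInputs (hp'.symm.trans hp)).elim, fun _ _ s hs' => ?_⟩
      obtain rfl : (⟨_, hs⟩ : S) = s := Subtype.ext hs'
      exact castHom_heq _ _ _
  choose m hm hm' using this
  refine ⟨Labelling.lift _ x.ob (fun ψ => m _ _ _ ψ) (fun ψ => hm _ _ _ ψ) fun {_ p b y} hy => ?_,
    ParallelFamily.ext_heq (fun _ => rfl) rfl fun s => hm' _ _ _ _ rfl rfl s rfl⟩
  rcases hy with ⟨hp, hy⟩ | ⟨hp, -⟩
  · exact Or.inl ⟨hp, ulift_eq_zero hy⟩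
  · refine Or.inr fun i k q y hy => ?_
    rcases hy with ⟨hq, hy⟩ | ⟨-, hi, -⟩
    · exact ⟨hq, ulift_eq_zero hy⟩
    · refine (zero_not_mem_arrowInputs n ?_).elim
      rw [← hi, ← hp]
      exact List.mem_ofFn.2 ⟨i, rfl⟩

theorem arrows_obj_eq {n : ℕ} {Q : NSOperad.{u}}
    {F G : ULift.{u} (Fin (n + 1)) → Q.Ob} (h : F (ULift.up 0) = G (ULift.up 0))
    (h' : ∀ i : Fin n, F (ULift.up i.succ) = G (ULift.up i.succ)) (a) : F a = G a := by
  obtain ⟨a⟩ := a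
  cases a using Fin.cases with
  | zero => exact h
  | succ i => exact h' i

/-- `arrows n S` corepresents the families of parallel `n`-ary morphisms indexed by `S`. -/
theorem bijective_map_arrows (n : ℕ) (S : Set ℕ) (Q : NSOperad.{u}) :
    Function.Bijective fun F : arrows n S ⟶ Q => (parallel n S).map F (arrowsFamily n S) := by
  refine ⟨fun F G h => ?_, exists_map_arrows⟩
  have ho : ∀ a, Map.obj F a = Map.obj G a := arrows_obj_eq
    (congrArg ParallelFamily.target h)
    fun i => congrFun (congrArg ParallelFamily.inputs h) i
  refine Map.ext_heq ho fun {m p b} ψ => ?_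
  obtain ⟨y, hy⟩ := ψ
  have hy₀ := hy
  rcases hy₀ with ⟨hp, hy'⟩ | ⟨hp, rfl, hs⟩
  · have hψ : HEq (⟨y, hy⟩ : (arrows n S).Hom p b) ((arrows n S).id b) :=
      label_heq (P := ArrowHom n S) (hp.trans (ofFn_one fun _ => b).symm) (ulift_eq_zero hy')
    have hp' : List.ofFn p = List.ofFn fun _ : Fin 1 => b := hp.trans (ofFn_one fun _ => b).symm
    have h₁ := (Map.map_heq F hp' rfl hψ).trans (heq_of_eq (Map.map_id F b))
    have h₂ := (Map.map_heq G hp' rfl hψ).trans (heq_of_eq (Map.map_id G b))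
    exact h₁.trans ((id_heq (ho b)).trans h₂.symm)
  · have hψ : HEq (⟨y, hy⟩ : (arrows n S).Hom p (ULift.up 0)) ((arrowsFamily n S).hom ⟨_, hs⟩) :=
      label_heq (P := ArrowHom n S) hp rfl
    have h₁ := Map.map_heq F hp rfl hψ
    have h₂ := Map.map_heq G hp rfl hψ
    have h₃ := congrArg (fun z : ParallelFamily n S Q => Mor.mk (z.hom ⟨_, hs⟩)) h
    exact h₁.trans ((Mor.heq_of_mk_eq h₃).2.2.trans h₂.symm)

end NSOperad

namespace SymOperad

open NSOperad (ParallelFamily Mor)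

/-- The generators of `arrows n S`. -/
def arrowsFamily (n : ℕ) (S : Set ℕ) : ParallelFamily n S (arrows.{u} n S).toNSOperad :=
  ⟨fun i => ULift.up i.succ, ULift.up 0,
    fun s => ⟨ULift.up s, Or.inr ⟨List.Perm.refl _, rfl, s.2⟩⟩⟩

/-- A reordering of the inputs `1, …, n` of a generator comes from a permutation. -/
theorem exists_equiv_of_perm_arrowInputs {n m : ℕ} {p : Fin m → ULift.{u} (Fin (n + 1))}
    (h : (List.ofFn p).Perm (arrowInputs n)) :
    ∃ σ : Fin m ≃ Fin n, ∀ i, p i = ULift.up (σ i).succ := by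
  obtain rfl : m = n := by simpa [arrowInputs] using h.length_eq
  have (i : Fin m) : ∃ j : Fin m, ULift.up j.succ = p i := by
    have hi : p i ∈ arrowInputs m := h.mem_iff.1 (List.mem_ofFn.2 ⟨i, rfl⟩)
    exact List.mem_ofFn.1 hi
  choose σ hσ using this
  have hnodup : (List.ofFn p).Nodup := h.nodup_iff.2 (List.nodup_ofFn.2 fun i j hij =>
    Fin.succ_injective _ (congrArg ULift.down hij))
  have hinj : Function.Injective σ := fun i j hij => List.nodup_ofFn.1 hnodup (by
    rw [← hσ i, ← hσ j, hij])
  exact ⟨Equiv.ofBijective σ (Finite.injective_iff_bijective.1 hinj), fun i => (hσ i).symm⟩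

theorem act_heq {P : SymOperad.{u}} {m m' n n' : ℕ} {σ : Fin m ≃ Fin n}
    {σ' : Fin m' ≃ Fin n'} {p : Fin n → P.Ob} {p' : Fin n' → P.Ob} {b b' : P.Ob}
    (hp : List.ofFn p = List.ofFn p') (hb : b = b') {ψ : P.Hom p b} {ψ' : P.Hom p' b'}
    (hψ : HEq ψ ψ') (hσ : ∀ i i', i.val = i'.val → (σ i).val = (σ' i').val) :
    HEq (P.act σ ψ) (P.act σ' ψ') :=
  ActOperad.act_heq (P := toAct.obj P) trivial hp hb hψ hσ

theorem singleton_not_perm_arrowInputs {n : ℕ} : ¬ [ULift.up 0].Perm (arrowInputs.{u} n) :=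
  fun h => zero_not_mem_arrowInputs n (h.mem_iff.1 (List.mem_singleton_self _))

/-- Every family of parallel morphisms is the image of the generators of `arrows n S`. The non-identity
morphisms of `arrows n S` are the permuted generators, and the permutation is determined by the
inputs, as these are distinct. -/
theorem exists_map_arrows {n : ℕ} {S : Set ℕ} {Q : SymOperad.{u}}
    (x : ParallelFamily n S Q.toNSOperad) :
    ∃ F : arrows n S ⟶ Q, (arrowsFamily n S).map F.toMap = x := by
  have (m : ℕ) (p : Fin m → ULift.{u} (Fin (n + 1))) (b : ULift.{u} (Fin (n + 1)))
      (ψ : (arrows n S).Hom p b) : ∃ χ : Q.Hom (fun i => x.ob (p i)) (x.ob b),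
      (List.ofFn p = [b] → HEq χ (Q.id (x.ob b))) ∧ ∀ σ : Fin m ≃ Fin n,
        (∀ i, p i = ULift.up (σ i).succ) → b = ULift.up 0 →
        ∀ s : S, ψ.1.down = s → HEq χ (Q.act σ (x.hom s)) := by
    obtain ⟨y, hy⟩ := ψ
    rcases hy with ⟨hp, -⟩ | ⟨hp, rfl, hs⟩
    · refine ⟨NSOperad.castHom (ofFn_comp_of_singleton x.ob hp).symm rfl (Q.id (x.ob b)),
        fun _ => NSOperad.castHom_heq _ _ _, ?_⟩
      rintro σ hσ rfl
      obtain rfl : m = 1 := eq_one_of_ofFn_eq_singleton hp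
      have h0 : p 0 = ULift.up 0 := by simpa using hp
      exact (Fin.succ_ne_zero (σ 0) (congrArg ULift.down ((hσ 0).symm.trans h0))).elim
    · obtain ⟨σ, hσ⟩ := exists_equiv_of_perm_arrowInputs hp
      obtain rfl : p = fun i => ULift.up (σ i).succ := funext hσ
      refine ⟨Q.act σ (x.hom ⟨_, hs⟩), fun hp' => (singleton_not_perm_arrowInputs (hp' ▸ hp)).elim,
        fun σ' hσ' _ s hs' => ?_⟩
      obtain rfl : (⟨_, hs⟩ : S) = s := Subtype.ext hs'
      obtain rfl : σ = σ' := Equiv.ext fun i =>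
        Fin.succ_injective _ (congrArg ULift.down (hσ' i))
      rfl
  choose m hm hm' using this
  let F : NSOperad.Map (arrows n S).toNSOperad Q.toNSOperad :=
    Labelling.lift _ x.ob (fun ψ => m _ _ _ ψ) (fun ψ => hm _ _ _ ψ) fun {_ p b y} hy => by
      rcases hy with ⟨hp, hy⟩ | ⟨hp, -⟩
      · exact Or.inl ⟨hp, ulift_eq_zero hy⟩
      · refine Or.inr fun i k q y hy => ?_
        rcases hy with ⟨hq, hy⟩ | ⟨-, hi, -⟩
        · exact ⟨hq, ulift_eq_zero hy⟩
        · refine (zero_not_mem_arrowInputs n ?_).elim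
          rw [← hi, ← hp.mem_iff]
          exact List.mem_ofFn.2 ⟨i, rfl⟩
  refine ⟨SymOperad.Map.mk F fun {l k} τ p b ψ => ?_,
    ParallelFamily.ext_heq (fun _ => rfl) rfl fun s => ?_⟩
  · obtain ⟨y, hy⟩ := ψ
    have hy₀ := hy
    rcases hy₀ with ⟨hp, -⟩ | ⟨hp, rfl, hs⟩
    · have hk : k = 1 := eq_one_of_ofFn_eq_singleton hp
      have hτ : List.ofFn (fun i => p (τ i)) = List.ofFn p :=
        (List.perm_singleton.1 ((perm_ofFn_comp τ p).trans (List.Perm.of_eq hp))).trans hp.symm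
      exact eq_of_heq ((F.map_heq hτ rfl ((arrows n S).act_heq_of_unary hk τ _)).trans
        (Q.act_heq_of_unary hk τ _).symm)
    · obtain ⟨σ, hσ⟩ := exists_equiv_of_perm_arrowInputs hp
      have h₁ := hm' _ _ _ ((arrows n S).act τ ⟨y, hy⟩) (τ.trans σ) (fun i => hσ (τ i)) rfl
        ⟨_, hs⟩ rfl
      have h₂ := hm' _ _ _ ⟨y, hy⟩ σ hσ rfl ⟨_, hs⟩ rfl
      refine eq_of_heq (h₁.trans ?_)
      rw [← Q.act_act]
      refine act_heq ?_ rfl h₂.symm fun i i' hi => by rw [Fin.ext hi]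
      obtain rfl : p = fun i => ULift.up (σ i).succ := funext hσ
      rfl
  · refine (hm' _ _ _ _ (Equiv.refl _) (fun _ => rfl) rfl s rfl).trans ?_
    rw [Q.act_refl]
    exact HEq.rfl

/-- `arrows n S` corepresents the families of parallel `n`-ary morphisms indexed by `S`. -/
theorem bijective_map_arrows (n : ℕ) (S : Set ℕ) (Q : SymOperad.{u}) :
    Function.Bijective fun F : arrows n S ⟶ Q =>
      (forget ⋙ NSOperad.parallel n S).map F (arrowsFamily n S) := by
  refine ⟨fun F G h => ?_, exists_map_arrows⟩
  have ho : ∀ a, F.toMap.obj a = G.toMap.obj a := NSOperad.arrows_obj_eq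
    (congrArg ParallelFamily.target h)
    fun i => congrFun (congrArg ParallelFamily.inputs h) i
  refine SymOperad.hom_ext (NSOperad.Map.ext_heq ho fun {m p b} ψ => ?_)
  obtain ⟨y, hy⟩ := ψ
  have hy₀ := hy
  rcases hy₀ with ⟨hp, hy'⟩ | ⟨hp, rfl, hs⟩
  · have hp' : List.ofFn p = List.ofFn fun _ : Fin 1 => b := hp.trans (ofFn_one fun _ => b).symm
    have hψ : HEq (⟨y, hy⟩ : (arrows n S).Hom p b) ((arrows n S).id b) :=
      label_heq (P := ArrowHom n S) hp' (ulift_eq_zero hy')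
    have h₁ := (F.toMap.map_heq hp' rfl hψ).trans (heq_of_eq (F.map_id b))
    have h₂ := (G.toMap.map_heq hp' rfl hψ).trans (heq_of_eq (G.map_id b))
    exact h₁.trans ((NSOperad.id_heq (ho b)).trans h₂.symm)
  · obtain ⟨σ, hσ⟩ := exists_equiv_of_perm_arrowInputs hp
    obtain rfl : p = fun i => ULift.up (σ i).succ := funext hσ
    have hψ : (⟨y, hy⟩ : (arrows n S).Hom _ (ULift.up 0)) =
        (arrows n S).act σ ((arrowsFamily n S).hom ⟨_, hs⟩) := rfl
    have h₃ := congrArg (fun z : ParallelFamily n S Q.toNSOperad => Mor.mk (z.hom ⟨_, hs⟩)) h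
    obtain ⟨h₄, h₅, h₆⟩ := Mor.heq_of_mk_eq h₃
    rw [hψ]
    refine (heq_of_eq (F.map_act σ _)).trans (HEq.trans ?_ (heq_of_eq (G.map_act σ _)).symm)
    exact act_heq (congrArg List.ofFn h₄) h₅ h₆ fun i i' hi => by rw [Fin.ext hi]

end SymOperad

/-! ### Cofibrant generation -/

instance : HasLimits NSOperad.{u} :=
  Adjunction.has_limits_of_equivalence NSOperad.toAct

instance : HasColimits NSOperad.{u} :=
  Adjunction.has_colimits_of_equivalence NSOperad.toAct

instance : HasLimits SymOperad.{u} :=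
  Adjunction.has_limits_of_equivalence SymOperad.toAct

instance : HasColimits SymOperad.{u} :=
  Adjunction.has_colimits_of_equivalence SymOperad.toAct

section FilteredColimits

variable {J : Type u} [SmallCategory J] [IsFiltered J]

theorem NSOperad.preservesColimit_ob (F : J ⥤ NSOperad.{u}) :
    PreservesColimit F (𝟭 NSOperad.{u} ⋙ NSOperad.ob) :=
  inferInstanceAs (PreservesColimit F (NSOperad.toAct ⋙ ActOperad.forget ⋙ NSOperad.ob))

theorem NSOperad.preservesColimit_mor (F : J ⥤ NSOperad.{u}) :
    PreservesColimit F (𝟭 NSOperad.{u} ⋙ NSOperad.mor) :=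
  inferInstanceAs (PreservesColimit F (NSOperad.toAct ⋙ ActOperad.forget ⋙ NSOperad.mor))

theorem SymOperad.preservesColimit_ob (F : J ⥤ SymOperad.{u}) :
    PreservesColimit F (SymOperad.forget ⋙ NSOperad.ob) :=
  inferInstanceAs (PreservesColimit F (SymOperad.toAct ⋙ ActOperad.forget ⋙ NSOperad.ob))

theorem SymOperad.preservesColimit_mor (F : J ⥤ SymOperad.{u}) :
    PreservesColimit F (SymOperad.forget ⋙ NSOperad.mor) :=
  inferInstanceAs (PreservesColimit F (SymOperad.toAct ⋙ ActOperad.forget ⋙ NSOperad.mor))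

end FilteredColimits

namespace NSOperad

/-- A model structure whose classes are those of the underlying functors of operads is cofibrantly
generated by any functors with the universal properties of `∅ ⟶ ⋆`, `∂Ar_n ⟶ Ar_n`,
`PAr_n ⟶ Ar_n` and `⋆ ⟶ H`. -/
theorem isCofibrantlyGeneratedModelStructure_of_corepresentableBy {C : Type w} [Category.{u} C]
    [HasLimits C] [HasColimits C] [M : ModelCategory C] (U : C ⥤ NSOperad.{u})
    (hW : weakEquivalences C = equivalences.inverseImage U)
    (hF : fibrations C = isofibrations.inverseImage U)
    (hob : ∀ {J : Type u} [SmallCategory J] [IsFiltered J] (F : J ⥤ C),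
      PreservesColimit F (U ⋙ ob))
    (hmor : ∀ {J : Type u} [SmallCategory J] [IsFiltered J] (F : J ⥤ C),
      PreservesColimit F (U ⋙ mor))
    {empty star H : C} {arrows : ℕ → Set ℕ → C}
    (α : ((Functor.const C).obj PUnit.{u + 1}).CorepresentableBy empty)
    (β : (U ⋙ ob).CorepresentableBy star) (γ : (U ⋙ isos).CorepresentableBy H)
    (δ : ∀ (n : ℕ) (S : Set ℕ), (U ⋙ parallel n S).CorepresentableBy (arrows n S))
    (emptyToStar : empty ⟶ star) (starToIso : star ⟶ H) (e : Bool)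
    (hiso : ∀ (X : C) (g : H ⟶ X),
      β.homEquiv (starToIso ≫ g) = endpoint e (P := U.obj X) (γ.homEquiv g))
    (boundary : ∀ n, arrows n ∅ ⟶ arrows n {0})
    (hboundary : ∀ n, ∃ f : (∅ : Set ℕ) → ({0} : Set ℕ), ∀ (X : C) (g : arrows n {0} ⟶ X),
      (δ n ∅).homEquiv (boundary n ≫ g) =
        ParallelFamily.comap f (P := U.obj X) ((δ n {0}).homEquiv g))
    (fold : ∀ n, arrows n {0, 1} ⟶ arrows n {0})
    (hfold : ∀ n, ∃ f : ({0, 1} : Set ℕ) → ({0} : Set ℕ), ∀ (X : C) (g : arrows n {0} ⟶ X),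
      (δ n {0, 1}).homEquiv (fold n ≫ g) =
        ParallelFamily.comap f (P := U.obj X) ((δ n {0}).homEquiv g)) :
    IsCofibrantlyGeneratedModelStructure (equivalences.inverseImage U) (cofibrations C)
      (isofibrations.inverseImage U)
      (MorphismProperty.ofHoms (fun _ : Unit => emptyToStar) ⊔ MorphismProperty.ofHoms boundary ⊔
        MorphismProperty.ofHoms fold)
      (MorphismProperty.ofHoms fun _ : Unit => starToIso) := by
  have h₁ : MorphismProperty.IsSmall.{u} (MorphismProperty.ofHoms fun _ : Unit => emptyToStar) :=
    MorphismProperty.isSmall_ofHoms _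
  have h₂ : MorphismProperty.IsSmall.{u} (MorphismProperty.ofHoms boundary) :=
    MorphismProperty.isSmall_ofHoms _
  have h₃ : MorphismProperty.IsSmall.{u} (MorphismProperty.ofHoms fold) :=
    MorphismProperty.isSmall_ofHoms _
  have h₄ : MorphismProperty.IsSmall.{u} (MorphismProperty.ofHoms fun _ : Unit => starToIso) :=
    MorphismProperty.isSmall_ofHoms _
  refine ⟨inferInstance, inferInstance, M, hW, rfl, hF, ?_, ?_, ?_, ?_⟩
  · have := isSmall_sup.{u} (MorphismProperty.ofHoms (fun _ : Unit => emptyToStar))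
      (MorphismProperty.ofHoms boundary)
    have := isSmall_sup.{u} (MorphismProperty.ofHoms (fun _ : Unit => emptyToStar) ⊔
      MorphismProperty.ofHoms boundary) (MorphismProperty.ofHoms fold)
    refine hasSmallObjectArgument_of_preservesColimit _ fun i hi J _ _ F => ?_
    have := hob F
    have := hmor F
    rcases hi with (⟨⟨⟩⟩ | ⟨⟨n⟩⟩) | ⟨⟨n⟩⟩
    · exact preservesColimit_coyoneda α
    · exact preservesColimit_coyoneda (δ _ _)
    · exact preservesColimit_coyoneda (δ _ _)
  · refine hasSmallObjectArgument_of_preservesColimit _ fun i hi J _ _ F => ?_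
    have := hob F
    obtain ⟨⟩ := hi
    exact preservesColimit_coyoneda β
  · ext X Y F
    rw [trivialFibrations, hF, hW, rlp_sup, rlp_sup, rlp_ofHoms, rlp_ofHoms, rlp_ofHoms]
    refine (isofibrations_inf_equivalences_iff (U.map F)).trans ?_
    have hb (n : ℕ) : HasLiftingProperty (boundary n) F ↔ _ :=
      hasLiftingProperty_iff_map_surjective F (δ n ∅) (δ n {0}) _ (hboundary n).choose_spec
    have hf (n : ℕ) : HasLiftingProperty (fold n) F ↔ _ :=
      hasLiftingProperty_iff_map_injective F (δ n {0, 1}) (δ n {0}) _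
        (a := ⟨0, Or.inl rfl⟩) (b := ⟨1, Or.inr rfl⟩) (fun h => zero_ne_one (congrArg Subtype.val h))
        (by rintro ⟨s, rfl | rfl⟩ <;> simp) (hfold n).choose_spec
    simp only [hb, hf, hasLiftingProperty_iff_surjective F α β]
    exact ⟨fun h => ⟨⟨fun _ => h.1, fun n p b => (h.2 p b).2⟩, fun n p b => (h.2 p b).1⟩,
      fun h => ⟨h.1.1 (), fun {n} p b => ⟨h.2 n p b, h.1.2 n p b⟩⟩⟩
  · ext X Y F
    rw [hF, rlp_ofHoms, hasLiftingProperty_iff_isofibrations F β γ e hiso]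
    exact ⟨fun h _ => h, fun h => h ()⟩

end NSOperad

theorem mainTheorem3 (e : Bool) :
    IsCofibrantlyGeneratedModelStructure
      NSOperad.equivalences.{u} NSOperad.injectiveOnObjects.{u} NSOperad.isofibrations.{u}
      NSOperad.generatingCofibrations.{u} (NSOperad.generatingTrivialCofibrations.{u} e) ∧
    IsCofibrantlyGeneratedModelStructure
      SymOperad.equivalences.{u} SymOperad.injectiveOnObjects.{u} SymOperad.isofibrations.{u}
      SymOperad.generatingCofibrations.{u} (SymOperad.generatingTrivialCofibrations.{u} e) := by
  constructor
  · let _ := NSOperad.modelCategory.{u}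
    exact NSOperad.isCofibrantlyGeneratedModelStructure_of_corepresentableBy (𝟭 NSOperad.{u}) rfl rfl
      NSOperad.preservesColimit_ob NSOperad.preservesColimit_mor
      (corepresentableByOfBijective PUnit.unit NSOperad.bijective_map_empty)
      (corepresentableByOfBijective (A := NSOperad.unaryIndiscrete PUnit) PUnit.unit
        NSOperad.bijective_map_star)
      (corepresentableByOfBijective NSOperad.freeIso NSOperad.bijective_map_freeIso)
      (fun n S => corepresentableByOfBijective (NSOperad.arrowsFamily n S)
        (NSOperad.bijective_map_arrows n S))
      NSOperad.emptyToStar (NSOperad.starToIso e) e (fun X g => by cases e <;> rfl)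
      NSOperad.boundaryInclusion (fun n => ⟨fun s => (Set.notMem_empty _ s.2).elim, fun X g =>
        NSOperad.ParallelFamily.ext_heq (fun _ => rfl) rfl fun s => (Set.notMem_empty _ s.2).elim⟩)
      NSOperad.foldParallel (fun n => ⟨fun _ => ⟨0, rfl⟩, fun X g => rfl⟩)
  · let _ := SymOperad.modelCategory.{u}
    exact NSOperad.isCofibrantlyGeneratedModelStructure_of_corepresentableBy SymOperad.forget.{u}
      rfl rfl SymOperad.preservesColimit_ob SymOperad.preservesColimit_mor
      (corepresentableByOfBijective PUnit.unit fun Q => (NSOperad.bijective_map_empty _).comp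
        (SymOperad.bijective_toMap_unaryIndiscrete Q))
      (corepresentableByOfBijective (A := SymOperad.unaryIndiscrete PUnit) PUnit.unit fun Q =>
        (NSOperad.bijective_map_star _).comp
        (SymOperad.bijective_toMap_unaryIndiscrete Q))
      (corepresentableByOfBijective (A := SymOperad.unaryIndiscrete (ULift.{u} Bool))
        NSOperad.freeIso fun Q => (NSOperad.bijective_map_freeIso _).comp
        (SymOperad.bijective_toMap_unaryIndiscrete Q))
      (fun n S => corepresentableByOfBijective (A := SymOperad.arrows n S)
        (SymOperad.arrowsFamily n S)
        (SymOperad.bijective_map_arrows n S))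
      SymOperad.emptyToStar (SymOperad.starToIso e) e (fun X g => by cases e <;> rfl)
      SymOperad.boundaryInclusion (fun n => ⟨fun s => (Set.notMem_empty _ s.2).elim, fun X g =>
        NSOperad.ParallelFamily.ext_heq (fun _ => rfl) rfl fun s => (Set.notMem_empty _ s.2).elim⟩)
      SymOperad.foldParallel (fun n => ⟨fun _ => ⟨0, rfl⟩, fun X g => rfl⟩)
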